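/- Let $p$ be a prime and let $k$ be an algebraically closed field of characteristic $p$. Let $G$ be a finite group which is the semi-direct product of a normal $p$-subgroup $P$ by a cyclic subgroup $C$ of order prime to $p$. **Bertin obstruction.** Let $\mathrm{Aut}_k(k[[t]])$ be the group of continuous $k$-algebra automorphisms of $k[[t]]$, and let $\phi : G \to \mathrm{Aut}_k(k[[t]])$ be an injective homomorphism. Its Artin character $a_\phi$ is given by $a_\phi(g) = -\mathrm{ord}_t(\phi(g)(t)-t)$ for $g \ne 1$ and $a_\phi(1) = -\sum_{g\neq 1} a_\phi(g)$. The Bertin obstruction of $\phi$ vanishes if there are a finite $G$-set $S$, all of whose point stabilizers are non-trivial and cyclic, and an integer $m$ such that $$\chi_S = m\cdot \mathrm{reg}_G - a_\phi,$$ where $\chi_S$ is the character of the permutation representation of $G$ on $S$ and $\mathrm{reg}_G$ is the character of the regular representation. The group $G$ is a weak Bertin group for $k$ if there is at least one such $\phi$ whose Bertin obstruction vanishes. **Green–Matignon groups.** For subgroups $H, K \le G$ write $\mathrm{C}_H(K)$ and $\mathrm{N}_H(K)$ for the centralizer and the normalizer of $K$ in $H$. Let $B$ be the maximal subgroup of $C$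 of order dividing $p-1$. The group $G = P \rtimes C$ is a Green–Matignon (GM) group for $k$ if there is a faithful (i.e. injective) character $\Theta : B \to \mathbb{Z}_p^*$ such that (a) if $1 \neq c \in C$, then $\mathrm{C}_P(c) = \mathrm{C}_P(C)$ and this group is cyclic; (b) if $T$ is a cyclic subgroup of $P$ for which $\mathrm{C}_C(T)$ is trivial, then $xyx^{-1} = y^{\Theta(x)}$ for all $y \in T$ and $x \in \mathrm{N}_B(T)$. (For $y$ of order $p^n$ and $z \in \mathbb{Z}_p$, $y^z$ means $y^a$ for any integer $a \equiv z \bmod p^n$.) **Theorem.** There is an injection $\phi : G \to \mathrm{Aut}_k(k[[t]])$ which has vanishing Bertin obstruction if and only if $G$ is a GM group for $k$. Thus $G$ is a weak Bertin group for $k$ if and only if it is a GM group for $k$. -/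

import Mathlib

open scoped PowerSeries

noncomputable section

namespace BertinObstruction

/-- The group `Aut_k(k[[t]])`. Every `k`-algebra automorphism of `k[[t]]` is automatically continuous
for the `t`-adic topology (see `X_pow_dvd_apply_iff`), so this is the group of continuous
`k`-algebra automorphisms. -/
abbrev AutPowerSeries (k : Type*) [Field k] : Type _ := k⟦X⟧ ≃ₐ[k] k⟦X⟧

/-- A `k`-algebra automorphism of `k[[t]]` maps each ideal `(t ^ n)` onto itself. -/
theorem X_pow_dvd_apply_iff {k : Type*} [Field k] (σ : AutPowerSeries k) (n : ℕ) (f : k⟦X⟧) :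
    (PowerSeries.X : k⟦X⟧) ^ n ∣ σ f ↔ (PowerSeries.X : k⟦X⟧) ^ n ∣ f := by
  have key : ∀ τ : AutPowerSeries k, (PowerSeries.X : k⟦X⟧) ∣ τ PowerSeries.X := by
    intro τ
    by_contra h
    rw [PowerSeries.X_dvd_iff] at h
    have hu : IsUnit (τ PowerSeries.X) := by
      rw [PowerSeries.isUnit_iff_constantCoeff]
      exact isUnit_iff_ne_zero.mpr h
    exact PowerSeries.X_prime.not_isUnit ((MulEquiv.isUnit_map τ.toMulEquiv).mp hu)
  have key2 : ∀ (τ : AutPowerSeries k) (g : k⟦X⟧), (PowerSeries.X : k⟦X⟧) ^ n ∣ g →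
      (PowerSeries.X : k⟦X⟧) ^ n ∣ τ g := by
    intro τ g hg
    have h1 := map_dvd τ hg
    rw [map_pow] at h1
    exact (pow_dvd_pow_of_dvd (key τ) n).trans h1
  refine ⟨fun h => ?_, key2 σ f⟩
  have h2 := key2 σ.symm (σ f) h
  rwa [AlgEquiv.symm_apply_apply] at h2

/-- The ramification function `i_φ(g) = ord_t (φ(g)(t) - t)`. It is only used for `φ` injective and
`g ≠ 1`; then `φ(g)(t) ≠ t`, so the order is finite. -/
def ramIndex {k : Type*} [Field k] {G : Type*} [Group G] (φ : G →* AutPowerSeries k) (g : G) : ℕ :=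
  (φ g PowerSeries.X - PowerSeries.X).order.toNat

open Classical in
/-- The Artin character `a_φ` of an injection `φ : G → Aut_k(k[[t]])`: `a_φ(g) = -i_φ(g)` for `g ≠ 1`,
and `a_φ(1) = ∑_{g ≠ 1} i_φ(g)`. The residue degree is `1` since `G` acts trivially on the residue
field `k`. -/
def artinCharacter {k : Type*} [Field k] {G : Type*} [Group G] (φ : G →* AutPowerSeries k) (g : G) :
    ℤ :=
  if g = 1 then ∑ᶠ (h : G) (_ : h ≠ 1), (ramIndex φ h : ℤ) else -(ramIndex φ g : ℤ)

/-- The character `χ_S` of the permutation representation on a finite `G`-set `S`: the trace of the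
permutation matrix of `g` is the number of points of `S` fixed by `g`. -/
def permCharacter (G : Type*) [Group G] (S : Type*) [MulAction G S] (g : G) : ℤ :=
  (Nat.card (MulAction.fixedBy S g) : ℤ)

/-- The character of the regular representation of `G`, i.e. of `G` acting on itself by left
multiplication. -/
def regCharacter (G : Type*) [Group G] (g : G) : ℤ := permCharacter G G g

/-- The Bertin obstruction of `φ` vanishes: there is a finite `G`-set `S`, all of whose point
stabilizers are non-trivial and cyclic, with `χ_S = m • reg_G - a_φ` for some integer `m`. -/
def BertinObstructionVanishes {k : Type*} [Field k] {G : Type*} [Group G]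
    (φ : G →* AutPowerSeries k) : Prop :=
  ∃ (S : Type) (_ : Finite S) (_ : MulAction G S),
    (∀ s : S, MulAction.stabilizer G s ≠ ⊥ ∧ IsCyclic (MulAction.stabilizer G s)) ∧
    ∃ m : ℤ, ∀ g : G, permCharacter G S g = m * regCharacter G g - artinCharacter φ g

/-- `G` is a weak Bertin group for `k`: some injection `φ : G → Aut_k(k[[t]])` has vanishing Bertin
obstruction. -/
def IsWeakBertinGroup (k : Type*) [Field k] (G : Type*) [Group G] : Prop :=
  ∃ φ : G →* AutPowerSeries k, Function.Injective φ ∧ BertinObstructionVanishes φ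

/-- The power `y ^ z` of an element `y` of `p`-power order `p ^ n` with a `p`-adic integer exponent
`z`: it is `y ^ a` for any natural number `a ≡ z` modulo `p ^ n`. -/
def padicPow (p : ℕ) [Fact p.Prime] {G : Type*} [Group G] (y : G) (z : ℤ_[p]) : G :=
  y ^ (z.appr (padicValNat p (orderOf y)))

/-- `G = P ⋊ C` (internally) is a Green-Matignon group: `B` is the maximal subgroup of `C` of order
dividing `p - 1`, and there is a faithful character `Θ : B → ℤ_pˣ` with properties (a) and (b).
Here `C_P(c) = P ⊓ centralizer {c}`, `C_P(C) = P ⊓ centralizer C`, `C_C(T) = C ⊓ centralizer T` and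
`N_B(T) = B ⊓ normalizer T`. -/
def IsGreenMatignon (p : ℕ) [Fact p.Prime] {G : Type*} [Group G] (P C : Subgroup G) : Prop :=
  ∃ B : Subgroup G, IsGreatest {H : Subgroup G | H ≤ C ∧ Nat.card H ∣ p - 1} B ∧
  ∃ Θ : B →* (ℤ_[p])ˣ, Function.Injective Θ ∧
    (∀ c ∈ C, c ≠ 1 →
      P ⊓ Subgroup.centralizer {c} = P ⊓ Subgroup.centralizer (C : Set G) ∧
      IsCyclic (P ⊓ Subgroup.centralizer {c} : Subgroup G)) ∧
    (∀ T : Subgroup G, T ≤ P → IsCyclic T → C ⊓ Subgroup.centralizer (T : Set G) = ⊥ →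
      ∀ x : B, (x : G) ∈ Subgroup.normalizer (T : Set G) →
        ∀ y ∈ T, (x : G) * y * (x : G)⁻¹ = padicPow p y (Θ x : ℤ_[p]))

end BertinObstruction

end

/-!
The theorem compares two conditions on `G = P ⋊ C`, and both directions rest on one reformulation:
by Burnside's lemma the Bertin obstruction of `φ` vanishes if and only if there is a finite `G`-set
`S` with nontrivial cyclic stabilizers in which every `g ≠ 1` has exactly
`i(g) = ord (φ(g)(t) - t)` fixed points (`exists_card_fixedBy_eq`,
`bertinObstructionVanishes_of_gset`). Two facts on ramification link this to the group structure.
The tame character `θ`, the action of `G` on the cotangent space of `k⟦t⟧`, has kernel `P`, so that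
`i(g) = 1` for `g ∉ P`; and if `x g x⁻¹ = g ^ a` with `1 ≠ g ∈ P`, then `a = θ(x) ^ (i(g) - 1)` in
`k` (`conj_exponent_eq`).

If the obstruction vanishes, every `c ≠ 1` in `C` fixes exactly one point of `S`, and the
centralizer of `c` lies in the cyclic stabilizer of this point; this is (a). For `T = ⟨t⟩ ≤ P`
centralized by no nontrivial element of `C`, an element `x` normalizing `T` acts freely on the
`i(t)` points fixed by `T`, so its order divides `i(t)` and `a = θ(x)⁻¹` in `k`; this is (b), with
`Θ` the Teichmüller lift of `θ⁻¹` (`isGreenMatignon_of_bertinObstructionVanishes`).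

Conversely let `G` be a Green–Matignon group. The reduction of `Θ⁻¹` extends to a character
`θ : G → kˣ` with kernel `P`. It is the tame character of an action `φ` for which the numbers
`i(g)`, `1 ≠ g ∈ P`, are divisible by a high power of `p`, large, and fast growing along `g ↦ g ^ p`
(`exists_isStronglyRamified`). This `φ` is built as a tower of Artin–Schreier extensions, one for
each minimal normal subgroup in turn; each embedding problem is solvable since `k((t))` has trivial
additive cohomology, and the solution can be modified to have an arbitrarily large conductor. For
the set `S`, the coset space `S₀` of the centralizer of `C` takes care of the elements outside `P`.
A set whose stabilizers are nontrivial cyclic subgroups `T` of `P`, having `i(T) - |S₀ ^ T|` points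
fixed by each such `T`, exists once these numbers decrease fast and satisfy the congruences
of Burnside's lemma for the normalizers (`exists_gset`). The `p`-part of the congruences follows from
the divisibility of `i`. For the `p'`-part one needs `i(t) ≡ |S₀ ^ t|` modulo the order of any
`p'`-element `x` normalizing `⟨t⟩` (`fixCount_modEq_ramIndex`): if a nontrivial power of `x`
centralizes `t`, then by (a) so does `x`, and both numbers are `1`; otherwise the action of `x` on
`S₀ ^ t` is free, while (b) gives `θ(x) ^ i(t) = 1`, so both numbers are `0`.
-/

open scoped PowerSeries

noncomputable section

namespace BertinObstruction

open PowerSeries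

local notation "𝕂" => LaurentSeries

/-! ### Endomorphisms of a power series ring -/

section PowerSeriesMaps

variable {k : Type*} [Field k]

theorem constantCoeff_algHom_X (f : k⟦X⟧ →ₐ[k] k⟦X⟧) : constantCoeff (f X) = 0 := by
  by_contra h
  have h1 : IsUnit (X - C (constantCoeff (f X)) : k⟦X⟧) := by
    rw [PowerSeries.isUnit_iff_constantCoeff]
    simpa using h
  have h2 := h1.map f
  rw [PowerSeries.isUnit_iff_constantCoeff, map_sub, map_sub] at h2
  have h3 : f (C (constantCoeff (f X))) = C (constantCoeff (f X)) := f.commutes _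
  rw [h3] at h2
  simp at h2

theorem X_dvd_algHom_X (f : k⟦X⟧ →ₐ[k] k⟦X⟧) : (X : k⟦X⟧) ∣ f X := by
  rw [PowerSeries.X_dvd_iff]
  exact constantCoeff_algHom_X f

theorem algHom_C (f : k⟦X⟧ →ₐ[k] k⟦X⟧) (c : k) : f (C c) = C c := f.commutes c

theorem constantCoeff_algHom (f : k⟦X⟧ →ₐ[k] k⟦X⟧) (x : k⟦X⟧) :
    constantCoeff (f x) = constantCoeff x := by
  have h : (X : k⟦X⟧) ∣ x - C (constantCoeff x) := by
    rw [PowerSeries.X_dvd_iff]; simp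
  have h2 := (X_dvd_algHom_X f).trans (map_dvd f h)
  rw [PowerSeries.X_dvd_iff, map_sub, algHom_C] at h2
  simpa [sub_eq_zero] using h2

/-- Two endomorphisms that agree at `X` modulo `X ^ d` agree everywhere modulo `X ^ d`. -/
theorem X_pow_dvd_algHom_sub {f g : k⟦X⟧ →ₐ[k] k⟦X⟧} {d : ℕ} (h : X ^ d ∣ f X - g X) (x : k⟦X⟧) :
    X ^ d ∣ f x - g x := by
  induction d generalizing x with
  | zero => simp
  | succ n ih =>
    obtain ⟨y, hy⟩ : (X : k⟦X⟧) ∣ x - C (constantCoeff x) := by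
      rw [PowerSeries.X_dvd_iff]; simp
    have hx : x = C (constantCoeff x) + X * y := by rw [← hy]; ring
    have h1 := ih ((pow_dvd_pow _ n.le_succ).trans h) y
    rw [hx, map_add, map_add, map_mul, map_mul, algHom_C, algHom_C]
    have : C (constantCoeff x) + f X * f y - (C (constantCoeff x) + g X * g y)
        = f X * (f y - g y) + (f X - g X) * g y := by ring
    rw [this]
    refine dvd_add ?_ (h.mul_right _)
    rw [pow_succ']
    exact mul_dvd_mul (X_dvd_algHom_X f) h1

/-- An endomorphism is determined by the image of `X`; no continuity has to be assumed. -/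
theorem algHom_ext_X {f g : k⟦X⟧ →ₐ[k] k⟦X⟧} (h : f X = g X) : f = g := by
  ext x n
  have h1 : X ^ (n + 1) ∣ f x - g x :=
    X_pow_dvd_algHom_sub (by rw [h, sub_self]; exact dvd_zero _) x
  rw [X_pow_dvd_iff] at h1
  have := h1 n n.lt_succ_self
  rw [map_sub, sub_eq_zero] at this
  simpa using this

/-- The endomorphism of `k⟦X⟧` with `X ↦ X * r`. -/
def scaleHom (r : k⟦X⟧) : k⟦X⟧ →ₐ[k] k⟦X⟧ :=
  substAlgHom (HasSubst.of_constantCoeff_zero' (a := X * r) (by simp))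

@[simp] theorem scaleHom_X (r : k⟦X⟧) : scaleHom r X = X * r := substAlgHom_X _

theorem algHom_injective {f : k⟦X⟧ →ₐ[k] k⟦X⟧} (h : f X ≠ 0) : Function.Injective f := by
  rw [injective_iff_map_eq_zero]
  intro x hx
  by_contra h0
  obtain ⟨u, hu⟩ := (PowerSeries.X_pow_order_dvd (φ := x))
  have h1 : constantCoeff u ≠ 0 := by
    intro h2
    rw [← PowerSeries.X_dvd_iff] at h2
    have h3 : X ^ (x.order.toNat + 1) ∣ x := by
      rw [hu, pow_succ]
      conv_rhs => rw [hu]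
      exact mul_dvd_mul (dvd_of_eq (by rw [← hu])) h2
    have h4 := PowerSeries.X_pow_dvd_iff.mp h3 x.order.toNat (Nat.lt_succ_self _)
    exact PowerSeries.coeff_order h0 h4
  rw [hu, map_mul, map_pow] at hx
  rcases mul_eq_zero.mp hx with h2 | h2
  · exact pow_ne_zero _ h h2
  · apply h1
    rw [← constantCoeff_algHom f, h2, map_zero]

theorem scaleHom_injective {r : k⟦X⟧} (h : r ≠ 0) : Function.Injective (scaleHom r) :=
  algHom_injective (by rw [scaleHom_X]; exact mul_ne_zero X_ne_zero h)

theorem scaleHom_surjective {r : k⟦X⟧} (h : constantCoeff r ≠ 0) :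
    Function.Surjective (scaleHom r) := by
  have h1 : constantCoeff (X * r : k⟦X⟧) = 0 := by simp
  have h2 : IsUnit (coeff 1 (X * r : k⟦X⟧)) := by
    rw [show (1 : ℕ) = 0 + 1 from rfl, PowerSeries.coeff_succ_X_mul]
    simpa using h
  set s := substInvOfIsUnit (X * r) h2 with hs
  have hs0 : HasSubst s := HasSubst.substInvOfIsUnit _ _
  have hs1 : (scaleHom r) s = X := by
    rw [scaleHom, coe_substAlgHom]
    exact subst_substInvOfIsUnit_left _ h1 h2
  intro y
  have hcomp : (scaleHom r).comp (substAlgHom hs0) = AlgHom.id k _ := by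
    apply algHom_ext_X
    rw [AlgHom.comp_apply, substAlgHom_X]
    exact hs1
  exact ⟨substAlgHom hs0 y, DFunLike.congr_fun hcomp y⟩

/-! ### Roots of power series -/

/-- Roots of order prime to the characteristic lift from the constant term, by Hensel's lemma. -/
theorem exists_pow_eq_powerSeries {m : ℕ} (hm : (m : k) ≠ 0) {c : k} (hc : c ≠ 0) {u : k⟦X⟧}
    (hu : constantCoeff u = c ^ m) : ∃ r : k⟦X⟧, r ^ m = u ∧ constantCoeff r = c := by
  have hm0 : m ≠ 0 := by rintro rfl; simp at hm
  have hH : HenselianRing k⟦X⟧ (Ideal.span {X}) := inferInstance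
  obtain ⟨r, hr, hr2⟩ := hH.is_henselian (Polynomial.X ^ m - Polynomial.C u)
    (Polynomial.monic_X_pow_sub_C u hm0) (C c) (by
      rw [Ideal.mem_span_singleton, PowerSeries.X_dvd_iff]
      simp [hu]) (by
      apply IsUnit.map
      rw [PowerSeries.isUnit_iff_constantCoeff]
      simp [Polynomial.derivative_X_pow, hm, hc])
  refine ⟨r, ?_, ?_⟩
  · simpa [Polynomial.IsRoot, sub_eq_zero] using hr
  · rw [Ideal.mem_span_singleton, PowerSeries.X_dvd_iff] at hr2
    simpa [sub_eq_zero] using hr2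

/-- In characteristic `p` over a perfect field, substituting `X ^ q` turns every power series into a
`q`-th power. -/
theorem exists_pow_eq_expand (p : ℕ) [Fact p.Prime] [CharP k p] [PerfectRing k p] (f : ℕ)
    (hq : p ^ f ≠ 0) (u : k⟦X⟧) : ∃ r : k⟦X⟧, r ^ (p ^ f) = expand (p ^ f) hq u := by
  refine ⟨PowerSeries.map (iterateFrobeniusEquiv k p f).symm u, ?_⟩
  have h := MvPowerSeries.map_iterateFrobenius_expand p (Fact.out : p.Prime).ne_zero
    (PowerSeries.map ((iterateFrobeniusEquiv k p f).symm : k →+* k) u) f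
  refine h.symm.trans ?_
  change PowerSeries.map (iterateFrobenius k p f) (expand (p ^ f) hq _) = _
  rw [map_expand]
  congr 1
  ext n
  simp only [PowerSeries.coeff_map]
  exact (iterateFrobeniusEquiv k p f).apply_symm_apply _

/-! ### Leading terms of Laurent series -/

/-- The Laurent series `X`. -/
abbrev lX (k : Type*) [Field k] : 𝕂 k := ((X : k⟦X⟧) : 𝕂 k)

theorem lX_ne_zero : lX k ≠ 0 := by
  rw [lX, ← LaurentSeries.coe_algebraMap]
  exact (map_ne_zero_iff _ (IsFractionRing.injective k⟦X⟧ (𝕂 k))).mpr X_ne_zero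

theorem lC_injective : Function.Injective ((↑) : k⟦X⟧ → 𝕂 k) :=
  IsFractionRing.injective k⟦X⟧ (𝕂 k)

/-- `x = c X ^ n + (higher terms)`, where `c = 0` is allowed. -/
def HasLead (n : ℤ) (c : k) (x : 𝕂 k) : Prop :=
  ∃ u : k⟦X⟧, constantCoeff u = c ∧ x = lX k ^ n * (u : 𝕂 k)

/-- The `X`-adic order of `x` is at least `n`. -/
def OrdGE (n : ℤ) (x : 𝕂 k) : Prop := ∃ u : k⟦X⟧, x = lX k ^ n * (u : 𝕂 k)

/-- The `X`-adic order of `x` is exactly `n`. -/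
def OrdEq (n : ℤ) (x : 𝕂 k) : Prop := ∃ c : k, c ≠ 0 ∧ HasLead n c x

variable {n m : ℤ} {c d : k} {x y : 𝕂 k}

theorem HasLead.ordGE (h : HasLead n c x) : OrdGE n x := h.imp fun _ hu => hu.2

theorem OrdEq.ordGE (h : OrdEq n x) : OrdGE n x := h.choose_spec.2.ordGE

theorem OrdGE.exists_hasLead (h : OrdGE n x) : ∃ c, HasLead n c x :=
  h.elim fun u hu => ⟨_, u, rfl, hu⟩

theorem ordGE_zero : OrdGE n (0 : 𝕂 k) := ⟨0, by simp⟩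

theorem OrdGE.add (hx : OrdGE n x) (hy : OrdGE n y) : OrdGE n (x + y) := by
  obtain ⟨u, rfl⟩ := hx
  obtain ⟨v, rfl⟩ := hy
  exact ⟨u + v, by push_cast; ring⟩

theorem OrdGE.neg (hx : OrdGE n x) : OrdGE n (-x) := by
  obtain ⟨u, rfl⟩ := hx
  exact ⟨-u, by push_cast; ring⟩

theorem OrdGE.sub (hx : OrdGE n x) (hy : OrdGE n y) : OrdGE n (x - y) := by
  rw [sub_eq_add_neg]; exact hx.add hy.neg

theorem OrdGE.mono (hx : OrdGE n x) (h : m ≤ n) : OrdGE m x := by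
  obtain ⟨u, rfl⟩ := hx
  obtain ⟨e, rfl⟩ := Int.le.dest h
  refine ⟨X ^ e * u, ?_⟩
  rw [zpow_add₀ lX_ne_zero]
  push_cast
  simp [mul_assoc]

theorem HasLead.mul (hx : HasLead n c x) (hy : HasLead m d y) :
    HasLead (n + m) (c * d) (x * y) := by
  obtain ⟨u, rfl, rfl⟩ := hx
  obtain ⟨v, rfl, rfl⟩ := hy
  exact ⟨u * v, by simp, by rw [zpow_add₀ lX_ne_zero]; push_cast; ring⟩

theorem OrdGE.mul (hx : OrdGE n x) (hy : OrdGE m y) : OrdGE (n + m) (x * y) := by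
  obtain ⟨c, hc⟩ := hx.exists_hasLead
  obtain ⟨d, hd⟩ := hy.exists_hasLead
  exact (hc.mul hd).ordGE

theorem OrdEq.mul (hx : OrdEq n x) (hy : OrdEq m y) : OrdEq (n + m) (x * y) := by
  obtain ⟨c, hc0, hc⟩ := hx
  obtain ⟨d, hd0, hd⟩ := hy
  exact ⟨_, mul_ne_zero hc0 hd0, hc.mul hd⟩

theorem HasLead.add (hx : HasLead n c x) (hy : HasLead n d y) : HasLead n (c + d) (x + y) := by
  obtain ⟨u, rfl, rfl⟩ := hx
  obtain ⟨v, rfl, rfl⟩ := hy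
  exact ⟨u + v, by simp, by push_cast; ring⟩

theorem HasLead.neg (hx : HasLead n c x) : HasLead n (-c) (-x) := by
  obtain ⟨u, rfl, rfl⟩ := hx
  exact ⟨-u, by simp, by push_cast; ring⟩

theorem HasLead.sub (hx : HasLead n c x) (hy : HasLead n d y) : HasLead n (c - d) (x - y) := by
  rw [sub_eq_add_neg, sub_eq_add_neg]; exact hx.add hy.neg

theorem hasLead_zero_iff : HasLead n 0 x ↔ OrdGE (n + 1) x := by
  constructor
  · rintro ⟨u, hu, rfl⟩
    rw [← PowerSeries.X_dvd_iff] at hu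
    obtain ⟨v, rfl⟩ := hu
    exact ⟨v, by rw [zpow_add₀ lX_ne_zero]; push_cast; simp [mul_assoc]⟩
  · rintro ⟨v, rfl⟩
    exact ⟨X * v, by simp, by rw [zpow_add₀ lX_ne_zero]; push_cast; simp [mul_assoc]⟩

theorem HasLead.add_ordGE (hx : HasLead n c x) (hy : OrdGE m y) (h : n < m) :
    HasLead n c (x + y) := by
  have := hx.add (hasLead_zero_iff.mpr (hy.mono h))
  rwa [add_zero] at this

theorem OrdEq.add_ordGE (hx : OrdEq n x) (hy : OrdGE m y) (h : n < m) : OrdEq n (x + y) :=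
  hx.imp fun _ hc => ⟨hc.1, hc.2.add_ordGE hy h⟩

theorem OrdEq.sub_ordGE (hx : OrdEq n x) (hy : OrdGE m y) (h : n < m) : OrdEq n (x - y) := by
  rw [sub_eq_add_neg]; exact hx.add_ordGE hy.neg h

theorem hasLead_coe (u : k⟦X⟧) : HasLead 0 (constantCoeff u) (u : 𝕂 k) := ⟨u, rfl, by simp⟩

theorem ordGE_coe (u : k⟦X⟧) : OrdGE 0 (u : 𝕂 k) := (hasLead_coe u).ordGE

theorem hasLead_C (c : k) : HasLead 0 c (HahnSeries.C c : 𝕂 k) := ⟨C c, by simp, by simp⟩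

theorem hasLead_one : HasLead 0 (1 : k) (1 : 𝕂 k) := ⟨1, by simp, by simp⟩

theorem hasLead_lX_zpow (n : ℤ) : HasLead n 1 (lX k ^ n) := ⟨1, by simp, by simp⟩

theorem HasLead.pow (hx : HasLead n c x) (e : ℕ) : HasLead (e * n) (c ^ e) (x ^ e) := by
  induction e with
  | zero => simpa using hasLead_one
  | succ e ih =>
    rw [pow_succ, pow_succ]
    have := ih.mul hx
    rwa [show (e : ℤ) * n + n = ((e + 1 : ℕ) : ℤ) * n by push_cast; ring] at this

theorem OrdGE.pow (hx : OrdGE n x) (e : ℕ) : OrdGE (e * n) (x ^ e) := by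
  obtain ⟨c, hc⟩ := hx.exists_hasLead
  exact (hc.pow e).ordGE

theorem OrdEq.pow (hx : OrdEq n x) (e : ℕ) : OrdEq (e * n) (x ^ e) := by
  obtain ⟨c, hc0, hc⟩ := hx
  exact ⟨_, pow_ne_zero e hc0, hc.pow e⟩

theorem HasLead.inv (hx : HasLead n c x) (hc : c ≠ 0) : HasLead (-n) c⁻¹ x⁻¹ := by
  obtain ⟨u, rfl, rfl⟩ := hx
  refine ⟨u⁻¹, by simp, ?_⟩
  have h : (u : 𝕂 k) * ((u⁻¹ : k⟦X⟧) : 𝕂 k) = 1 := by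
    rw [← PowerSeries.coe_mul, PowerSeries.mul_inv_cancel _ hc]; simp
  rw [mul_inv, zpow_neg, eq_inv_of_mul_eq_one_right h]

theorem HasLead.zpow (hx : HasLead n c x) (hc : c ≠ 0) (e : ℤ) :
    HasLead (e * n) (c ^ e) (x ^ e) := by
  rcases e with e | e
  · simpa using hx.pow e
  · have := (hx.pow (e + 1)).inv (pow_ne_zero _ hc)
    rw [zpow_negSucc, zpow_negSucc]
    rwa [show Int.negSucc e * n = -(((e + 1 : ℕ) : ℤ) * n) by rw [Int.negSucc_eq]; push_cast; ring]

theorem exists_ordEq (hx : x ≠ 0) : ∃ n, OrdEq n x := by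
  have h := LaurentSeries.single_order_mul_powerSeriesPart x
  refine ⟨x.order, constantCoeff x.powerSeriesPart, ?_, x.powerSeriesPart, rfl, ?_⟩
  · rw [← coeff_zero_eq_constantCoeff_apply, LaurentSeries.powerSeriesPart_coeff]
    simpa using mt HahnSeries.coeff_order_eq_zero.mp hx
  · conv_lhs => rw [← h]
    congr 1
    rw [lX, PowerSeries.coe_X, RatFunc.single_zpow]

theorem HasLead.ne_zero (hx : HasLead n c x) (hc : c ≠ 0) : x ≠ 0 := by
  obtain ⟨u, rfl, rfl⟩ := hx
  refine mul_ne_zero (zpow_ne_zero _ lX_ne_zero) fun h => hc ?_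
  have : u = 0 := lC_injective (by rw [h]; simp)
  rw [this, map_zero]

theorem OrdEq.ne_zero (hx : OrdEq n x) : x ≠ 0 := by
  obtain ⟨c, hc0, hc⟩ := hx
  exact hc.ne_zero hc0

theorem HasLead.unique (hx : HasLead n c x) (hy : HasLead n d x) : c = d := by
  by_contra h
  have := (hx.sub hy).ne_zero (sub_ne_zero.mpr h)
  exact this (sub_self x)

theorem OrdEq.le (hx : OrdEq n x) (hy : OrdGE m x) : m ≤ n := by
  by_contra h
  obtain ⟨c, hc0, hc⟩ := hx
  exact hc0 (hc.unique (hasLead_zero_iff.mpr (hy.mono (by omega))))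

theorem OrdEq.unique (hx : OrdEq n x) (hy : OrdEq m x) : n = m :=
  le_antisymm (hy.le hx.ordGE) (hx.le hy.ordGE)

/-- Elements with the same leading term and the same `m`-th power, `m` invertible, are equal. -/
theorem eq_of_pow_eq {m : ℕ} (hm : (m : k) ≠ 0) (hc : c ≠ 0) (hx : HasLead n c x)
    (hy : HasLead n c y) (h : x ^ m = y ^ m) : x = y := by
  by_contra hxy
  obtain ⟨e, he⟩ := exists_ordEq (sub_ne_zero.mpr hxy)
  have h1 : HasLead ((m - 1 : ℕ) * n) (m * c ^ (m - 1))
      (∑ i ∈ Finset.range m, x ^ i * y ^ (m - 1 - i)) := by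
    have : ∀ s : Finset ℕ, s ⊆ Finset.range m →
        HasLead ((m - 1 : ℕ) * n) (s.card * c ^ (m - 1)) (∑ i ∈ s, x ^ i * y ^ (m - 1 - i)) := by
      intro s
      induction s using Finset.induction_on with
      | empty => intro _; simpa [hasLead_zero_iff] using ordGE_zero
      | insert i s hi ih =>
        intro hs
        rw [Finset.sum_insert hi, Finset.card_insert_of_notMem hi]
        have hi' : i < m := Finset.mem_range.mp (hs (Finset.mem_insert_self _ _))
        have h2 := ((hx.pow i).mul (hy.pow (m - 1 - i))).add
          (show HasLead (i * n + (m - 1 - i : ℕ) * n) _ _ from by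
            have := ih fun j hj => hs (Finset.mem_insert_of_mem hj)
            rwa [← add_mul, ← Nat.cast_add, show i + (m - 1 - i) = m - 1 by omega])
        rw [← add_mul, ← Nat.cast_add, ← pow_add, show i + (m - 1 - i) = m - 1 by omega] at h2
        convert h2 using 1
        push_cast; ring
    simpa using this _ subset_rfl
  have h2 := h1.ne_zero (mul_ne_zero hm (pow_ne_zero _ hc))
  have h3 := (Commute.all x y).geom_sum₂_mul m
  rw [h, sub_self] at h3
  rcases mul_eq_zero.mp h3 with h4 | h4
  · exact h2 h4
  · exact hxy (sub_eq_zero.mp h4)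

/-! ### Extending endomorphisms to Laurent series -/

/-- The extension of an injective endomorphism of `k⟦X⟧` to the fraction field. -/
def laurentMap (f : k⟦X⟧ →ₐ[k] k⟦X⟧) (hf : Function.Injective f) : 𝕂 k →+* 𝕂 k :=
  IsFractionRing.lift (A := k⟦X⟧) (K := 𝕂 k)
    (g := (algebraMap k⟦X⟧ (𝕂 k)).comp (f : k⟦X⟧ →+* k⟦X⟧))
    ((IsFractionRing.injective k⟦X⟧ (𝕂 k)).comp hf)

section laurentMap

variable {f g : k⟦X⟧ →ₐ[k] k⟦X⟧} {hf : Function.Injective f} {hg : Function.Injective g}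

@[simp] theorem laurentMap_coe (u : k⟦X⟧) :
    laurentMap f hf (u : 𝕂 k) = ((f u : k⟦X⟧) : 𝕂 k) :=
  IsFractionRing.lift_algebraMap _ u

@[simp] theorem laurentMap_C (c : k) : laurentMap f hf (HahnSeries.C c) = HahnSeries.C c := by
  have := laurentMap_coe (f := f) (hf := hf) (C c)
  rwa [algHom_C, PowerSeries.coe_C] at this

theorem ringHom_ext_laurent {F G : 𝕂 k →+* 𝕂 k}
    (h : ∀ u : k⟦X⟧, F (u : 𝕂 k) = G (u : 𝕂 k)) : F = G :=
  IsLocalization.ringHom_ext (nonZeroDivisors k⟦X⟧) (RingHom.ext h)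

theorem laurentMap_comp {hfg : Function.Injective (f.comp g)} (x : 𝕂 k) :
    laurentMap (f.comp g) hfg x = laurentMap f hf (laurentMap g hg x) := by
  have : laurentMap (f.comp g) hfg = (laurentMap f hf).comp (laurentMap g hg) :=
    ringHom_ext_laurent fun u => by
      rw [laurentMap_coe, RingHom.comp_apply, laurentMap_coe, laurentMap_coe]; rfl
  rw [this]; rfl

theorem laurentMap_id {h : Function.Injective (AlgHom.id k k⟦X⟧)} (x : 𝕂 k) :
    laurentMap (AlgHom.id k k⟦X⟧) h x = x := by
  have : laurentMap (AlgHom.id k k⟦X⟧) h = RingHom.id (𝕂 k) :=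
    ringHom_ext_laurent fun u => by
      rw [laurentMap_coe]; rfl
  rw [this]; rfl

theorem HasLead.laurentMap {e : ℤ} {w : k} (hX : HasLead e w ((f X : k⟦X⟧) : 𝕂 k)) (hw : w ≠ 0)
    (hx : HasLead n c x) : HasLead (e * n) (c * w ^ n) (laurentMap f hf x) := by
  obtain ⟨u, rfl, rfl⟩ := hx
  rw [map_mul, map_zpow₀, laurentMap_coe, laurentMap_coe]
  have := (hX.zpow hw n).mul (hasLead_coe (f u))
  rwa [constantCoeff_algHom, add_zero, mul_comm (w ^ n), mul_comm n] at this

theorem OrdEq.laurentMap {e : ℤ} (hX : OrdEq e ((f X : k⟦X⟧) : 𝕂 k))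
    (hx : OrdEq n x) : OrdEq (e * n) (laurentMap f hf x) := by
  obtain ⟨w, hw, hX⟩ := hX
  obtain ⟨c, hc0, hc⟩ := hx
  exact ⟨_, mul_ne_zero hc0 (zpow_ne_zero _ hw), HasLead.laurentMap hX hw hc⟩

end laurentMap

end PowerSeriesMaps

/-! ### Automorphisms of `k⟦X⟧` and their ramification -/

section Ramification

variable {k : Type*} [Field k]

/-- The action of an automorphism of `k⟦X⟧` on Laurent series. -/
def laurentAut (σ : AutPowerSeries k) : 𝕂 k →+* 𝕂 k := laurentMap (σ : k⟦X⟧ →ₐ[k] k⟦X⟧) σ.injective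

@[simp] theorem laurentAut_coe (σ : AutPowerSeries k) (u : k⟦X⟧) :
    laurentAut σ (u : 𝕂 k) = ((σ u : k⟦X⟧) : 𝕂 k) := laurentMap_coe u

@[simp] theorem laurentAut_C (σ : AutPowerSeries k) (c : k) :
    laurentAut σ (HahnSeries.C c) = HahnSeries.C c := laurentMap_C c

theorem laurentAut_mul (σ τ : AutPowerSeries k) (x : 𝕂 k) :
    laurentAut (σ * τ) x = laurentAut σ (laurentAut τ x) :=
  laurentMap_comp (f := (σ : k⟦X⟧ →ₐ[k] k⟦X⟧)) (g := (τ : k⟦X⟧ →ₐ[k] k⟦X⟧)) x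

@[simp] theorem laurentAut_one (x : 𝕂 k) : laurentAut (1 : AutPowerSeries k) x = x :=
  laurentMap_id x

/-- The coefficient of `X` in `σ X`, i.e. the action of `σ` on the cotangent space. -/
def tameCoeff (σ : AutPowerSeries k) : k := coeff 1 (σ X)

theorem hasLead_one_of_constantCoeff {u : k⟦X⟧} (h : constantCoeff u = 0) :
    HasLead 1 (coeff 1 u) (u : 𝕂 k) := by
  rw [← PowerSeries.X_dvd_iff] at h
  obtain ⟨v, rfl⟩ := h
  refine ⟨v, ?_, by simp⟩
  rw [show (1 : ℕ) = 0 + 1 from rfl, PowerSeries.coeff_succ_X_mul]; simp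

theorem hasLead_aut_X (σ : AutPowerSeries k) :
    HasLead 1 (tameCoeff σ) ((σ X : k⟦X⟧) : 𝕂 k) :=
  hasLead_one_of_constantCoeff (constantCoeff_algHom_X (σ : k⟦X⟧ →ₐ[k] k⟦X⟧))

theorem hasLead_X : HasLead 1 (1 : k) (((X : k⟦X⟧)) : 𝕂 k) := ⟨1, by simp, by simp⟩

theorem tameCoeff_one : tameCoeff (1 : AutPowerSeries k) = 1 := by
  simp [tameCoeff]

theorem tameCoeff_ne_zero (σ : AutPowerSeries k) : tameCoeff σ ≠ 0 := by
  intro h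
  have h1 := hasLead_aut_X σ
  rw [h, hasLead_zero_iff] at h1
  obtain ⟨v, hv⟩ := h1
  have h2 : (X : k⟦X⟧) ^ 2 ∣ σ X := ⟨v, lC_injective (by rw [hv]; push_cast; rfl)⟩
  rw [X_pow_dvd_apply_iff] at h2
  have h3 := PowerSeries.X_pow_dvd_iff.mp h2 1 (by norm_num)
  simp at h3

theorem HasLead.aut {n : ℤ} {c : k} {x : 𝕂 k} (σ : AutPowerSeries k) (hx : HasLead n c x) :
    HasLead n (c * tameCoeff σ ^ n) (laurentAut σ x) := by
  have := HasLead.laurentMap (f := (σ : k⟦X⟧ →ₐ[k] k⟦X⟧)) (hf := σ.injective) (hasLead_aut_X σ)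
    (tameCoeff_ne_zero σ) hx
  rwa [one_mul] at this

theorem OrdGE.aut {n : ℤ} {x : 𝕂 k} (σ : AutPowerSeries k) (hx : OrdGE n x) :
    OrdGE n (laurentAut σ x) := by
  obtain ⟨c, hc⟩ := hx.exists_hasLead
  exact (hc.aut σ).ordGE

theorem tameCoeff_mul (σ τ : AutPowerSeries k) :
    tameCoeff (σ * τ) = tameCoeff σ * tameCoeff τ := by
  have h1 := hasLead_aut_X (σ * τ)
  have h2 := (hasLead_aut_X τ).aut σ
  rw [laurentAut_coe, zpow_one, mul_comm] at h2
  exact h1.unique h2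

/-- `σ ↦ coeff 1 (σ X)` as a character. -/
def tameHom (k : Type*) [Field k] : AutPowerSeries k →* kˣ where
  toFun σ := Units.mk0 (tameCoeff σ) (tameCoeff_ne_zero σ)
  map_one' := Units.ext tameCoeff_one
  map_mul' σ τ := Units.ext (tameCoeff_mul σ τ)

theorem aut_ext_X {σ τ : AutPowerSeries k} (h : σ X = τ X) : σ = τ := by
  have : (σ : k⟦X⟧ →ₐ[k] k⟦X⟧) = τ := algHom_ext_X h
  ext x : 1
  exact DFunLike.congr_fun this x

theorem OrdEq.order_toNat {u : k⟦X⟧} {n : ℕ} (h : OrdEq (n : ℤ) (u : 𝕂 k)) :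
    u.order.toNat = n := by
  obtain ⟨c, hc, v, hv, huv⟩ := h
  have h1 : u = X ^ n * v := lC_injective (by rw [huv]; push_cast; simp)
  have h2 : u.order = n := by
    rw [PowerSeries.order_eq_nat, h1, PowerSeries.coeff_X_pow_mul', if_pos le_rfl]
    refine ⟨by simpa [hv] using hc, fun i hi => ?_⟩
    rw [PowerSeries.coeff_X_pow_mul', if_neg (by omega)]
  rw [h2]; rfl

theorem ordEq_order_toNat {u : k⟦X⟧} (h : u ≠ 0) : OrdEq (u.order.toNat : ℤ) (u : 𝕂 k) := by
  obtain ⟨n, c, hc, v, hv, hn⟩ := exists_ordEq (x := (u : 𝕂 k)) fun h0 =>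
    h (lC_injective (by simpa using h0))
  have h1 : OrdEq n (u : 𝕂 k) := ⟨c, hc, v, hv, hn⟩
  lift n to ℕ using h1.le (ordGE_coe u)
  rwa [h1.order_toNat]

section ram

variable {G : Type*} [Group G] {φ : G →* AutPowerSeries k}

/-- The tame character of an action: the character through which `G` acts on the cotangent space of
`k⟦X⟧`. -/
def tameChar (φ : G →* AutPowerSeries k) : G →* kˣ := (tameHom k).comp φ

theorem coe_tameChar (g : G) : (tameChar φ g : k) = tameCoeff (φ g) := rfl

theorem aut_X_sub_ne_zero (hφ : Function.Injective φ) {g : G} (hg : g ≠ 1) : φ g X - X ≠ 0 := by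
  intro h
  apply hg
  apply hφ
  rw [map_one]
  exact aut_ext_X (by simpa [sub_eq_zero] using h)

theorem ordEq_ramIndex (hφ : Function.Injective φ) {g : G} (hg : g ≠ 1) :
    OrdEq (ramIndex φ g : ℤ) ((φ g X - X : k⟦X⟧) : 𝕂 k) :=
  ordEq_order_toNat (aut_X_sub_ne_zero hφ hg)

theorem ramIndex_eq_of_ordEq {g : G} {n : ℕ} (h : OrdEq (n : ℤ) ((φ g X - X : k⟦X⟧) : 𝕂 k)) :
    ramIndex φ g = n := h.order_toNat

theorem hasLead_aut_X_sub (σ : AutPowerSeries k) :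
    HasLead 1 (tameCoeff σ - 1) ((σ X - X : k⟦X⟧) : 𝕂 k) := by
  rw [PowerSeries.coe_sub]
  exact (hasLead_aut_X σ).sub hasLead_X

/-- Elements outside the wild inertia group have ramification index `1`. -/
theorem ramIndex_of_tameChar_ne_one {g : G} (h : tameChar φ g ≠ 1) : ramIndex φ g = 1 := by
  apply ramIndex_eq_of_ordEq
  refine ⟨_, sub_ne_zero.mpr fun h1 => h (Units.ext ?_), hasLead_aut_X_sub (φ g)⟩
  exact h1

theorem two_le_ramIndex (hφ : Function.Injective φ) {g : G} (hg : g ≠ 1) (h : tameChar φ g = 1) :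
    2 ≤ ramIndex φ g := by
  have h1 := hasLead_aut_X_sub (φ g)
  rw [← coe_tameChar, h, Units.val_one, sub_self, hasLead_zero_iff] at h1
  exact_mod_cast (ordEq_ramIndex hφ hg).le h1

theorem X_pow_dvd_iff_ordGE {u : k⟦X⟧} {n : ℕ} : X ^ n ∣ u ↔ OrdGE (n : ℤ) (u : 𝕂 k) := by
  constructor
  · rintro ⟨v, rfl⟩
    exact ⟨v, by push_cast; simp⟩
  · rintro ⟨v, hv⟩
    exact ⟨v, lC_injective (by rw [hv]; push_cast; simp)⟩

theorem X_pow_dvd_ramIndex (hφ : Function.Injective φ) (g : G) (u : k⟦X⟧) :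
    X ^ ramIndex φ g ∣ φ g u - u := by
  by_cases hg : g = 1
  · simp [hg]
  · exact X_pow_dvd_algHom_sub (f := (φ g : k⟦X⟧ →ₐ[k] k⟦X⟧)) (g := AlgHom.id k _)
      (X_pow_dvd_iff_ordGE.mpr (ordEq_ramIndex hφ hg).ordGE) u

theorem le_ramIndex_of_dvd (hφ : Function.Injective φ) {g : G} (hg : g ≠ 1) {n : ℕ}
    (h : X ^ n ∣ φ g X - X) : n ≤ ramIndex φ g := by
  exact_mod_cast (ordEq_ramIndex hφ hg).le (X_pow_dvd_iff_ordGE.mp h)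

theorem ramIndex_conj_le (hφ : Function.Injective φ) {g : G} (hg : g ≠ 1) (x : G) :
    ramIndex φ g ≤ ramIndex φ (x * g * x⁻¹) := by
  apply le_ramIndex_of_dvd hφ (by simpa [mul_inv_eq_one] using hg)
  have h1 := X_pow_dvd_ramIndex hφ g (φ x⁻¹ X)
  rw [← X_pow_dvd_apply_iff (φ x), map_sub, ← AlgEquiv.mul_apply, ← AlgEquiv.mul_apply,
    ← AlgEquiv.mul_apply, ← map_mul, ← map_mul, ← map_mul, mul_inv_cancel, map_one] at h1
  simpa [mul_assoc] using h1

theorem ramIndex_conj (hφ : Function.Injective φ) (g x : G) :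
    ramIndex φ (x * g * x⁻¹) = ramIndex φ g := by
  by_cases hg : g = 1
  · simp [hg]
  · refine le_antisymm ?_ (ramIndex_conj_le hφ hg x)
    have := ramIndex_conj_le hφ (g := x * g * x⁻¹) (by simpa [mul_inv_eq_one] using hg) x⁻¹
    simpa [mul_assoc] using this

theorem ramIndex_le_of_mem_zpowers [Finite G] (hφ : Function.Injective φ) {g h : G} (hh : h ≠ 1)
    (hgh : h ∈ Subgroup.zpowers g) : ramIndex φ g ≤ ramIndex φ h := by
  obtain ⟨n, rfl⟩ := (mem_powers_iff_mem_zpowers.mpr hgh)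
  apply le_ramIndex_of_dvd hφ hh
  clear hh hgh
  show _ ∣ φ (g ^ n) X - X
  induction n with
  | zero => simp
  | succ n ih =>
    have := dvd_add (X_pow_dvd_ramIndex hφ g (φ (g ^ n) X)) ih
    rw [sub_add_sub_cancel, ← AlgEquiv.mul_apply, ← map_mul, ← pow_succ'] at this
    exact this

theorem ramIndex_eq_of_zpowers_eq [Finite G] (hφ : Function.Injective φ) {g h : G}
    (hgh : Subgroup.zpowers g = Subgroup.zpowers h) : ramIndex φ g = ramIndex φ h := by
  by_cases hg : g = 1
  · have : h = 1 := by
      rwa [hg, Subgroup.zpowers_one_eq_bot, eq_comm, Subgroup.zpowers_eq_bot] at hgh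
    rw [hg, this]
  · have hh : h ≠ 1 := by
      rintro rfl
      rw [Subgroup.zpowers_one_eq_bot, Subgroup.zpowers_eq_bot] at hgh
      exact hg hgh
    exact le_antisymm
      (ramIndex_le_of_mem_zpowers hφ hh (hgh ▸ Subgroup.mem_zpowers h))
      (ramIndex_le_of_mem_zpowers hφ hg (hgh ▸ Subgroup.mem_zpowers g))

/-- The leading term of `(1 + ε) ^ l - 1` is that of `l ε`, with coefficient `0` if `l = 0` in
`k`. -/
theorem hasLead_one_add_zpow_sub_one {i : ℤ} (hi : 0 < i) {α : k} {ε : 𝕂 k} (h : HasLead i α ε)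
    (l : ℤ) : HasLead i (l * α) ((1 + ε) ^ l - 1) := by
  have hnat : ∀ n : ℕ, HasLead i (n * α) ((1 + ε) ^ n - 1) := by
    intro n
    induction n with
    | zero => simpa [hasLead_zero_iff] using ordGE_zero
    | succ n ih =>
      have h1 := (ih.add h).add_ordGE (ih.ordGE.mul h.ordGE) (by omega)
      convert h1 using 1
      · push_cast; ring
      · ring
  have h1 : HasLead 0 (1 : k) (1 + ε) := hasLead_one.add_ordGE h.ordGE hi
  rcases l with n | n
  · simpa using hnat n
  · have h2 := h1.pow (n + 1)
    have h3 := ((hnat (n + 1)).mul (h2.inv (by simp))).neg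
    have h4 : (1 + ε) ^ (n + 1) ≠ 0 := h2.ne_zero (by simp)
    rw [zpow_negSucc]
    convert h3 using 1
    · simp
    · rw [Int.negSucc_eq]; push_cast; simp; ring
    · field_simp; ring

/-- If `σ X = X + α X ^ i + ...` with `i ≥ 2`, then `σ` acts on the leading term of `x` through the
logarithmic derivative of `x`. -/
theorem hasLead_aut_sub {σ : AutPowerSeries k} {i : ℤ} (hi : 2 ≤ i) {α : k}
    (hσ : HasLead i α ((σ X - X : k⟦X⟧) : 𝕂 k)) {l : ℤ} {c : k} {x : 𝕂 k} (hx : HasLead l c x) :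
    HasLead (l + i - 1) (l * c * α) (laurentAut σ x - x) := by
  obtain ⟨u, rfl, rfl⟩ := hx
  set ε : 𝕂 k := ((σ X - X : k⟦X⟧) : 𝕂 k) * lX k ^ (-1 : ℤ) with hε
  have h1 : HasLead (i - 1) α ε := by
    have := hσ.mul (hasLead_lX_zpow (-1))
    rwa [mul_one] at this
  have h2 : laurentAut σ (lX k) = lX k * (1 + ε) := by
    rw [hε, mul_add, mul_one, zpow_neg_one, mul_comm _ (lX k)⁻¹,
      mul_inv_cancel_left₀ lX_ne_zero, laurentAut_coe]
    push_cast; ring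
  lift i to ℕ using by omega
  have h3 : OrdGE (i : ℤ) (((σ u - u : k⟦X⟧)) : 𝕂 k) :=
    X_pow_dvd_iff_ordGE.mp (X_pow_dvd_algHom_sub (f := (σ : k⟦X⟧ →ₐ[k] k⟦X⟧)) (g := AlgHom.id k _)
      (X_pow_dvd_iff_ordGE.mpr hσ.ordGE) u)
  have h4 := (hasLead_one_add_zpow_sub_one (by omega) h1 l).mul (hasLead_coe (σ u))
  have h5 : constantCoeff (σ u) = constantCoeff u :=
    constantCoeff_algHom (σ : k⟦X⟧ →ₐ[k] k⟦X⟧) u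
  have h6 := (hasLead_lX_zpow l).mul (h4.add_ordGE h3 (by omega))
  convert h6 using 1
  · ring
  · rw [h5]; ring
  · rw [map_mul, map_zpow₀, h2, mul_zpow, laurentAut_coe]
    push_cast; ring

theorem hasLead_pow_aut_sub {σ : AutPowerSeries k} {i : ℤ} (hi : 2 ≤ i) {α : k}
    (hσ : HasLead i α ((σ X - X : k⟦X⟧) : 𝕂 k)) (n : ℕ) :
    HasLead i (n * α) (((σ ^ n) X - X : k⟦X⟧) : 𝕂 k) := by
  have h1 : tameCoeff σ = 1 := by
    have h2 := (hasLead_aut_X_sub σ).unique (hasLead_zero_iff.mpr (hσ.ordGE.mono (by omega)))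
    exact sub_eq_zero.mp h2
  induction n with
  | zero => simpa [hasLead_zero_iff] using ordGE_zero
  | succ n ih =>
    have h2 := (ih.aut σ).add hσ
    rw [h1, one_zpow, mul_one, laurentAut_coe, ← PowerSeries.coe_add, map_sub, sub_add_sub_cancel,
      ← AlgEquiv.mul_apply, ← pow_succ'] at h2
    convert h2 using 1
    push_cast; ring

/-- The kernel of the tame character consists of elements of `p`-power order, as
`σ ^ n = X + n α X ^ i + ...`. -/
theorem natCast_eq_zero_of_pow_eq_one (hφ : Function.Injective φ) {g : G} (hg : g ≠ 1)
    (h : tameChar φ g = 1) {n : ℕ} (hn : g ^ n = 1) : (n : k) = 0 := by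
  obtain ⟨α, hα, h1⟩ := ordEq_ramIndex hφ hg
  have h2 := hasLead_pow_aut_sub (by exact_mod_cast two_le_ramIndex hφ hg h) h1 n
  rw [← map_pow, hn, map_one] at h2
  by_contra hn0
  exact h2.ne_zero (mul_ne_zero hn0 hα) (by simp)

/-- How conjugation by `x` acts on a cyclic subgroup of the wild inertia group: the exponent is
determined by the tame character and the ramification index. -/
theorem conj_exponent_eq (hφ : Function.Injective φ) {g x : G} (hg : g ≠ 1)
    (h : tameChar φ g = 1) {a : ℕ} (hx : x * g * x⁻¹ = g ^ a) :
    (a : k) = (tameChar φ x : k) ^ (ramIndex φ g - 1) := by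
  obtain ⟨α, hα, h1⟩ := ordEq_ramIndex hφ hg
  have hi : (2 : ℤ) ≤ (ramIndex φ g : ℤ) := by exact_mod_cast two_le_ramIndex hφ hg h
  have h2 := hasLead_pow_aut_sub hi h1 a
  have h3 := hasLead_aut_sub hi h1 (hasLead_aut_X (φ x⁻¹))
  have h4 := h3.aut (φ x)
  rw [laurentAut_coe, ← PowerSeries.coe_sub, laurentAut_coe, map_sub, ← AlgEquiv.mul_apply,
    ← AlgEquiv.mul_apply, ← AlgEquiv.mul_apply, ← map_mul, ← map_mul, ← map_mul, mul_inv_cancel,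
    map_one, mul_assoc x g, ← mul_assoc, hx, map_pow, add_sub_cancel_left] at h4
  have h5 := h2.unique h4
  have h6 : tameCoeff (φ x) * tameCoeff (φ x⁻¹) = 1 := by
    rw [← tameCoeff_mul, ← map_mul, mul_inv_cancel, map_one, tameCoeff_one]
  apply mul_right_cancel₀ hα
  rw [h5, coe_tameChar]
  obtain ⟨j, hj⟩ : ∃ j, ramIndex φ g = j + 1 := ⟨ramIndex φ g - 1, by omega⟩
  rw [hj, zpow_natCast, Nat.add_sub_cancel, pow_succ]
  push_cast
  linear_combination (α * tameCoeff (φ x) ^ j) * h6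

end ram

end Ramification

/-! ### Artin–Schreier extensions of `k((X))` -/

section ArtinSchreier

variable {k : Type*} [Field k]

instance charP_laurent (p : ℕ) [CharP k p] : CharP (𝕂 k) p :=
  charP_of_injective_ringHom (f := (HahnSeries.C : k →+* 𝕂 k)) HahnSeries.C_injective p

/-- An endomorphism is determined by the image of any uniformizer. -/
theorem algHom_ext_of_hasLead {F G : k⟦X⟧ →ₐ[k] k⟦X⟧} {t : k⟦X⟧} {w : k} (hw : w ≠ 0)
    (ht : HasLead 1 w (t : 𝕂 k)) (h : F t = G t) : F = G := by
  obtain ⟨r, hr, hrt⟩ := ht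
  have h1 : t = X * r := lC_injective (by rw [hrt]; push_cast; simp)
  have h2 : F.comp (scaleHom r) = G.comp (scaleHom r) :=
    algHom_ext_X (by simpa [← h1] using h)
  ext x : 1
  obtain ⟨y, rfl⟩ := scaleHom_surjective (r := r) (by rwa [hr]) x
  exact DFunLike.congr_fun h2 y

/-- A Laurent series with a pole of order `m`, with `m` invertible in `k`, is the `(-m)`-th power of a
uniformizer. -/
theorem exists_pow_hasLead {m : ℕ} (hm : (m : k) ≠ 0) {c : k} (hc : c ≠ 0) {z : 𝕂 k}
    (hz : HasLead (-m : ℤ) (c ^ (-m : ℤ)) z) :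
    ∃ t : k⟦X⟧, HasLead 1 c (t : 𝕂 k) ∧ (t : 𝕂 k) ^ (-m : ℤ) = z := by
  obtain ⟨u, hu, rfl⟩ := hz
  have hu0 : constantCoeff u ≠ 0 := by rw [hu]; exact zpow_ne_zero _ hc
  obtain ⟨r, hr, hrc⟩ := exists_pow_eq_powerSeries hm hc (u := u⁻¹) (by
    rw [PowerSeries.constantCoeff_inv, hu]; simp)
  refine ⟨X * r, ⟨r, hrc, by push_cast; simp⟩, ?_⟩
  have h : (u : 𝕂 k) * ((u⁻¹ : k⟦X⟧) : 𝕂 k) = 1 := by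
    rw [← PowerSeries.coe_mul, PowerSeries.mul_inv_cancel _ hu0]; simp
  rw [PowerSeries.coe_mul, mul_zpow]
  congr 1
  rw [zpow_neg, zpow_natCast, ← PowerSeries.coe_pow, hr]
  exact (eq_inv_of_mul_eq_one_left h).symm

/-- An automorphism of `k⟦X⟧` may be prescribed by its tame coefficient and by the image of
`X ^ (-m)`, for `m` invertible in `k`. -/
theorem exists_aut_lX_zpow {m : ℕ} (hm : (m : k) ≠ 0) {c : k} (hc : c ≠ 0) {z : 𝕂 k}
    (hz : HasLead (-m : ℤ) (c ^ (-m : ℤ)) z) :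
    ∃ σ : AutPowerSeries k, tameCoeff σ = c ∧ laurentAut σ (lX k ^ (-m : ℤ)) = z := by
  obtain ⟨t, ht, rfl⟩ := exists_pow_hasLead hm hc hz
  have ht' := ht
  obtain ⟨r, hr, hrt⟩ := ht
  have h1 : t = X * r := lC_injective (by rw [hrt]; push_cast; simp)
  have hr0 : constantCoeff r ≠ 0 := by rwa [hr]
  have h2 : Function.Bijective (scaleHom r) :=
    ⟨scaleHom_injective (by rintro rfl; simp at hr0), scaleHom_surjective hr0⟩
  refine ⟨AlgEquiv.ofBijective (scaleHom r) h2, ?_, ?_⟩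
  · have h3 := hasLead_aut_X (AlgEquiv.ofBijective (scaleHom r) h2)
    rw [AlgEquiv.ofBijective_apply, scaleHom_X, ← h1] at h3
    exact h3.unique ht'
  · rw [map_zpow₀, laurentAut_coe, AlgEquiv.ofBijective_apply, scaleHom_X, h1]

theorem aut_ext_lX_zpow {m : ℕ} (hm : (m : k) ≠ 0) {σ τ : AutPowerSeries k}
    (h1 : tameCoeff σ = tameCoeff τ)
    (h2 : laurentAut σ (lX k ^ (-m : ℤ)) = laurentAut τ (lX k ^ (-m : ℤ))) : σ = τ := by
  apply aut_ext_X
  apply lC_injective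
  refine eq_of_pow_eq hm (tameCoeff_ne_zero σ) (hasLead_aut_X σ) (h1 ▸ hasLead_aut_X τ) ?_
  rw [map_zpow₀, map_zpow₀, laurentAut_coe, laurentAut_coe, zpow_neg, zpow_neg, inv_inj] at h2
  simpa using h2

section
variable (p : ℕ) [Fact p.Prime] [CharP k p]

theorem exists_root [IsAlgClosed k] {m : ℕ} (hm : 0 < m) (c : k) (hc : c ≠ 0) :
    ∃ d : k, d ≠ 0 ∧ d ^ (-m : ℤ) = c := by
  obtain ⟨d, hd⟩ := IsAlgClosed.exists_pow_nat_eq c⁻¹ hm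
  refine ⟨d, ?_, ?_⟩
  · rintro rfl
    rw [zero_pow hm.ne', eq_comm, _root_.inv_eq_zero] at hd
    exact hc hd
  · rw [zpow_neg, zpow_natCast, hd, inv_inv]

/-- The extension of `k((X))` obtained by adjoining a root `y` of `y ^ q - y = a`, where `a` has a
pole of order `m` prime to `p`: it is again a Laurent series field, with a uniformizer `X` such that
`y = X ^ (-m)`, and it is described by the embedding `ι`. An element with a pole of order `l > m`
prime to `p` acquires, modulo elements `w ^ q - w`, a pole of order `q * l - m * (q - 1)`. -/
theorem exists_artinSchreier_embedding [IsAlgClosed k] {f : ℕ} (hf : f ≠ 0) {m : ℕ}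
    (hmp : ¬ p ∣ m) {a : 𝕂 k} (ha : OrdEq (-m : ℤ) a) :
    ∃ (ι : k⟦X⟧ →ₐ[k] k⟦X⟧) (hι : Function.Injective ι),
      OrdEq ((p ^ f : ℕ) : ℤ) ((ι X : k⟦X⟧) : 𝕂 k) ∧
      laurentMap ι hι a = (lX k ^ (-m : ℤ)) ^ (p ^ f) - lX k ^ (-m : ℤ) ∧
      ∀ (b : 𝕂 k) (l : ℕ), ¬ p ∣ l → m < l → OrdEq (-l : ℤ) b →
        ∃ w : 𝕂 k, OrdEq (-(p ^ f * l : ℕ) + (m * (p ^ f - 1) : ℕ) : ℤ)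
          (laurentMap ι hι b - (w ^ (p ^ f) - w)) := by
  have hm : (m : k) ≠ 0 := by rwa [Ne, CharP.cast_eq_zero_iff k p]
  have hm0 : 0 < m := Nat.pos_of_ne_zero (by rintro rfl; simp at hmp)
  have hp := (Fact.out : p.Prime)
  have hq2 : 2 ≤ p ^ f := hp.two_le.trans (Nat.le_self_pow hf p)
  have hqne : p ^ f ≠ 0 := by omega
  obtain ⟨c, hc, hac⟩ := ha
  obtain ⟨d, hd, rfl⟩ := exists_root hm0 c hc
  -- up to an automorphism `α`, the element `a` is `X ^ (-m)`
  obtain ⟨α, hα, hαa⟩ := exists_aut_lX_zpow hm hd hac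
  set M := m * (p ^ f - 1) with hM
  have hM0 : M ≠ 0 := Nat.mul_ne_zero hm0.ne' (by omega)
  have hE0 : constantCoeff (1 - X ^ M : k⟦X⟧) = 1 := by simp [hM0]
  -- for `η ^ (-m) = 1 - X ^ (m * (q - 1))`, the map `ι₀ : X ↦ X ^ q * η` sends `X ^ (-m)` to
  -- `X ^ (-m * q) - X ^ (-m)`
  obtain ⟨η, hη, hη0⟩ := exists_pow_eq_powerSeries hm one_ne_zero (u := (1 - X ^ M : k⟦X⟧)⁻¹)
    (by rw [PowerSeries.constantCoeff_inv, hE0]; simp)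
  have hηne : η ≠ 0 := by rintro rfl; simp at hη0
  set ι₀ : k⟦X⟧ →ₐ[k] k⟦X⟧ := scaleHom (X ^ (p ^ f - 1) * η) with hι₀
  have hι₀inj : Function.Injective ι₀ :=
    scaleHom_injective (mul_ne_zero (pow_ne_zero _ X_ne_zero) hηne)
  have hι₀X : ι₀ X = X ^ p ^ f * η := by
    rw [hι₀, scaleHom_X, ← mul_assoc, ← pow_succ', Nat.sub_add_cancel (by omega)]
  have hι₀X' : HasLead ((p ^ f : ℕ) : ℤ) (1 : k) ((ι₀ X : k⟦X⟧) : 𝕂 k) :=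
    ⟨η, hη0, by rw [hι₀X]; push_cast; norm_cast⟩
  have hinj : Function.Injective (ι₀.comp (α.symm : k⟦X⟧ →ₐ[k] k⟦X⟧)) :=
    hι₀inj.comp α.symm.injective
  have hcomp : ∀ x, laurentMap _ hinj x = laurentMap ι₀ hι₀inj (laurentAut α⁻¹ x) :=
    fun x => laurentMap_comp (f := ι₀) (g := ((α⁻¹ : AutPowerSeries k) : k⟦X⟧ →ₐ[k] k⟦X⟧)) x
  have hηpow : ((η : 𝕂 k)) ^ (-m : ℤ) = 1 - lX k ^ M := by
    have h : ((1 - X ^ M : k⟦X⟧) : 𝕂 k) * (((1 - X ^ M : k⟦X⟧)⁻¹ : k⟦X⟧) : 𝕂 k) = 1 := by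
      rw [← PowerSeries.coe_mul, PowerSeries.mul_inv_cancel _ (by rw [hE0]; exact one_ne_zero)]
      simp
    rw [zpow_neg, zpow_natCast, ← PowerSeries.coe_pow, hη]
    rw [← eq_inv_of_mul_eq_one_left h]
    push_cast; rfl
  refine ⟨ι₀.comp (α.symm : k⟦X⟧ →ₐ[k] k⟦X⟧), hinj, ?_, ?_, ?_⟩
  · have h1 := HasLead.laurentMap (hf := hι₀inj) hι₀X' one_ne_zero (hasLead_aut_X α⁻¹)
    rw [laurentMap_coe, mul_one] at h1
    exact ⟨_, mul_ne_zero (tameCoeff_ne_zero _) (by simp), h1⟩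
  · rw [hcomp, ← hαa, ← laurentAut_mul, inv_mul_cancel, laurentAut_one, map_zpow₀, laurentMap_coe,
      hι₀X, PowerSeries.coe_mul, mul_zpow, hηpow, PowerSeries.coe_pow]
    rw [mul_sub, mul_one]
    congr 1
    · rw [← zpow_natCast, ← zpow_natCast, ← zpow_mul, ← zpow_mul, mul_comm]
    · rw [← zpow_natCast (lX k) M, ← zpow_natCast, ← zpow_mul, ← zpow_add₀ lX_ne_zero]
      congr 1
      rw [hM]
      push_cast [Nat.one_le_iff_ne_zero.mpr hqne]
      ring
  · intro b l hlp hml hb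
    rw [hcomp]
    obtain ⟨e, he, heb⟩ := hb
    obtain ⟨u, hu, hbu⟩ := heb.aut α⁻¹
    have hu0 : constantCoeff u ≠ 0 := by
      rw [hu]; exact mul_ne_zero he (zpow_ne_zero _ (tameCoeff_ne_zero _))
    rw [hbu]
    -- after `α⁻¹` the element `b` is `X ^ (-l) * u`, and its image under `ι₀` is close to
    -- `X ^ (-q * l) * u(X ^ q)`, which is a `q`-th power; this power is removed by `w`
    obtain ⟨r, hr⟩ := exists_pow_eq_expand p f hqne u
    refine ⟨lX k ^ (-l : ℤ) * r, ?_⟩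
    have hη1 : ((η : 𝕂 k)) = 1 + ((η : 𝕂 k) - 1) := by ring
    -- comparing `m`-th powers shows that `η - 1` has order exactly `M`
    obtain ⟨γ, hγ, hγe⟩ : OrdEq (M : ℤ) ((η : 𝕂 k) - 1) := by
      have hne : (η : 𝕂 k) - 1 ≠ 0 := by
        intro h0
        rw [hη1, h0, add_zero, one_zpow, eq_comm, sub_eq_self] at hηpow
        exact pow_ne_zero _ lX_ne_zero hηpow
      obtain ⟨e', γ, hγ, hγe⟩ := exists_ordEq hne
      have he' : 0 < e' := by
        have h1 := (hasLead_coe η).sub hasLead_one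
        rw [hη0, sub_self, hasLead_zero_iff] at h1
        have := OrdEq.le ⟨γ, hγ, hγe⟩ h1
        omega
      have h2 := hasLead_one_add_zpow_sub_one he' hγe (-m)
      rw [← hη1, hηpow, sub_sub_cancel_left] at h2
      have h3 : e' = M := by
        refine OrdEq.unique ⟨_, ?_, h2⟩ ⟨_, ?_, (hasLead_lX_zpow (k := k) M).neg⟩
        · push_cast; exact mul_ne_zero (neg_ne_zero.mpr hm) hγ
        · simp
      exact ⟨γ, hγ, h3 ▸ hγe⟩
    have hηl : OrdEq (M : ℤ) ((η : 𝕂 k) ^ (-l : ℤ) - 1) := by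
      have h4 := hasLead_one_add_zpow_sub_one (by omega) hγe (-l)
      rw [← hη1] at h4
      refine ⟨_, mul_ne_zero ?_ hγ, h4⟩
      push_cast
      rwa [neg_ne_zero, Ne, CharP.cast_eq_zero_iff k p]
    have hdiff : OrdGE ((p ^ f : ℕ) + M : ℤ)
        (((ι₀ u : k⟦X⟧) : 𝕂 k) - ((expand (p ^ f) hqne u : k⟦X⟧) : 𝕂 k)) := by
      rw [← PowerSeries.coe_sub]
      have h1 : X ^ (p ^ f + M) ∣ ι₀ X - expand (p ^ f) hqne X := by
        rw [X_pow_dvd_iff_ordGE, hι₀X, expand_X, PowerSeries.coe_sub, PowerSeries.coe_mul]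
        have h3 := (hasLead_lX_zpow (k := k) (p ^ f : ℕ)).ordGE.mul hγe.ordGE
        convert h3 using 1
        · push_cast; ring
        · rw [zpow_natCast]
          push_cast; ring
      have := X_pow_dvd_iff_ordGE.mp (X_pow_dvd_algHom_sub h1 u)
      exact_mod_cast this
    have hu' : OrdEq 0 ((ι₀ u : k⟦X⟧) : 𝕂 k) :=
      ⟨_, by rwa [constantCoeff_algHom ι₀ u], hasLead_coe _⟩
    have h5 := (hηl.mul hu').add_ordGE hdiff (by omega)
    have h6 : OrdEq (-l * (p ^ f : ℕ) : ℤ) (lX k ^ (-l * (p ^ f : ℕ) : ℤ)) :=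
      ⟨1, one_ne_zero, hasLead_lX_zpow _⟩
    have h7 : OrdGE (-l : ℤ) (lX k ^ (-l : ℤ) * (r : 𝕂 k)) := ⟨r, rfl⟩
    have hlt : (-l * (p ^ f : ℕ) : ℤ) + (M + 0) < -l := by
      rw [hM]
      obtain ⟨Q, hQ⟩ : ∃ Q, p ^ f = Q + 2 := ⟨p ^ f - 2, by omega⟩
      rw [hQ]
      have : m + 1 ≤ l := hml
      push_cast [show Q + 2 - 1 = Q + 1 by omega]
      nlinarith
    have h8 := (h6.mul h5).add_ordGE h7 hlt
    convert h8 using 1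
    · push_cast; ring
    · rw [map_mul, map_zpow₀, laurentMap_coe, laurentMap_coe, hι₀X, mul_pow, zpow_mul,
        zpow_natCast (lX k ^ (-l : ℤ)), ← PowerSeries.coe_pow r, hr, PowerSeries.coe_mul, mul_zpow,
        PowerSeries.coe_pow, ← zpow_natCast (lX k) (p ^ f), ← zpow_mul, mul_comm ((p ^ f : ℕ) : ℤ),
        zpow_mul, zpow_natCast]
      ring

end

end ArtinSchreier

/-! ### Lifting a group action through an Artin–Schreier extension -/

section Lifting

variable {k : Type*} [Field k]

theorem ordEq_pow_sub_self {q : ℕ} (hq : 2 ≤ q) {n : ℤ} (hn : n < 0) {b : 𝕂 k} (hb : OrdEq n b) :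
    OrdEq (q * n) (b ^ q - b) :=
  (hb.pow q).sub_ordGE hb.ordGE (by nlinarith)

/-- If `b ^ q - b` has at most a pole of order `m`, with `m` prime to `p`, then `q` times the pole
order of `b` is less than `m`. -/
theorem OrdEq.neg_lt_mul_of_pow_sub {p f : ℕ} [Fact p.Prime] (hf : f ≠ 0) {m : ℕ} (hmp : ¬ p ∣ m)
    {n : ℤ} {b : 𝕂 k} (hb : OrdEq n b) (h : OrdGE (-m : ℤ) (b ^ (p ^ f) - b)) :
    -(m : ℤ) < (p ^ f : ℕ) * n := by
  have hp := (Fact.out : p.Prime)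
  have hq2 : 2 ≤ p ^ f := hp.two_le.trans (Nat.le_self_pow hf p)
  have hm0 : 0 < m := Nat.pos_of_ne_zero (by rintro rfl; simp at hmp)
  by_cases hn : n < 0
  · refine lt_of_le_of_ne ((ordEq_pow_sub_self hq2 hn hb).le h) fun h1 => hmp ?_
    rw [← Int.natCast_dvd_natCast, ← dvd_neg, h1]
    exact Dvd.dvd.mul_right (by exact_mod_cast dvd_pow_self p hf) _
  · have : 0 ≤ ((p ^ f : ℕ) : ℤ) * n := mul_nonneg (by positivity) (by omega)
    omega

variable (p : ℕ) [Fact p.Prime] [CharP k p]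

theorem sub_pow_sub_sub (f : ℕ) (x y : 𝕂 k) :
    (x - y) ^ (p ^ f) - (x - y) = (x ^ (p ^ f) - x) - (y ^ (p ^ f) - y) := by
  rw [sub_pow_char_pow]; ring

theorem add_pow_sub_add (f : ℕ) (x y : 𝕂 k) :
    (x + y) ^ (p ^ f) - (x + y) = (x ^ (p ^ f) - x) + (y ^ (p ^ f) - y) := by
  rw [add_pow_char_pow]; ring

/-- An action of `G` on `k((X))`, an element `a` with a pole of order `m` prime to `p`, and a
twisted crossed homomorphism `β` such that `β ^ q - β` is the coboundary of `a`, give an action of `G` on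
the Artin–Schreier extension `y ^ q - y = a` in which `g` sends `y` to `χ(g)⁻¹ (y + β g)`. -/
theorem exists_artinSchreier_action [IsAlgClosed k] {f : ℕ} (hf : f ≠ 0) {m : ℕ} (hmp : ¬ p ∣ m)
    {G : Type*} [Group G] (φ : G →* AutPowerSeries k) (χ : G →* kˣ)
    (hχ : ∀ g, (χ g : k) ^ (p ^ f) = χ g) (hθ : ∀ g, (tameChar φ g : k) ^ (p ^ f) = tameChar φ g)
    {a : 𝕂 k} (ha : OrdEq (-m : ℤ) a) (β : G → 𝕂 k)
    (hβ : ∀ g h, β (g * h) = β g + HahnSeries.C (χ g : k) * laurentAut (φ g) (β h))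
    (haβ : ∀ g, HahnSeries.C (χ g : k) * laurentAut (φ g) a - a = β g ^ (p ^ f) - β g) :
    ∃ (ι : k⟦X⟧ →ₐ[k] k⟦X⟧) (hι : Function.Injective ι) (ψ : G →* AutPowerSeries k),
      OrdEq ((p ^ f : ℕ) : ℤ) ((ι X : k⟦X⟧) : 𝕂 k) ∧
      tameChar ψ = tameChar φ ∧
      (∀ g u, ψ g (ι u) = ι (φ g u)) ∧
      (∀ g, laurentAut (ψ g) (lX k ^ (-m : ℤ)) =
        HahnSeries.C ((χ g)⁻¹ : k) * (lX k ^ (-m : ℤ) + laurentMap ι hι (β g))) ∧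
      ∀ (b : 𝕂 k) (l : ℕ), ¬ p ∣ l → m < l → OrdEq (-l : ℤ) b →
        ∃ w : 𝕂 k, OrdEq (-(p ^ f * l : ℕ) + (m * (p ^ f - 1) : ℕ) : ℤ)
          (laurentMap ι hι b - (w ^ (p ^ f) - w)) := by
  have hp := (Fact.out : p.Prime)
  have hq2 : 2 ≤ p ^ f := hp.two_le.trans (Nat.le_self_pow hf p)
  have hm : (m : k) ≠ 0 := by rwa [Ne, CharP.cast_eq_zero_iff k p]
  have hm0 : 0 < m := Nat.pos_of_ne_zero (by rintro rfl; simp at hmp)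
  obtain ⟨ι, hι, hιX, hιa, hιb⟩ := exists_artinSchreier_embedding p hf hmp ha
  have haut : ∀ g, OrdGE (-m : ℤ) (β g ^ (p ^ f) - β g) := fun g => by
    rw [← haβ]
    have := ((hasLead_C (χ g : k)).ordGE.mul (ha.ordGE.aut (φ g)))
    rw [zero_add] at this
    exact this.sub ha.ordGE
  -- both sides describe the action on the leading term of `a`
  have hχθ : ∀ g, (χ g : k) = (tameChar φ g : k) ^ m := by
    intro g
    obtain ⟨c, hc, hac⟩ := ha
    have h1 := ((hasLead_C (χ g : k)).mul (hac.aut (φ g)))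
    rw [zero_add] at h1
    have h2 := h1.sub hac
    rw [haβ] at h2
    have h3 : OrdGE (-m + 1 : ℤ) (β g ^ (p ^ f) - β g) := by
      by_cases h0 : β g = 0
      · rw [h0, zero_pow (by omega), sub_zero]; exact ordGE_zero
      · obtain ⟨n, hn⟩ := exists_ordEq h0
        have h4 := hn.neg_lt_mul_of_pow_sub hf hmp (haut g)
        by_cases hn0 : n < 0
        · exact (ordEq_pow_sub_self hq2 hn0 hn).ordGE.mono (by omega)
        · have h5 : OrdGE 0 (β g) := hn.ordGE.mono (by omega)
          have h6 := (h5.pow (p ^ f)).sub (h5.mono (by simp))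
          exact h6.mono (by simp; omega)
    have h4 := h2.unique (hasLead_zero_iff.mpr h3)
    have h5 : (tameCoeff (φ g)) ≠ 0 := tameCoeff_ne_zero _
    rw [coe_tameChar]
    rw [zpow_neg, zpow_natCast] at h4
    field_simp at h4
    have := mul_left_cancel₀ hc (by linear_combination h4 : c * (χ g : k) = c * tameCoeff (φ g) ^ m)
    exact this
  have hιβ : ∀ g, OrdGE (-m + 1 : ℤ) (laurentMap ι hι (β g)) := by
    intro g
    by_cases h0 : β g = 0
    · rw [h0, map_zero]; exact ordGE_zero
    · obtain ⟨n, hn⟩ := exists_ordEq h0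
      have h4 := hn.neg_lt_mul_of_pow_sub hf hmp (haut g)
      exact (OrdEq.laurentMap (hf := hι) hιX hn).ordGE.mono (by omega)
  -- the automorphism over `φ g` is prescribed by its value at `y = X ^ (-m)`
  have hex : ∀ g, ∃ σ : AutPowerSeries k, tameCoeff σ = tameChar φ g ∧
      laurentAut σ (lX k ^ (-m : ℤ)) =
        HahnSeries.C ((χ g)⁻¹ : k) * (lX k ^ (-m : ℤ) + laurentMap ι hι (β g)) := by
    intro g
    apply exists_aut_lX_zpow hm (tameChar φ g).ne_zero
    have h1 := (hasLead_C ((χ g : k)⁻¹)).mul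
      ((hasLead_lX_zpow (k := k) (-m)).add_ordGE (hιβ g) (by omega))
    rw [zero_add, mul_one] at h1
    rwa [zpow_neg, zpow_natCast, ← hχθ]
  choose σ hσ1 hσ2 using hex
  have hχC : ∀ g, HahnSeries.C ((χ g : k)⁻¹) ^ (p ^ f) = (HahnSeries.C ((χ g : k)⁻¹) : 𝕂 k) := by
    intro g; rw [← map_pow, inv_pow, hχ]
  have hχC' : ∀ g, HahnSeries.C ((χ g : k)⁻¹) * (HahnSeries.C (χ g : k) : 𝕂 k) = 1 := by
    intro g; rw [← map_mul, inv_mul_cancel₀ (χ g).ne_zero, map_one]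
  have hσa : ∀ g, laurentAut (σ g) (laurentMap ι hι a) = laurentMap ι hι (laurentAut (φ g) a) := by
    intro g
    rw [hιa, map_sub, map_pow, hσ2, mul_pow, hχC, ← mul_sub, add_pow_sub_add, ← hιa, ← map_pow,
      ← map_sub, ← haβ, ← map_add, add_sub_cancel, map_mul, laurentMap_C, ← mul_assoc, hχC',
      one_mul]
  have hσι : ∀ g u, σ g (ι u) = ι (φ g u) := by
    intro g
    obtain ⟨c, hc, hac⟩ := ha
    obtain ⟨d, hd, rfl⟩ := exists_root hm0 c hc
    obtain ⟨t, ht, hta⟩ := exists_pow_hasLead hm hd hac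
    have key : ((σ g : AutPowerSeries k) : k⟦X⟧ →ₐ[k] k⟦X⟧).comp ι
        = ι.comp ((φ g : AutPowerSeries k) : k⟦X⟧ →ₐ[k] k⟦X⟧) := by
      refine algHom_ext_of_hasLead hd ht (lC_injective ?_)
      show ((σ g (ι t) : k⟦X⟧) : 𝕂 k) = ((ι (φ g t) : k⟦X⟧) : 𝕂 k)
      obtain ⟨w, hw, hιXw⟩ := hιX
      have h1 := (HasLead.laurentMap (hf := hι) hιXw hw ht).aut (σ g)
      have h2 := HasLead.laurentMap (hf := hι) hιXw hw (ht.aut (φ g))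
      rw [laurentMap_coe, laurentAut_coe, mul_one, zpow_one, zpow_natCast, hσ1, hθ] at h1
      rw [laurentAut_coe, laurentMap_coe, mul_one, zpow_one, zpow_one, ← coe_tameChar,
        mul_right_comm] at h2
      refine eq_of_pow_eq hm (mul_ne_zero (mul_ne_zero hd hw) (tameChar φ g).ne_zero) h1 h2 ?_
      have h3 := hσa g
      rw [← hta, map_zpow₀, map_zpow₀, map_zpow₀, map_zpow₀, laurentMap_coe, laurentAut_coe,
        laurentAut_coe, laurentMap_coe, zpow_neg, zpow_neg, inv_inj] at h3
      simpa using h3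
    exact fun u => DFunLike.congr_fun key u
  have hσιL : ∀ g x, laurentAut (σ g) (laurentMap ι hι x) =
      laurentMap ι hι (laurentAut (φ g) x) := by
    intro g x
    have : (laurentAut (σ g)).comp (laurentMap ι hι) = (laurentMap ι hι).comp (laurentAut (φ g)) :=
      ringHom_ext_laurent fun u => by
        rw [RingHom.comp_apply, RingHom.comp_apply, laurentMap_coe, laurentAut_coe, laurentAut_coe,
          laurentMap_coe, hσι]
    exact DFunLike.congr_fun this x
  have hmul : ∀ g h, σ (g * h) = σ g * σ h := by
    intro g h
    apply aut_ext_lX_zpow hm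
    · rw [tameCoeff_mul, hσ1, hσ1, hσ1, map_mul, Units.val_mul]
    · rw [laurentAut_mul, hσ2 h, map_mul, map_add, hσ2, laurentAut_C, hσιL, hσ2, hβ, map_mul,
        Units.val_mul, mul_inv, map_mul, map_add, map_mul, laurentMap_C]
      linear_combination HahnSeries.C ((χ h : k)⁻¹) *
        laurentMap ι hι (laurentAut (φ g) (β h)) * hχC' g
  refine ⟨ι, hι, MonoidHom.mk' σ hmul, hιX, ?_, hσι, hσ2, hιb⟩
  ext g
  exact hσ1 g

end Lifting

/-! ### Crossed homomorphisms with values in Laurent series -/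

section CrossedHom

variable {k : Type*} [Field k]

/-- By independence of characters, a faithful action has an element of trace `1`. -/
theorem exists_sum_laurentAut_eq_one {H : Type*} [Group H] [Fintype H] {φ : H →* AutPowerSeries k}
    (hφ : Function.Injective φ) : ∃ z : 𝕂 k, ∑ h, laurentAut (φ h) z = 1 := by
  have hinj : Function.Injective fun h : H => (laurentAut (φ h) : 𝕂 k →* 𝕂 k) := by
    intro g h hgh
    apply hφ
    apply aut_ext_X
    apply lC_injective
    have := DFunLike.congr_fun hgh ((X : k⟦X⟧) : 𝕂 k)
    rw [← laurentAut_coe, ← laurentAut_coe]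
    exact this
  have hli := (linearIndependent_monoidHom (𝕂 k) (𝕂 k)).comp _ hinj
  obtain ⟨x, hx⟩ : ∃ x : 𝕂 k, ∑ h, laurentAut (φ h) x ≠ 0 := by
    by_contra! hall
    rw [Fintype.linearIndependent_iff] at hli
    have := hli (fun _ => 1) (by
      funext x
      simpa using hall x) 1
    exact one_ne_zero this
  set c := ∑ h, laurentAut (φ h) x with hc
  have hcinv : ∀ g, laurentAut (φ g) c = c := by
    intro g
    rw [hc, map_sum]
    refine Fintype.sum_equiv (Equiv.mulLeft g) _ _ fun h => ?_
    rw [← laurentAut_mul, ← map_mul]; rfl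
  refine ⟨x * c⁻¹, ?_⟩
  simp_rw [map_mul, map_inv₀, hcinv]
  rw [← Finset.sum_mul, ← hc, mul_inv_cancel₀ hx]

section

variable {G : Type*} [Group G] [Finite G] {V : Subgroup G} [V.Normal]
  {φ : G ⧸ V →* AutPowerSeries k}

/-- An additive form of Hilbert's Theorem 90: a twisted crossed homomorphism that vanishes on `V` is a
coboundary. -/
theorem exists_coboundary_eq (hφ : Function.Injective φ) (χ : G →* kˣ) {γ : G → 𝕂 k} (hγV : ∀ v ∈ V, γ v = 0)
    (hγ : ∀ g h : G, γ (g * h) = γ g + HahnSeries.C (χ g : k) * laurentAut (φ g) (γ h)) :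
    ∃ a : 𝕂 k, ∀ g : G, HahnSeries.C (χ g : k) * laurentAut (φ g) a - a = γ g := by
  cases nonempty_fintype (G ⧸ V)
  obtain ⟨z, hz⟩ := exists_sum_laurentAut_eq_one hφ
  have hout : ∀ g : G, γ (g : G ⧸ V).out = γ g := by
    intro g
    obtain ⟨v, hv⟩ := QuotientGroup.mk_out_eq_mul V g
    rw [hv, hγ, hγV _ v.2, map_zero, mul_zero, add_zero]
  refine ⟨-∑ h : G ⧸ V, γ h.out * laurentAut (φ h) z, fun g => ?_⟩
  have h1 : HahnSeries.C (χ g : k) * laurentAut (φ g) (∑ h : G ⧸ V, γ h.out * laurentAut (φ h) z)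
      = ∑ h : G ⧸ V, (γ h.out - γ g) * laurentAut (φ h) z := by
    rw [map_sum, Finset.mul_sum]
    refine Fintype.sum_equiv (Equiv.mulLeft (g : G ⧸ V)) _ _ fun h => ?_
    rw [map_mul, ← laurentAut_mul, ← map_mul, ← mul_assoc]
    have h2 : γ ((g : G ⧸ V) * h).out
        = γ g + HahnSeries.C (χ g : k) * laurentAut (φ g) (γ h.out) := by
      rw [← hγ, ← hout (g * h.out)]
      congr 2
      rw [QuotientGroup.mk_mul, QuotientGroup.out_eq']
    rw [Equiv.coe_mulLeft, h2, add_sub_cancel_left]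
  rw [map_neg, mul_neg, h1]
  simp_rw [sub_mul]
  rw [Finset.sum_sub_distrib, ← Finset.mul_sum, hz]
  ring

/-- A homomorphism from `V` to `k` which is semi-invariant under conjugation extends to a twisted
crossed homomorphism on `G`. -/
theorem exists_crossedHom_extension (hφ : Function.Injective φ) (χ : G →* kˣ) {j : G → k}
    (hj : ∀ v ∈ V, ∀ w ∈ V, j (v * w) = j v + j w)
    (hjχ : ∀ g, ∀ v ∈ V, j (g * v * g⁻¹) = χ g * j v) :
    ∃ β : G → 𝕂 k, (∀ v ∈ V, β v = HahnSeries.C (j v)) ∧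
      ∀ g h : G, β (g * h) = β g + HahnSeries.C (χ g : k) * laurentAut (φ g) (β h) := by
  cases nonempty_fintype (G ⧸ V)
  obtain ⟨z, hz⟩ := exists_sum_laurentAut_eq_one hφ
  -- the factors in `V` by which the chosen representatives fail to be compatible with products
  set N : G → G ⧸ V → G := fun g h => g * h.out * ((g : G ⧸ V) * h).out⁻¹ with hN
  have hNV : ∀ g h, N g h ∈ V := by
    intro g h
    rw [← QuotientGroup.eq_one_iff]
    simp [hN]
  refine ⟨fun g => ∑ h : G ⧸ V, HahnSeries.C (j (N g h)) * laurentAut (φ (g * h)) z, ?_, ?_⟩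
  · intro v hv
    have hv1 : (v : G ⧸ V) = 1 := (QuotientGroup.eq_one_iff v).mpr hv
    have : ∀ h, N v h = v := by
      intro h
      simp [hN, hv1]
    simp_rw [this, hv1, one_mul]
    rw [← Finset.mul_sum, hz, mul_one]
  · intro g g'
    have h1 : ∀ h, j (N (g * g') h) = χ g * j (N g' h) + j (N g (g' * h)) := by
      intro h
      rw [← hjχ _ _ (hNV g' h), ← hj _ (Subgroup.Normal.conj_mem ‹_› _ (hNV g' h) g) _ (hNV _ _)]
      congr 1
      simp only [hN, QuotientGroup.mk_mul, mul_assoc]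
      group
    have h2 : ∀ h : G ⧸ V, ((g * g' : G) : G ⧸ V) * h = g * (g' * h) := by
      intro h; rw [QuotientGroup.mk_mul, mul_assoc]
    simp_rw [h1, h2, map_add, add_mul]
    rw [Finset.sum_add_distrib, add_comm]
    congr 1
    · exact Fintype.sum_equiv (Equiv.mulLeft (g' : G ⧸ V)) _ _ fun h => rfl
    · rw [map_sum, Finset.mul_sum]
      refine Finset.sum_congr rfl fun h _ => ?_
      rw [map_mul φ (g : G ⧸ V), laurentAut_mul, map_mul (laurentAut (φ (g : G ⧸ V))), laurentAut_C,
        map_mul, mul_assoc]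

end

end CrossedHom

/-! ### Semi-invariant embeddings of minimal normal subgroups -/

section Semiinvariant

variable {k : Type*} [Field k]

/-- Additive functions to `k` separate the points of an elementary abelian `p`-group `V`; they are
extended by `0` outside `V`. -/
theorem exists_additive_ne_zero (p : ℕ) [Fact p.Prime] [CharP k p] {G : Type*} [Group G]
    (V : Subgroup G) (hcomm : ∀ v ∈ V, ∀ w ∈ V, v * w = w * v) (hexp : ∀ v ∈ V, v ^ p = 1)
    {v₀ : G} (hv₀ : v₀ ∈ V) (hne : v₀ ≠ 1) :
    ∃ μ : G → k, (∀ v ∈ V, ∀ w ∈ V, μ (v * w) = μ v + μ w) ∧ (∀ g, g ∉ V → μ g = 0) ∧ μ v₀ ≠ 0 := by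
  classical
  let _ : CommGroup V := { (inferInstance : Group V) with
    mul_comm := fun a b => Subtype.ext (hcomm a a.2 b b.2) }
  let _ : Module (ZMod p) (Additive V) := AddCommGroup.zmodModule (n := p) fun x =>
    Additive.toMul.injective (Subtype.ext (hexp _ (Additive.toMul x).2))
  have h1 : (Additive.ofMul (⟨v₀, hv₀⟩ : V)) ≠ 0 := fun h =>
    hne (congrArg (fun x : Additive V => ((Additive.toMul x : V) : G)) h)
  obtain ⟨f, hf⟩ : ∃ f : Module.Dual (ZMod p) (Additive V), f (Additive.ofMul ⟨v₀, hv₀⟩) ≠ 0 := by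
    by_contra! hall
    exact h1 ((Module.forall_dual_apply_eq_zero_iff (ZMod p) _).mp hall)
  refine ⟨fun g => if h : g ∈ V then ZMod.castHom (dvd_refl p) k (f (Additive.ofMul ⟨g, h⟩)) else 0,
    ?_, ?_, ?_⟩
  · intro v hv w hw
    simp only [hv, hw, mul_mem hv hw, dif_pos]
    rw [← map_add, ← map_add]
    rfl
  · intro g hg
    simp [hg]
  · simp only [hv₀, dif_pos]
    exact (map_ne_zero_iff _ (ZMod.castHom (dvd_refl p) k).injective).mpr hf

/-- A minimal normal subgroup `V` contained in the kernel of a character `θ` into `kˣ`, when this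
kernel is a non-trivial `p`-group, embeds into the additive group of `k`, in such a way that
conjugation becomes multiplication by a power of `θ`. -/
theorem exists_semiinvariant_embedding [IsAlgClosed k] (p : ℕ) [Fact p.Prime] [CharP k p] (f : ℕ)
    {G : Type*} [Group G] [Finite G] (θ : G →* kˣ) (hker : IsPGroup p θ.ker) (hne : θ.ker ≠ ⊥)
    (hθ : ∀ g, (θ g : k) ^ (p ^ f) = θ g) :
    ∃ V : Subgroup G, V.Normal ∧ V ≤ θ.ker ∧ V ≠ ⊥ ∧ (∀ v ∈ V, v ^ p = 1) ∧
      ∃ (e : ℕ) (j : G → k), (∀ v ∈ V, ∀ w ∈ V, j (v * w) = j v + j w) ∧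
        (∀ g, ∀ v ∈ V, j (g * v * g⁻¹) = (θ g : k) ^ e * j v) ∧
        (∀ v ∈ V, j v = 0 → v = 1) ∧ ∀ v ∈ V, j v ^ (p ^ f) = j v := by
  classical
  have hp : p.Prime := Fact.out
  -- the elements of order dividing `p` in the center of the kernel
  let A : Subgroup G :=
    { carrier := {z | z ∈ θ.ker ∧ (∀ x ∈ θ.ker, x * z = z * x) ∧ z ^ p = 1}
      one_mem' := ⟨one_mem _, by simp, one_pow _⟩
      mul_mem' := by
        rintro a b ⟨ha, ha', hap⟩ ⟨hb, hb', hbp⟩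
        refine ⟨mul_mem ha hb, fun x hx => ?_, ?_⟩
        · rw [← mul_assoc, ha' x hx, mul_assoc, hb' x hx, mul_assoc]
        · rw [Commute.mul_pow (hb' a ha), hap, hbp, one_mul]
      inv_mem' := by
        rintro a ⟨ha, ha', hap⟩
        refine ⟨inv_mem ha, fun x hx => ?_, by rw [inv_pow, hap, inv_one]⟩
        exact (Commute.inv_right (ha' x hx)) }
  have hAconj : ∀ g, ∀ a ∈ A, g * a * g⁻¹ ∈ A := by
    rintro g a ⟨ha, ha', hap⟩
    refine ⟨Subgroup.Normal.conj_mem inferInstance _ ha g, fun x hx => ?_, ?_⟩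
    · have h1 : g⁻¹ * x * g ∈ θ.ker := by
        simpa using Subgroup.Normal.conj_mem (inferInstance : θ.ker.Normal) _ hx g⁻¹
      have h2 := ha' _ h1
      calc x * (g * a * g⁻¹) = g * ((g⁻¹ * x * g) * a) * g⁻¹ := by group
        _ = g * (a * (g⁻¹ * x * g)) * g⁻¹ := by rw [h2]
        _ = g * a * g⁻¹ * x := by group
    · rw [conj_pow, hap, mul_one, mul_inv_cancel]
  have hAne : ∃ a ∈ A, a ≠ 1 := by
    have : Nontrivial θ.ker := (Subgroup.nontrivial_iff_ne_bot _).mpr hne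
    have := hker.center_nontrivial
    have hpc : IsPGroup p (Subgroup.center θ.ker) := hker.to_subgroup _
    obtain ⟨n, hn0, hn⟩ := hpc.nontrivial_iff_card.mp this
    obtain ⟨z, hz⟩ := exists_prime_orderOf_dvd_card' (G := Subgroup.center θ.ker) p
      (hn ▸ dvd_pow_self p hn0.ne')
    refine ⟨((z : θ.ker) : G), ⟨(z : θ.ker).2, fun x hx => ?_, ?_⟩, ?_⟩
    · have := Subgroup.mem_center_iff.mp z.2 ⟨x, hx⟩
      exact congrArg Subtype.val this
    · have := pow_orderOf_eq_one z
      rw [hz] at this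
      exact congrArg (fun y : Subgroup.center θ.ker => ((y : θ.ker) : G)) this
    · intro h1
      have : z = 1 := Subtype.ext (Subtype.ext h1)
      rw [this, orderOf_one] at hz
      exact hp.one_lt.ne hz
  obtain ⟨V, ⟨hVn, hVA, hVne⟩, hVmin⟩ := WellFounded.has_min
    (wellFounded_lt (α := Subgroup G))
    {V : Subgroup G | V.Normal ∧ V ≤ A ∧ V ≠ ⊥} ⟨A, ⟨fun a ha g => hAconj g a ha⟩, le_rfl, by
      obtain ⟨a, ha, ha1⟩ := hAne
      intro h
      rw [h] at ha
      exact ha1 (Subgroup.mem_bot.mp ha)⟩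
  have hmin : ∀ K : Subgroup G, K.Normal → K ≤ V → K ≠ ⊥ → V ≤ K := by
    intro K hK hKV hKne
    by_contra h
    exact hVmin K ⟨hK, hKV.trans hVA, hKne⟩ (lt_of_le_not_ge hKV h)
  obtain ⟨⟨v₀, hv₀⟩, hv₀1'⟩ := V.ne_bot_iff_exists_ne_one.mp hVne
  have hv₀1 : v₀ ≠ 1 := fun h => hv₀1' (Subtype.ext h)
  obtain ⟨μ, hμadd, hμ0, hμne⟩ := exists_additive_ne_zero (k := k) p V
    (fun v hv w hw => (hVA hw).2.1 v (hVA hv).1) (fun v hv => (hVA hv).2.2) hv₀ hv₀1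
  -- the space of additive functions on `V`
  let W : Submodule k (G → k) :=
    { carrier := {μ | (∀ v ∈ V, ∀ w ∈ V, μ (v * w) = μ v + μ w) ∧ ∀ g, g ∉ V → μ g = 0}
      zero_mem' := by simp
      add_mem' := by
        rintro a b ⟨ha, ha'⟩ ⟨hb, hb'⟩
        refine ⟨fun v hv w hw => ?_, fun g hg => ?_⟩
        · simp only [Pi.add_apply, ha v hv w hw, hb v hv w hw]; ring
        · simp [ha' g hg, hb' g hg]
      smul_mem' := by
        rintro c a ⟨ha, ha'⟩
        refine ⟨fun v hv w hw => ?_, fun g hg => ?_⟩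
        · simp only [Pi.smul_apply, ha v hv w hw, smul_add]
        · simp [ha' g hg] }
  -- a generator of the image of `θ`
  have hfin : Finite θ.range := (Set.finite_range θ).to_subtype
  obtain ⟨⟨ζ, c, hcζ⟩, hζ⟩ := IsCyclic.exists_generator (α := θ.range)
  have hVconj : ∀ g v, g * v * g⁻¹ ∈ V ↔ v ∈ V := fun g v => (hVn.mem_comm_iff.trans (by simp))
  have hgen : ∀ g : G, ∃ i : ℕ, ∃ x ∈ θ.ker, g = c ^ i * x := by
    intro g
    obtain ⟨i, hi⟩ := mem_powers_iff_mem_zpowers.mpr (hζ ⟨θ g, g, rfl⟩)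
    have hi' : ζ ^ i = θ g := congrArg Subtype.val hi
    refine ⟨i, (c ^ i)⁻¹ * g, ?_, by group⟩
    rw [MonoidHom.mem_ker, map_mul, map_inv, map_pow, hcζ, hi', inv_mul_cancel]
  -- a semi-invariant additive function is an eigenvector of conjugation by `c`
  let T : W →ₗ[k] W :=
    { toFun := fun μ => ⟨fun v => μ.1 (c * v * c⁻¹), by
        refine ⟨fun v hv w hw => ?_, fun g hg => μ.2.2 _ (by rwa [hVconj])⟩
        rw [← μ.2.1 _ ((hVconj c v).mpr hv) _ ((hVconj c w).mpr hw)]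
        group⟩
      map_add' := fun _ _ => rfl
      map_smul' := fun _ _ => rfl }
  have hWne : Nontrivial W := ⟨⟨⟨μ, hμadd, hμ0⟩, 0, fun h =>
    hμne (congrFun (congrArg Subtype.val h) v₀)⟩⟩
  obtain ⟨α, hα⟩ := Module.End.exists_eigenvalue T
  obtain ⟨⟨l, hladd, hl0⟩, hl⟩ := hα.exists_hasEigenvector
  have hlc : ∀ v, l (c * v * c⁻¹) = α * l v := fun v =>
    congrFun (congrArg Subtype.val hl.apply_eq_smul) v
  have hlne : ∃ v ∈ V, l v ≠ 0 := by
    by_contra! hall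
    apply hl.2
    apply Subtype.ext
    funext v
    by_cases hv : v ∈ V
    · exact hall v hv
    · exact hl0 v hv
  have hlpow : ∀ (i : ℕ) v, l (c ^ i * v * (c ^ i)⁻¹) = α ^ i * l v := by
    intro i
    induction i with
    | zero => simp
    | succ i ih =>
      intro v
      rw [pow_succ' α, mul_assoc (α : k), ← ih, ← hlc]
      congr 1
      rw [pow_succ']
      group
  have hlker : ∀ x ∈ θ.ker, ∀ v ∈ V, l (x * v * x⁻¹) = l v := by
    intro x hx v hv
    rw [(hVA hv).2.1 x hx, mul_inv_cancel_right]
  have hαζ : α ^ orderOf ζ = 1 := by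
    obtain ⟨v, hv, hlv⟩ := hlne
    have h1 : c ^ orderOf ζ ∈ θ.ker := by
      rw [MonoidHom.mem_ker, map_pow, hcζ, pow_orderOf_eq_one]
    have h2 := hlpow (orderOf ζ) v
    rw [hlker _ h1 v hv] at h2
    exact mul_right_cancel₀ hlv (by rw [← h2, one_mul])
  have hζfin : 0 < orderOf ζ := by
    have : IsOfFinOrder ζ := by
      rw [← hcζ]; exact MonoidHom.isOfFinOrder θ (isOfFinOrder_of_finite c)
    exact this.orderOf_pos
  have : NeZero (orderOf ζ) := ⟨hζfin.ne'⟩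
  obtain ⟨e, -, he⟩ := (IsPrimitiveRoot.coe_units_iff.mpr
    (IsPrimitiveRoot.orderOf ζ)).eq_pow_of_pow_eq_one hαζ
  have hlθ : ∀ g, ∀ v ∈ V, l (g * v * g⁻¹) = (θ g : k) ^ e * l v := by
    intro g v hv
    obtain ⟨i, x, hx, rfl⟩ := hgen g
    rw [show c ^ i * x * v * (c ^ i * x)⁻¹ = c ^ i * (x * v * x⁻¹) * (c ^ i)⁻¹ by group, hlpow,
      hlker x hx v hv, map_mul, MonoidHom.mem_ker.mp hx, mul_one, map_pow, hcζ, ← he]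
    push_cast
    rw [pow_right_comm]
  have hl1 : l 1 = 0 := by
    have := hladd 1 (one_mem _) 1 (one_mem _)
    rwa [mul_one, left_eq_add] at this
  have hlinv : ∀ v ∈ V, l v⁻¹ = -l v := by
    intro v hv
    have := hladd v hv v⁻¹ (inv_mem hv)
    rw [mul_inv_cancel, hl1] at this
    linear_combination -this
  -- the kernel is trivial by minimality
  have hlinj : ∀ v ∈ V, l v = 0 → v = 1 := by
    let K : Subgroup G :=
      { carrier := {v | v ∈ V ∧ l v = 0}
        one_mem' := ⟨one_mem _, hl1⟩
        mul_mem' := fun {a b} ha hb => ⟨mul_mem ha.1 hb.1, by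
          rw [hladd a ha.1 b hb.1, ha.2, hb.2, add_zero]⟩
        inv_mem' := fun {a} ha => ⟨inv_mem ha.1, by rw [hlinv a ha.1, ha.2, neg_zero]⟩ }
    have hKn : K.Normal := ⟨fun v hv g => ⟨(hVconj g v).mpr hv.1, by
      rw [hlθ g v hv.1, hv.2, mul_zero]⟩⟩
    obtain ⟨v, hv, hlv⟩ := hlne
    have hK : K = ⊥ := by
      by_contra h
      exact hlv (hmin K hKn (fun x hx => hx.1) h hv).2
    intro w hw hw0
    have : w ∈ K := ⟨hw, hw0⟩
    rwa [hK, Subgroup.mem_bot] at this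
  have hlv₀ : l v₀ ≠ 0 := fun h => hv₀1 (hlinj v₀ hv₀ h)
  refine ⟨V, hVn, fun v hv => (hVA hv).1, hVne, fun v hv => (hVA hv).2.2, e, fun g => l g / l v₀,
    ?_, ?_, ?_, ?_⟩
  · intro v hv w hw
    simp only [hladd v hv w hw, add_div]
  · intro g v hv
    simp only [hlθ g v hv, mul_div_assoc]
  · intro v hv h
    exact hlinj v hv ((div_eq_zero_iff.mp h).resolve_right hlv₀)
  · -- the elements with values in the field with `p ^ f` elements form a normal subgroup
    let K : Subgroup G :=
      { carrier := {v | v ∈ V ∧ (l v / l v₀) ^ (p ^ f) = l v / l v₀}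
        one_mem' := ⟨one_mem _, by rw [hl1, zero_div, zero_pow (pow_ne_zero _ hp.ne_zero)]⟩
        mul_mem' := fun {a b} ha hb => ⟨mul_mem ha.1 hb.1, by
          rw [hladd a ha.1 b hb.1, add_div, add_pow_char_pow, ha.2, hb.2]⟩
        inv_mem' := fun {a} ha => ⟨inv_mem ha.1, by
          rw [hlinv a ha.1, neg_div, ← zero_sub, sub_pow_char_pow, ha.2,
            zero_pow (pow_ne_zero _ hp.ne_zero)]⟩ }
    have hKn : K.Normal := ⟨fun v hv g => ⟨(hVconj g v).mpr hv.1, by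
      rw [hlθ g v hv.1, mul_div_assoc, mul_pow, hv.2, ← pow_mul, mul_comm e, pow_mul, hθ]⟩⟩
    have hv₀K : v₀ ∈ K := ⟨hv₀, by rw [div_self hlv₀, one_pow]⟩
    have hVK := hmin K hKn (fun x hx => hx.1) (by
      intro h
      rw [h, Subgroup.mem_bot] at hv₀K
      exact hv₀1 hv₀K)
    exact fun v hv => (hVK hv).2

end Semiinvariant

/-! ### Actions with prescribed tame character and strongly growing ramification -/

section Existence

variable {k : Type*} [Field k]

/-- An injective action of `G` on `k⟦X⟧` such that, on the non-trivial elements of the wild inertia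
group, the ramification indices are divisible by `p ^ N`, are at least `R`, and grow at least by a
factor `R` under `g ↦ g ^ p`. The last condition makes inductive constructions possible: every
semi-invariance condition on `x : k((X))` is satisfied by some `x` which modulo elements
`w ^ (p ^ f) - w` has an arbitrarily large pole order `l` with `l ≡ -1` modulo `p ^ N`. -/
structure IsStronglyRamified (p f N R : ℕ) {G : Type*} [Group G] (φ : G →* AutPowerSeries k) :
    Prop where
  injective : Function.Injective φ
  dvd_ramIndex : ∀ g, g ≠ 1 → tameChar φ g = 1 → p ^ N ∣ ramIndex φ g
  le_ramIndex : ∀ g, g ≠ 1 → tameChar φ g = 1 → R ≤ ramIndex φ g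
  mul_ramIndex_le : ∀ g, g ^ p ≠ 1 → tameChar φ g = 1 → R * ramIndex φ g ≤ ramIndex φ (g ^ p)
  exists_pole : ∀ e M : ℕ, ∃ (x w : 𝕂 k) (l : ℕ), M ≤ l ∧ p ^ N ∣ l + 1 ∧
    OrdEq (-l : ℤ) (x - (w ^ (p ^ f) - w)) ∧
    ∀ g, HahnSeries.C ((tameChar φ g : k) ^ e) * laurentAut (φ g) x = x

theorem laurentAut_laurentMap {ι : k⟦X⟧ →ₐ[k] k⟦X⟧} {hι : Function.Injective ι}
    {σ τ : AutPowerSeries k} (h : ∀ u, σ (ι u) = ι (τ u)) (x : 𝕂 k) :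
    laurentAut σ (laurentMap ι hι x) = laurentMap ι hι (laurentAut τ x) := by
  have : (laurentAut σ).comp (laurentMap ι hι) = (laurentMap ι hι).comp (laurentAut τ) :=
    ringHom_ext_laurent fun u => by
      rw [RingHom.comp_apply, RingHom.comp_apply, laurentMap_coe, laurentAut_coe, laurentAut_coe,
        laurentMap_coe, h]
  exact DFunLike.congr_fun this x

theorem exists_ordGE (x : 𝕂 k) : ∃ A : ℕ, OrdGE (-A : ℤ) x := by
  by_cases h : x = 0
  · exact ⟨0, h ▸ ordGE_zero⟩
  · obtain ⟨n, hn⟩ := exists_ordEq h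
    exact ⟨n.natAbs, hn.ordGE.mono (by omega)⟩

/-- An injective character acts on `k⟦X⟧` by scaling `X`. There is no wild inertia, and a monomial
`X ^ (-l)` serves as semi-invariant element for each exponent `-l` in a residue class. -/
theorem exists_isStronglyRamified_of_injective (p : ℕ) [Fact p.Prime] {f : ℕ} (hf : f ≠ 0) (N R : ℕ)
    {G : Type*} [Group G] (θ : G →* kˣ) (hθi : Function.Injective θ)
    (hθ : ∀ g, (θ g : k) ^ (p ^ f) = θ g) :
    ∃ φ : G →* AutPowerSeries k, tameChar φ = θ ∧ IsStronglyRamified p f N R φ := by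
  have hp := (Fact.out : p.Prime)
  have hq2 : 2 ≤ p ^ f := hp.two_le.trans (Nat.le_self_pow hf p)
  have h1 : ((1 : ℕ) : k) ≠ 0 := by simp
  have hex : ∀ g, ∃ σ : AutPowerSeries k, tameCoeff σ = θ g ∧
      laurentAut σ (lX k ^ (-(1 : ℕ) : ℤ)) =
        HahnSeries.C ((θ g : k)⁻¹) * lX k ^ (-(1 : ℕ) : ℤ) := by
    intro g
    apply exists_aut_lX_zpow h1 (θ g).ne_zero
    have := (hasLead_C ((θ g : k)⁻¹)).mul (hasLead_lX_zpow (k := k) (-(1 : ℕ)))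
    simpa using this
  choose σ hσ1 hσ2 using hex
  have hσX : ∀ g, laurentAut (σ g) (lX k) = HahnSeries.C (θ g : k) * lX k := by
    intro g
    have := congrArg (·⁻¹) (hσ2 g)
    simpa [mul_inv, ← map_inv₀] using this
  have hmul : ∀ g h, σ (g * h) = σ g * σ h := by
    intro g h
    apply aut_ext_lX_zpow h1
    · rw [tameCoeff_mul, hσ1, hσ1, hσ1, map_mul, Units.val_mul]
    · rw [laurentAut_mul, hσ2 h, map_mul, hσ2, laurentAut_C, hσ2, map_mul, Units.val_mul, mul_inv,
        map_mul]
      ring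
  have htame : tameChar (MonoidHom.mk' σ hmul) = θ := by
    ext g
    exact hσ1 g
  have htriv : ∀ g, tameChar (MonoidHom.mk' σ hmul) g = 1 → g = 1 := by
    intro g hg
    rw [htame] at hg
    exact hθi (by rw [hg, map_one])
  refine ⟨MonoidHom.mk' σ hmul, htame, ?_, ?_, ?_, ?_, ?_⟩
  · rw [injective_iff_map_eq_one]
    intro g hg
    apply htriv
    rw [tameChar, MonoidHom.comp_apply, hg, map_one]
  · exact fun g hg hg1 => absurd (htriv g hg1) hg
  · exact fun g hg hg1 => absurd (htriv g hg1) hg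
  · intro g hg hg1
    rw [htriv g hg1, one_pow] at hg
    exact absurd rfl hg
  · intro e M
    rw [htame]
    -- a multiple of `p ^ N` with `K ≡ e + 1` modulo the order of every `θ g`
    set K := (e + 1 + M * (p ^ f - 1)) * (p ^ f) ^ N with hK
    have hpos : 1 ≤ (p ^ f) ^ N := Nat.one_le_pow _ _ (by omega)
    have hMle : M ≤ M * (p ^ f - 1) := Nat.le_mul_of_pos_right _ (by omega)
    have hKM : M + 1 ≤ K := by nlinarith
    refine ⟨lX k ^ (-(K - 1 : ℕ) : ℤ), 0, K - 1, by omega, ?_, ?_, ?_⟩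
    · rw [Nat.sub_add_cancel (by omega), hK, ← pow_mul, mul_comm f, pow_mul]
      exact (dvd_pow_self _ hf).mul_left _
    · rw [zero_pow (by omega), sub_zero, sub_zero]
      exact ⟨1, one_ne_zero, hasLead_lX_zpow _⟩
    · intro g
      have hg : (θ g : k) ^ (K - 1) = (θ g : k) ^ e := by
        apply mul_right_cancel₀ (θ g).ne_zero
        rw [← pow_succ, ← pow_succ, Nat.sub_add_cancel (by omega), hK, mul_comm, pow_mul]
        have h2 : ∀ n, (θ g : k) ^ (p ^ f) ^ n = θ g := by
          intro n
          induction n with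
          | zero => simp
          | succ n ih => rw [pow_succ, pow_mul, ih, hθ]
        have h3 : (θ g : k) ^ (p ^ f - 1) = 1 := by
          apply mul_right_cancel₀ (θ g).ne_zero
          rw [← pow_succ, Nat.sub_add_cancel (by omega), hθ, one_mul]
        rw [h2, pow_add, mul_comm M, pow_mul, h3, one_pow, mul_one]
      show HahnSeries.C ((θ g : k) ^ e) * laurentAut (σ g) _ = _
      rw [map_zpow₀, hσX, ← hg, mul_zpow, zpow_neg, zpow_natCast, ← map_pow, ← mul_assoc,
        mul_inv_cancel₀, one_mul]
      rw [Ne, _root_.map_eq_zero]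
      exact pow_ne_zero _ (θ g).ne_zero

/-- Every character of a finite group with kernel a `p`-group is the tame character of a strongly
ramified action. By induction there is such an action of `G ⧸ V`, where `V` is a minimal normal
subgroup in the kernel; the group `V` embeds into `k`, and it becomes the Galois group of an
Artin–Schreier extension of `k((X))` whose conductor `m` may be chosen much larger than all
ramification indices of `G ⧸ V`. -/
theorem exists_isStronglyRamified (p : ℕ) [Fact p.Prime] [CharP k p] [IsAlgClosed k]
    {f : ℕ} (hf : f ≠ 0) {N : ℕ} (hN : N ≠ 0) (R : ℕ) {G : Type*} [Group G] [Finite G] (θ : G →* kˣ) (hker : IsPGroup p θ.ker)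
    (hθ : ∀ g, (θ g : k) ^ (p ^ f) = θ g) :
    ∃ φ : G →* AutPowerSeries k, tameChar φ = θ ∧ IsStronglyRamified p f N R φ := by
  have hp := (Fact.out : p.Prime)
  have hq2 : 2 ≤ p ^ f := hp.two_le.trans (Nat.le_self_pow hf p)
  induction hn : Nat.card G using Nat.strong_induction_on generalizing G with
  | _ n ih =>
  by_cases hne : θ.ker = ⊥
  · exact exists_isStronglyRamified_of_injective p hf N R θ ((MonoidHom.ker_eq_bot_iff θ).mp hne) hθ
  obtain ⟨V, hVn, hVker, hVne, hVp, e, j, hjadd, hjθ, hjinj, hjq⟩ :=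
    exists_semiinvariant_embedding p f θ hker hne hθ
  set θ' : G ⧸ V →* kˣ := QuotientGroup.lift V θ hVker with hθ'
  have hcard : Nat.card (G ⧸ V) < n := by
    rw [← hn, Subgroup.card_eq_card_quotient_mul_card_subgroup V]
    exact lt_mul_of_one_lt_right Nat.card_pos (by
      rw [Subgroup.one_lt_card_iff_ne_bot]; exact hVne)
  obtain ⟨φ₁, hφ₁θ, hφ₁⟩ := ih _ hcard θ' (by
    rintro ⟨g, hg⟩
    induction g using QuotientGroup.induction_on with
    | H g =>
    obtain ⟨i, hi⟩ := hker ⟨g, hg⟩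
    refine ⟨i, Subtype.ext ?_⟩
    have : g ^ p ^ i = 1 := congrArg Subtype.val hi
    show ((g : G ⧸ V)) ^ p ^ i = 1
    rw [← QuotientGroup.mk_pow, this, QuotientGroup.mk_one]) (by
    intro g
    induction g using QuotientGroup.induction_on with
    | H g => exact hθ g) rfl
  set χ : G →* kˣ := θ ^ e with hχ
  have hχv : ∀ g, (χ g : k) = (θ g : k) ^ e := fun g => by simp [hχ]
  have hχq : ∀ g, (χ g : k) ^ (p ^ f) = χ g := fun g => by
    rw [hχv, ← pow_mul, mul_comm, pow_mul, hθ]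
  have hχC : ∀ g, (HahnSeries.C (χ g : k) : 𝕂 k) ^ (p ^ f) = HahnSeries.C (χ g : k) := fun g => by
    rw [← map_pow, hχq]
  -- the embedding problem given by `G → G ⧸ V` has a solution `a₀`
  obtain ⟨β₀, hβ₀V, hβ₀⟩ := exists_crossedHom_extension hφ₁.injective χ hjadd
    (fun g v hv => by rw [hχv]; exact hjθ g v hv)
  obtain ⟨a₀, ha₀⟩ := exists_coboundary_eq hφ₁.injective χ
    (γ := fun g => β₀ g ^ (p ^ f) - β₀ g) (fun v hv => by
      simp only [hβ₀V v hv, ← map_pow, hjq v hv, sub_self]) (fun g h => by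
      simp only [hβ₀ g h, add_pow_sub_add, mul_pow, hχC, map_sub, map_pow, mul_sub])
  obtain ⟨A, hA⟩ := exists_ordGE a₀
  -- it is modified by an element with a much larger pole
  cases nonempty_fintype (G ⧸ V)
  set M := A + 1 + R + ∑ h, (R + 1) * ramIndex φ₁ h with hM
  obtain ⟨x, w, m, hMm, hmN, hxw, hx⟩ := hφ₁.exists_pole e M
  have hram : ∀ h, (R + 1) * ramIndex φ₁ h < m := by
    intro h
    have := Finset.single_le_sum (f := fun h => (R + 1) * ramIndex φ₁ h)
      (fun _ _ => Nat.zero_le _) (Finset.mem_univ h)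
    omega
  have hmp : ¬ p ∣ m := by
    intro h
    have h1 : p ∣ m + 1 := (dvd_pow_self p hN).trans hmN
    exact hp.one_lt.ne' (Nat.dvd_one.mp ((Nat.dvd_add_right h).mp h1))
  set φ : G →* AutPowerSeries k := φ₁.comp (QuotientGroup.mk' V) with hφ
  have hφg : ∀ g : G, φ g = φ₁ g := fun _ => rfl
  have hφθ : tameChar φ = θ := by
    ext g
    have := DFunLike.congr_fun hφ₁θ (g : G ⧸ V)
    exact congrArg Units.val this
  set a := (x - (w ^ (p ^ f) - w)) + a₀ with ha
  set β : G → 𝕂 k := fun g => β₀ g - (HahnSeries.C (χ g : k) * laurentAut (φ g) w - w) with hβ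
  have haOrd : OrdEq (-m : ℤ) a := hxw.add_ordGE hA (by omega)
  have hxinv : ∀ g, HahnSeries.C (χ g : k) * laurentAut (φ g) x = x := by
    intro g
    have := hx g
    rw [hφ₁θ] at this
    rw [hχv]
    exact this
  have hβmul : ∀ g h, β (g * h) = β g + HahnSeries.C (χ g : k) * laurentAut (φ g) (β h) := by
    intro g h
    simp only [hβ, hβ₀ g h, map_mul, Units.val_mul, laurentAut_mul, map_sub, laurentAut_C, hφg,
      QuotientGroup.mk_mul]
    ring
  have haβ : ∀ g, HahnSeries.C (χ g : k) * laurentAut (φ g) a - a = β g ^ (p ^ f) - β g := by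
    intro g
    simp only [hβ, sub_pow_sub_sub, mul_pow, hχC, ← ha₀, ha, map_add, map_sub, map_pow]
    rw [← hφg]
    linear_combination hxinv g
  obtain ⟨ι, hι, ψ, hιX, hψθ, hψι, hψy, hred⟩ := exists_artinSchreier_action p hf hmp φ χ hχq
    (by rw [hφθ]; exact hθ) haOrd β hβmul haβ
  have hψθ' : tameChar ψ = θ := hψθ.trans hφθ
  have hβV : ∀ v ∈ V, β v = HahnSeries.C (j v) := by
    intro v hv
    have h1 : (v : G ⧸ V) = 1 := (QuotientGroup.eq_one_iff v).mpr hv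
    have h2 : θ v = 1 := hVker hv
    simp only [hβ, hβ₀V v hv, hφg, h1, map_one, laurentAut_one, hχv, h2, Units.val_one, one_pow,
      one_mul, sub_self, sub_zero]
  have hyβ : ∀ g, θ g = 1 →
      laurentAut (ψ g) (lX k ^ (-m : ℤ)) - lX k ^ (-m : ℤ) = laurentMap ι hι (β g) := by
    intro g hg
    rw [hψy, hχv, hg]
    simp
  have hinj : Function.Injective ψ := by
    rw [injective_iff_map_eq_one]
    intro g hg
    have h1 : φ g = 1 := by
      ext u : 1
      apply hι
      rw [← hψι, hg]; rfl
    have h2 : g ∈ V := by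
      rw [← QuotientGroup.eq_one_iff]
      exact hφ₁.injective (by rw [← hφg, h1, map_one])
    have h3 := hyβ g (hVker h2)
    rw [hg, laurentAut_one, sub_self, hβV g h2, laurentMap_C, eq_comm, _root_.map_eq_zero] at h3
    exact hjinj g h2 h3
  -- the ramification index is determined by the order of `β`
  have hramβ : ∀ g, g ≠ 1 → θ g = 1 → ∀ n : ℤ, OrdEq n (β g) →
      (ramIndex ψ g : ℤ) = m + 1 + (p ^ f : ℕ) * n := by
    intro g hg hθg n hn
    have h2 : 2 ≤ ramIndex ψ g := two_le_ramIndex hinj hg (by rw [hψθ', hθg])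
    obtain ⟨α, hα, hαX⟩ := ordEq_ramIndex hinj hg
    have h3 := hasLead_aut_sub (by exact_mod_cast h2) hαX (hasLead_lX_zpow (k := k) (-m))
    rw [hyβ g hθg] at h3
    have h4 := OrdEq.laurentMap (hf := hι) hιX hn
    have h5 := h4.unique ⟨_, mul_ne_zero (mul_ne_zero (by
      push_cast
      rwa [neg_ne_zero, Ne, CharP.cast_eq_zero_iff k p]) one_ne_zero) hα, h3⟩
    linarith
  have hramV : ∀ g ∈ V, g ≠ 1 → ramIndex ψ g = m + 1 := by
    intro g hgV hg
    have h1 : OrdEq 0 (β g) := by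
      rw [hβV g hgV]
      exact ⟨j g, fun h => hg (hjinj g hgV h), hasLead_C _⟩
    have := hramβ g hg (hVker hgV) 0 h1
    rw [mul_zero, add_zero] at this
    exact_mod_cast this
  have hramnV : ∀ g, g ∉ V → θ g = 1 → ramIndex ψ g = ramIndex φ₁ g := by
    intro g hgV hθg
    have hg1 : (g : G ⧸ V) ≠ 1 := fun h => hgV ((QuotientGroup.eq_one_iff g).mp h)
    have hθ'g : tameChar φ₁ g = 1 := by rw [hφ₁θ]; exact hθg
    have h2 : 2 ≤ ramIndex φ₁ g := two_le_ramIndex hφ₁.injective hg1 hθ'g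
    obtain ⟨α, hα, hαX⟩ := ordEq_ramIndex hφ₁.injective hg1
    obtain ⟨c, hc, hca⟩ := haOrd
    have h3 := hasLead_aut_sub (by exact_mod_cast h2) hαX hca
    have h4 : OrdEq (-m + ramIndex φ₁ g - 1 : ℤ) (β g ^ (p ^ f) - β g) := by
      rw [← haβ, hχv, hθg, Units.val_one, one_pow, map_one, one_mul, hφg]
      exact ⟨_, mul_ne_zero (mul_ne_zero (by
        push_cast
        rwa [neg_ne_zero, Ne, CharP.cast_eq_zero_iff k p]) hc) hα, h3⟩
    have h5 : (ramIndex φ₁ g : ℤ) < m := by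
      have := hram g
      have h6 : ramIndex φ₁ g ≤ (R + 1) * ramIndex φ₁ g := Nat.le_mul_of_pos_left _ (by omega)
      exact_mod_cast lt_of_le_of_lt h6 this
    have hβ0 : β g ≠ 0 := by
      intro h0
      rw [h0, zero_pow (by omega), sub_zero] at h4
      exact h4.ne_zero rfl
    obtain ⟨n, hn⟩ := exists_ordEq hβ0
    have hn0 : n < 0 := by
      by_contra hn0
      have h6 : OrdGE 0 (β g) := hn.ordGE.mono (by omega)
      have h7 := h4.le (((h6.pow (p ^ f)).mono (by simp)).sub h6)
      omega
    have h6 := (ordEq_pow_sub_self hq2 hn0 hn).unique h4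
    have h7 := hramβ g (fun h => hgV (h ▸ one_mem V)) hθg n hn
    have h8 : (ramIndex ψ g : ℤ) = ramIndex φ₁ g := by linarith
    exact_mod_cast h8
  refine ⟨ψ, hψθ', hinj, ?_, ?_, ?_, ?_⟩
  · intro g hg hθg
    rw [hψθ'] at hθg
    by_cases hgV : g ∈ V
    · rw [hramV g hgV hg]; exact hmN
    · rw [hramnV g hgV hθg]
      exact hφ₁.dvd_ramIndex _ (fun h => hgV ((QuotientGroup.eq_one_iff g).mp h))
        (by rw [hφ₁θ]; exact hθg)
  · intro g hg hθg
    rw [hψθ'] at hθg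
    by_cases hgV : g ∈ V
    · rw [hramV g hgV hg]; omega
    · rw [hramnV g hgV hθg]
      exact hφ₁.le_ramIndex _ (fun h => hgV ((QuotientGroup.eq_one_iff g).mp h))
        (by rw [hφ₁θ]; exact hθg)
  · intro g hg hθg
    rw [hψθ'] at hθg
    have hgV : g ∉ V := fun h => hg (hVp g h)
    rw [hramnV g hgV hθg]
    by_cases hgV' : g ^ p ∈ V
    · rw [hramV _ hgV' hg]
      have := hram g
      nlinarith
    · rw [hramnV _ hgV' (by rw [map_pow, hθg, one_pow]), QuotientGroup.mk_pow]
      refine hφ₁.mul_ramIndex_le _ (fun h => hgV' ?_) (by rw [hφ₁θ]; exact hθg)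
      rw [← QuotientGroup.eq_one_iff, QuotientGroup.mk_pow, h]
  · intro e' M'
    obtain ⟨x', w', l, hMl, hlN, hxw', hx'⟩ := hφ₁.exists_pole e' (M' + m + 1)
    have hlp : ¬ p ∣ l := by
      intro h
      have h1 : p ∣ l + 1 := (dvd_pow_self p hN).trans hlN
      exact hp.one_lt.ne' (Nat.dvd_one.mp ((Nat.dvd_add_right h).mp h1))
    obtain ⟨w₁, hw₁⟩ := hred _ l hlp (by omega) hxw'
    obtain ⟨Q, hQ⟩ : ∃ Q, p ^ f = Q + 1 := ⟨p ^ f - 1, by omega⟩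
    obtain ⟨t, ht⟩ : ∃ t, l = m + t := ⟨l - m, by omega⟩
    have hQ1 : 1 ≤ Q := by omega
    refine ⟨laurentMap ι hι x', laurentMap ι hι w' + w₁, l + Q * t, by omega, ?_, ?_, ?_⟩
    · have h1 : p ^ N ∣ (l + 1) - (m + 1) := Nat.dvd_sub hlN hmN
      rw [show l + 1 - (m + 1) = t by omega] at h1
      rw [show l + Q * t + 1 = (l + 1) + Q * t by ring]
      exact dvd_add hlN (h1.mul_left _)
    · convert hw₁ using 1
      · rw [hQ, ht, Nat.add_sub_cancel]; push_cast; ring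
      · rw [add_pow_sub_add, map_sub, map_sub, map_pow]; ring
    · intro g
      have h1 := hx' g
      rw [hφ₁θ] at h1
      rw [hψθ', laurentAut_laurentMap (hψι g), ← laurentMap_C (hf := hι), ← map_mul]
      congr 1

end Existence

/-! ### Finite `G`-sets with prescribed numbers of fixed points -/

section Gset

universe u

variable {G : Type u} [Group G]

/-- The conjugate `g T g⁻¹`. -/
def conjBy (g : G) (T : Subgroup G) : Subgroup G := T.map (MulAut.conj g).toMonoidHom

theorem mem_conjBy {g x : G} {T : Subgroup G} : x ∈ conjBy g T ↔ g⁻¹ * x * g ∈ T := by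
  constructor
  · rintro ⟨y, hy, rfl⟩
    simpa [mul_assoc] using hy
  · intro h
    exact ⟨_, h, by simp [mul_assoc]⟩

theorem conjBy_mul (g h : G) (T : Subgroup G) : conjBy (g * h) T = conjBy g (conjBy h T) := by
  ext x
  simp only [mem_conjBy, mul_inv_rev, mul_assoc]

@[simp] theorem conjBy_one (T : Subgroup G) : conjBy 1 T = T := by
  ext x; simp [mem_conjBy]

@[simp] theorem conjBy_inv_conjBy (g : G) (T : Subgroup G) : conjBy g⁻¹ (conjBy g T) = T := by
  rw [← conjBy_mul, inv_mul_cancel, conjBy_one]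

@[simp] theorem conjBy_conjBy_inv (g : G) (T : Subgroup G) : conjBy g (conjBy g⁻¹ T) = T := by
  rw [← conjBy_mul, mul_inv_cancel, conjBy_one]

theorem conjBy_mono (g : G) {T U : Subgroup G} (h : T ≤ U) : conjBy g T ≤ conjBy g U :=
  Subgroup.map_mono h

theorem conjBy_le_iff (g : G) {T U : Subgroup G} : conjBy g T ≤ U ↔ T ≤ conjBy g⁻¹ U :=
  ⟨fun h => by simpa using conjBy_mono g⁻¹ h, fun h => by simpa using conjBy_mono g h⟩

theorem mem_normalizer_iff_conjBy {g : G} {T : Subgroup G} :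
    g ∈ Subgroup.normalizer (T : Set G) ↔ conjBy g T = T :=
  Subgroup.mem_normalizer_iff_map_conj_eq

theorem conjBy_zpowers (g x : G) :
    conjBy g (Subgroup.zpowers x) = Subgroup.zpowers (g * x * g⁻¹) := by
  rw [conjBy, MonoidHom.map_zpowers]; rfl

theorem conjBy_sup (g : G) (T U : Subgroup G) : conjBy g (T ⊔ U) = conjBy g T ⊔ conjBy g U :=
  Subgroup.map_sup _ _ _

theorem card_conjBy (g : G) (T : Subgroup G) : Nat.card (conjBy g T) = Nat.card T :=
  Nat.card_congr (Subgroup.equivMapOfInjective T _ (MulAut.conj g).injective).toEquiv.symm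

theorem stabilizer_smul_eq_conjBy {S : Type*} [MulAction G S] (g : G) (s : S) :
    MulAction.stabilizer G (g • s) = conjBy g (MulAction.stabilizer G s) :=
  MulAction.stabilizer_smul_eq_stabilizer_map_conj g s

theorem eq_of_le_of_conjBy [Finite G] {T U : Subgroup G} {g : G} (h : T ≤ U) (hU : U = conjBy g T) :
    T = U := by
  refine Subgroup.eq_of_le_of_card_ge h ?_
  rw [hU, card_conjBy]

/-- The number of points of `S` fixed by all elements of `T`. -/
def fixCount (T : Subgroup G) (S : Type*) [MulAction G S] : ℕ :=
  Nat.card {s : S // T ≤ MulAction.stabilizer G s}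

theorem fixCount_conjBy (g : G) (T : Subgroup G) (S : Type*) [MulAction G S] :
    fixCount (conjBy g T) S = fixCount T S := by
  refine Nat.card_congr ((MulAction.toPerm g⁻¹ : Equiv.Perm S).subtypeEquiv fun s => ?_)
  rw [MulAction.toPerm_apply, stabilizer_smul_eq_conjBy, conjBy_le_iff]

theorem fixCount_sum (T : Subgroup G) (S S' : Type*) [Finite S] [Finite S'] [MulAction G S]
    [MulAction G S'] : fixCount T (S ⊕ S') = fixCount T S + fixCount T S' := by
  rw [fixCount, Nat.card_congr (Equiv.subtypeSum (p := fun s : S ⊕ S' =>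
    T ≤ MulAction.stabilizer G s)), Nat.card_sum]
  congr 1 <;> refine Nat.card_congr (Equiv.subtypeEquivRight fun s => ?_) <;>
  · refine forall₂_congr fun g _ => ?_
    simp [MulAction.mem_stabilizer_iff]

theorem fixCount_sigma (T : Subgroup G) (n : ℕ) (S : Type*) [Finite S] [MulAction G S] :
    fixCount T (Σ _ : Fin n, S) = n * fixCount T S := by
  have e : {s : Σ _ : Fin n, S // T ≤ MulAction.stabilizer G s} ≃
      Fin n × {s : S // T ≤ MulAction.stabilizer G s} :=
    { toFun := fun s => (s.1.1, ⟨s.1.2, fun g hg => by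
        have h := s.2 hg
        rw [MulAction.mem_stabilizer_iff] at h ⊢
        exact eq_of_heq (Sigma.mk.inj_iff.mp h).2⟩)
      invFun := fun x => ⟨⟨x.1, x.2.1⟩, fun g hg => by
        have h := x.2.2 hg
        rw [MulAction.mem_stabilizer_iff] at h ⊢
        rw [Sigma.smul_mk, h]⟩
      left_inv := fun _ => rfl
      right_inv := fun _ => rfl }
  rw [fixCount, Nat.card_congr e, Nat.card_prod, Nat.card_fin]; rfl

theorem card_dvd_sum_fixedBy (H X : Type*) [Group H] [Fintype H] [Finite X] [MulAction H X] :
    Nat.card H ∣ ∑ h : H, Nat.card (MulAction.fixedBy X h) := by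
  classical
  cases nonempty_fintype X
  have := Fintype.ofFinite (Quotient (MulAction.orbitRel H X))
  have h := MulAction.sum_card_fixedBy_eq_card_orbits_mul_card_group H X
  simp_rw [Nat.card_eq_fintype_card, h]
  exact dvd_mul_left _ _

/-- The `G`-set `G ⧸ T` has `[N(T) : T]` points fixed by `T`. -/
theorem card_mul_fixCount_quotient [Finite G] (T : Subgroup G) :
    Nat.card T * fixCount T (G ⧸ T) = Nat.card (Subgroup.normalizer (T : Set G)) := by
  have h1 : fixCount T (G ⧸ T) = Nat.card (MulAction.fixedPoints T (G ⧸ T)) :=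
    Nat.card_congr (Equiv.subtypeEquivRight fun s =>
      ⟨fun h g => h g.2, fun h g hg => h ⟨g, hg⟩⟩)
  rw [h1, Nat.card_congr (Sylow.fixedPointsMulLeftCosetsEquivQuotient T), mul_comm]
  have h2 := Subgroup.card_eq_card_quotient_mul_card_subgroup
    (T.comap (Subgroup.normalizer (T : Set G)).subtype)
  rw [h2]
  congr 1
  exact (Nat.card_congr (Subgroup.subgroupOfEquivOfLe Subgroup.le_normalizer).toEquiv).symm

theorem fixCount_quotient_eq_zero {T U : Subgroup G} (h : ∀ g, ¬ U ≤ conjBy g T) :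
    fixCount U (G ⧸ T) = 0 := by
  have : IsEmpty {s : G ⧸ T // U ≤ MulAction.stabilizer G s} := by
    refine ⟨fun ⟨s, hs⟩ => ?_⟩
    induction s using QuotientGroup.induction_on with
    | H g =>
    rw [show (g : G ⧸ T) = g • ((1 : G) : G ⧸ T) by simp, stabilizer_smul_eq_conjBy,
      MulAction.stabilizer_quotient] at hs
    exact h g hs
  exact Nat.card_of_isEmpty

/-- The points of `S` fixed by `T`, with the action of a subgroup `H` that normalizes `T`. -/
def fixedSub {H T : Subgroup G} (hH : H ≤ Subgroup.normalizer (T : Set G)) (S : Type*)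
    [MulAction G S] : SubMulAction H S where
  carrier := {s | T ≤ MulAction.stabilizer G s}
  smul_mem' := by
    rintro ⟨g, hg⟩ s hs
    show T ≤ MulAction.stabilizer G (g • s)
    rw [stabilizer_smul_eq_conjBy]
    exact (mem_normalizer_iff_conjBy.mp (hH hg)).symm.le.trans (conjBy_mono g hs)

theorem card_fixedBy_fixedSub {H T : Subgroup G} (hH : H ≤ Subgroup.normalizer (T : Set G))
    (S : Type*) [MulAction G S] (g : H) :
    Nat.card (MulAction.fixedBy (fixedSub hH S) g) = fixCount (T ⊔ Subgroup.zpowers (g : G)) S := by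
  refine Nat.card_congr
    { toFun := fun s => ⟨s.1.1, sup_le s.1.2 ?_⟩
      invFun := fun s => ⟨⟨s.1, le_sup_left.trans s.2⟩, ?_⟩
      left_inv := fun _ => rfl
      right_inv := fun _ => rfl }
  · rw [Subgroup.zpowers_le]
    exact congrArg Subtype.val s.2
  · have := (le_sup_right.trans s.2) (Subgroup.mem_zpowers (g : G))
    exact Subtype.ext this

open Classical in
/-- Burnside's lemma for the action of `H` on the points fixed by a subgroup `T` that `H`
normalizes. -/
theorem card_dvd_sum_fixCount [Fintype G] {H T : Subgroup G}
    (hH : H ≤ Subgroup.normalizer (T : Set G)) (S : Type*) [Finite S] [MulAction G S] :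
    Nat.card H ∣ ∑ g : G with g ∈ H, fixCount (T ⊔ Subgroup.zpowers g) S := by
  have h := card_dvd_sum_fixedBy H (fixedSub hH S)
  simp_rw [card_fixedBy_fixedSub] at h
  rwa [← Finset.sum_subtype_eq_sum_filter, Finset.subtype_univ]

/-- If all nontrivial elements of `H` have the same number `e` of fixed points among the points
fixed by `T`, then the latter number is congruent to `e` modulo the order of `H`. -/
theorem fixCount_modEq_card [Finite G] {H T : Subgroup G}
    (hH : H ≤ Subgroup.normalizer (T : Set G)) (S : Type*) [Finite S] [MulAction G S] {e : ℕ}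
    (he : ∀ h ∈ H, h ≠ 1 → fixCount (T ⊔ Subgroup.zpowers h) S = e) :
    fixCount T S ≡ e [MOD Nat.card H] := by
  classical
  cases nonempty_fintype G
  have h := card_dvd_sum_fixCount hH S
  have h1 : (1 : G) ∈ Finset.univ.filter (fun g : G => g ∈ H) := by simp [H.one_mem]
  rw [← Finset.add_sum_erase _ _ h1, Subgroup.zpowers_one_eq_bot, sup_bot_eq,
    Finset.sum_congr rfl (g := fun _ => e) (fun g hg => by
      rw [Finset.mem_erase, Finset.mem_filter] at hg
      exact he g hg.2.2 hg.1), Finset.sum_const, smul_eq_mul, Finset.card_erase_of_mem h1,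
    show (Finset.univ.filter fun g : G => g ∈ H).card = Nat.card H by
      rw [Nat.card_eq_fintype_card, Fintype.card_subtype]] at h
  refine Nat.ModEq.add_right_cancel' ((Nat.card H - 1) * e) ?_
  have h2 : e + (Nat.card H - 1) * e = Nat.card H * e := by
    obtain ⟨n, hn⟩ : ∃ n, Nat.card H = n + 1 := Nat.exists_eq_succ_of_ne_zero Nat.card_pos.ne'
    rw [hn, Nat.add_sub_cancel]; ring
  rw [h2]
  exact ((Nat.modEq_zero_iff_dvd.mpr h)).trans (Nat.modEq_zero_iff_dvd.mpr (dvd_mul_right _ _)).symm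

/-- A sum of values of an invariant function is divisible by the order of the group as soon as the
value at each point is divisible by the order of its stabilizer. -/
theorem card_dvd_sum_of_stabilizer {D A : Type*} [Group D] [Finite D] [Fintype A] [MulAction D A]
    (f : A → ℕ) (hf : ∀ (d : D) a, f (d • a) = f a)
    (hstab : ∀ a, Nat.card (MulAction.stabilizer D a) ∣ f a) : Nat.card D ∣ ∑ a, f a := by
  classical
  have := Fintype.ofFinite (Quotient (MulAction.orbitRel D A))
  have (a : A) := Fintype.ofFinite (MulAction.orbit D a)
  rw [Fintype.sum_equiv (MulAction.selfEquivSigmaOrbits D A) f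
    (fun x => f x.2.1) (fun _ => rfl), Fintype.sum_sigma]
  refine Finset.dvd_sum fun ω _ => ?_
  have h : ∀ x : MulAction.orbit D ω.out, f x.1 = f ω.out := by
    rintro ⟨_, d, rfl⟩
    exact hf d _
  rw [Finset.sum_congr rfl fun x _ => h x, Finset.sum_const, smul_eq_mul, Finset.card_univ,
    ← Nat.card_eq_fintype_card, Nat.card_congr (MulAction.orbitEquivQuotientStabilizer D ω.out),
    Subgroup.card_eq_card_quotient_mul_card_subgroup (MulAction.stabilizer D ω.out)]
  exact Nat.mul_dvd_mul_left _ (hstab _)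

section exists_gset

variable [Fintype G] {𝒯 : Set (Subgroup G)} {F : Subgroup G → ℕ}

open Classical in
/-- In a `G`-set whose stabilizers belong to `𝒰`, the points fixed by some `T ∉ 𝒰` are fixed by
strictly larger members of `𝒰`. -/
theorem fixCount_le_of_lt {S : Type*} [Finite S] [MulAction G S] {𝒰 : Set (Subgroup G)}
    (hS : ∀ s : S, MulAction.stabilizer G s ∈ 𝒰) (h𝒰 : 𝒰 ⊆ 𝒯)
    (hF : ∀ T ∈ 𝒰, fixCount T S = F T) {T : Subgroup G} (hT : T ∉ 𝒰)
    (hsum : ∑ T' : Subgroup G with T' ∈ 𝒯 ∧ T < T', F T' ≤ F T) : fixCount T S ≤ F T := by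
  cases nonempty_fintype S
  refine le_trans ?_ hsum
  have h1 : fixCount T S ≤ ∑ T' : Subgroup G with T' ∈ 𝒰 ∧ T < T', fixCount T' S := by
    simp only [fixCount, Nat.card_eq_fintype_card, Fintype.card_subtype]
    refine le_trans (Finset.card_le_card ?_) Finset.card_biUnion_le
    intro s hs
    simp only [Finset.mem_filter, Finset.mem_univ, true_and, Finset.mem_biUnion] at hs ⊢
    exact ⟨_, ⟨hS s, lt_of_le_of_ne hs fun h => hT (h ▸ hS s)⟩, le_rfl⟩
  refine h1.trans ?_
  rw [Finset.sum_congr rfl fun T' hT' => hF T' (Finset.mem_filter.mp hT').2.1]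
  refine Finset.sum_le_sum_of_subset fun T' hT' => ?_
  rw [Finset.mem_filter] at hT' ⊢
  exact ⟨hT'.1, h𝒰 hT'.2.1, hT'.2.2⟩

open Classical in
/-- The divisibility that allows orbits of type `G ⧸ T` to be added to a `G`-set with the correct
number of points fixed by each subgroup strictly above `T`. -/
theorem card_normalizer_dvd_sub {S : Type*} [Finite S] [MulAction G S]
    {T : Subgroup G} (hT : T ∈ 𝒯)
    (hF : ∀ T' ∈ 𝒯, T < T' → fixCount T' S = F T') (h0 : ∀ T', T < T' → T' ∉ 𝒯 → fixCount T' S = 0)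
    (hle : fixCount T S ≤ F T)
    (hdvd : Nat.card (Subgroup.normalizer (T : Set G)) ∣
      ∑ g : G with g ∈ Subgroup.normalizer (T : Set G) ∧ T ⊔ Subgroup.zpowers g ∈ 𝒯,
        F (T ⊔ Subgroup.zpowers g)) :
    Nat.card (Subgroup.normalizer (T : Set G)) ∣ Nat.card T * (F T - fixCount T S) := by
  have h1 := card_dvd_sum_fixCount (T := T) le_rfl S
  rw [← Finset.filter_filter, Finset.sum_filter] at hdvd
  have h3 : ∑ g : G with g ∈ Subgroup.normalizer (T : Set G),
        (if T ⊔ Subgroup.zpowers g ∈ 𝒯 then F (T ⊔ Subgroup.zpowers g) else 0)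
      = ∑ g : G with g ∈ Subgroup.normalizer (T : Set G), fixCount (T ⊔ Subgroup.zpowers g) S
        + ∑ g : G with g ∈ Subgroup.normalizer (T : Set G),
          (if g ∈ T then F T - fixCount T S else 0) := by
    rw [← Finset.sum_add_distrib]
    refine Finset.sum_congr rfl fun g _ => ?_
    by_cases hg : g ∈ T
    · have : T ⊔ Subgroup.zpowers g = T := sup_eq_left.mpr (by rwa [Subgroup.zpowers_le])
      rw [this, if_pos hT, if_pos hg]
      omega
    · have hlt : T < T ⊔ Subgroup.zpowers g := by
        refine lt_of_le_of_ne le_sup_left fun h => hg ?_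
        rw [h]
        exact le_sup_right (a := T) (Subgroup.mem_zpowers g)
      rw [if_neg hg, add_zero]
      split_ifs with h
      · exact (hF _ h hlt).symm
      · exact (h0 _ hlt h).symm
  have h4 : ∑ g : G with g ∈ Subgroup.normalizer (T : Set G),
      (if g ∈ T then F T - fixCount T S else 0) = Nat.card T * (F T - fixCount T S) := by
    rw [← Finset.sum_filter, Finset.filter_filter, Finset.sum_const, smul_eq_mul,
      Nat.card_eq_fintype_card, Fintype.card_subtype]
    congr 2
    ext g
    simp only [Finset.mem_filter, Finset.mem_univ, true_and, and_iff_right_iff_imp]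
    exact fun hg => Subgroup.le_normalizer hg
  rw [h3, h4] at hdvd
  exact (Nat.dvd_add_right h1).mp hdvd

open Classical in
/-- A criterion for the existence of a finite `G`-set whose point stabilizers belong to a family
`𝒯` and in which each `T ∈ 𝒯` has exactly `F T` fixed points. Working down from the largest members
of `𝒯`, one adds copies of `G ⧸ T` until `T` has enough fixed points: `hsum` ensures that there are
not too many of them before, and `hdvd`, which is the congruence of Burnside's lemma for the action
of the normalizer of `T` on the points fixed by `T`, that the missing number is a multiple of
`[N(T) : T]`. -/
theorem exists_gset (hconj : ∀ g, ∀ T ∈ 𝒯, conjBy g T ∈ 𝒯)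
    (hconv : ∀ T ∈ 𝒯, ∀ T' ∈ 𝒯, ∀ U, T ≤ U → U ≤ T' → U ∈ 𝒯)
    (hFconj : ∀ g, ∀ T ∈ 𝒯, F (conjBy g T) = F T)
    (hsum : ∀ T ∈ 𝒯, ∑ T' : Subgroup G with T' ∈ 𝒯 ∧ T < T', F T' ≤ F T)
    (hdvd : ∀ T ∈ 𝒯, Nat.card (Subgroup.normalizer (T : Set G)) ∣
      ∑ g : G with g ∈ Subgroup.normalizer (T : Set G) ∧ T ⊔ Subgroup.zpowers g ∈ 𝒯,
        F (T ⊔ Subgroup.zpowers g)) :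
    ∃ (S : Type u) (_ : Finite S) (_ : MulAction G S),
      (∀ s : S, MulAction.stabilizer G s ∈ 𝒯) ∧ ∀ T ∈ 𝒯, fixCount T S = F T := by
  suffices H : ∀ (n : ℕ) (𝒰 : Set (Subgroup G)), 𝒰.ncard = n → 𝒰 ⊆ 𝒯 →
      (∀ g, ∀ T ∈ 𝒰, conjBy g T ∈ 𝒰) → (∀ T ∈ 𝒰, ∀ T' ∈ 𝒯, T ≤ T' → T' ∈ 𝒰) →
      ∃ (S : Type u) (_ : Finite S) (_ : MulAction G S),
        (∀ s : S, MulAction.stabilizer G s ∈ 𝒰) ∧ ∀ T ∈ 𝒰, fixCount T S = F T from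
    H _ 𝒯 rfl subset_rfl hconj fun _ _ _ h _ => h
  intro n
  induction n using Nat.strong_induction_on with
  | _ n ih =>
  intro 𝒰 hn h𝒰 h𝒰conj h𝒰up
  by_cases hne : 𝒰 = ∅
  · refine ⟨PEmpty, inferInstance,
      { smul := fun _ s => s, one_smul := fun s => s.elim, mul_smul := fun _ _ s => s.elim },
      fun s => s.elim, ?_⟩
    simp [hne]
  -- remove the conjugacy class of a minimal element
  obtain ⟨T, hT, hTmin⟩ := WellFounded.has_min (wellFounded_lt (α := Subgroup G)) 𝒰
    (Set.nonempty_iff_ne_empty.mpr hne)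
  set 𝒰' : Set (Subgroup G) := {U ∈ 𝒰 | ∀ g, U ≠ conjBy g T} with h𝒰'
  have hmin : ∀ U ∈ 𝒰, ∀ g, U ≤ conjBy g T → U = conjBy g T := by
    intro U hU g hUg
    by_contra h
    refine hTmin (conjBy g⁻¹ U) (h𝒰conj _ _ hU) (lt_of_le_of_ne ?_ fun h' => h ?_)
    · simpa using conjBy_mono g⁻¹ hUg
    · rw [← h', conjBy_conjBy_inv]
  have hup' : ∀ U ∈ 𝒰', ∀ U' ∈ 𝒯, U ≤ U' → U' ∈ 𝒰' := by
    rintro U ⟨hU, hUg⟩ U' hU' hle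
    refine ⟨h𝒰up U hU U' hU' hle, fun g hg => hUg g (hmin U hU g (hg ▸ hle))⟩
  have hcard : 𝒰'.ncard < n := by
    rw [← hn]
    refine Set.ncard_lt_ncard ⟨fun U hU => hU.1, fun h => ?_⟩ (Set.toFinite _)
    exact (h hT).2 1 (by simp)
  obtain ⟨S, hSfin, hSact, hSstab, hSF⟩ := ih _ hcard 𝒰' rfl (fun U hU => h𝒰 hU.1) (by
    rintro g U ⟨hU, hUg⟩
    refine ⟨h𝒰conj g U hU, fun h hh => hUg (g⁻¹ * h) ?_⟩
    rw [conjBy_mul, ← hh, conjBy_inv_conjBy]) hup'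
  have hT' : T ∉ 𝒰' := fun h => h.2 1 (by simp)
  have hlt' : ∀ T₁ ∈ 𝒯, T < T₁ → T₁ ∈ 𝒰' := by
    intro T₁ hT₁ hlt
    exact ⟨h𝒰up T hT T₁ hT₁ hlt.le, fun g hg => hlt.ne (eq_of_le_of_conjBy hlt.le hg)⟩
  have hle : fixCount T S ≤ F T :=
    fixCount_le_of_lt (𝒯 := 𝒯) hSstab (fun U hU => h𝒰 hU.1) hSF hT' (hsum T (h𝒰 hT))
  have hd := card_normalizer_dvd_sub (h𝒰 hT) (fun T₁ hT₁ hlt => hSF T₁ (hlt' T₁ hT₁ hlt))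
    (fun T₁ hlt hT₁ => by
      have : IsEmpty {s : S // T₁ ≤ MulAction.stabilizer G s} := ⟨fun s =>
        hT₁ (hconv T (h𝒰 hT) _ (h𝒰 (hSstab s.1).1) T₁ hlt.le s.2)⟩
      exact Nat.card_of_isEmpty) hle (hdvd T (h𝒰 hT))
  rw [← card_mul_fixCount_quotient T, Nat.mul_dvd_mul_iff_left Nat.card_pos] at hd
  obtain ⟨r, hr⟩ := hd
  refine ⟨S ⊕ (Σ _ : Fin r, G ⧸ T), inferInstance, inferInstance, ?_, ?_⟩
  · rintro (s | ⟨i, s⟩)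
    · have : MulAction.stabilizer G (Sum.inl s : S ⊕ (Σ _ : Fin r, G ⧸ T))
          = MulAction.stabilizer G s := by
        ext g; simp [MulAction.mem_stabilizer_iff]
      rw [this]
      exact (hSstab s).1
    · have : MulAction.stabilizer G (Sum.inr ⟨i, s⟩ : S ⊕ (Σ _ : Fin r, G ⧸ T))
          = MulAction.stabilizer G s := by
        ext g; simp [MulAction.mem_stabilizer_iff]
      rw [this]
      induction s using QuotientGroup.induction_on with
      | H g =>
      rw [show (g : G ⧸ T) = g • ((1 : G) : G ⧸ T) by simp, stabilizer_smul_eq_conjBy,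
        MulAction.stabilizer_quotient]
      exact h𝒰conj g T hT
  · have hTcount : fixCount T (S ⊕ (Σ _ : Fin r, G ⧸ T)) = F T := by
      rw [fixCount_sum, fixCount_sigma, mul_comm, ← hr]
      omega
    intro U hU
    by_cases hUT : ∃ g, U = conjBy g T
    · obtain ⟨g, rfl⟩ := hUT
      rw [fixCount_conjBy, hFconj g T (h𝒰 hT), hTcount]
    · push Not at hUT
      rw [fixCount_sum, fixCount_sigma, hSF U ⟨hU, hUT⟩,
        fixCount_quotient_eq_zero fun g hg => hUT g (hmin U hU g hg), mul_zero, add_zero]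

end exists_gset

end Gset

/-! ### Semidirect products of a `p`-group by a cyclic group of order prime to `p` -/

section semidirect

universe u

variable {p : ℕ} {G : Type u} [Group G] {P C : Subgroup G}

theorem exists_mul_eq_of_isComplement' (hPC : P.IsComplement' C) (g : G) :
    ∃ u ∈ P, ∃ c ∈ C, u * c = g := by
  obtain ⟨⟨u, c⟩, h⟩ := hPC.2 g
  exact ⟨u, u.2, c, c.2, h⟩

theorem eq_one_of_mem_of_mem (hPC : P.IsComplement' C) {g : G} (h : g ∈ P) (h' : g ∈ C) : g = 1 :=
  Subgroup.disjoint_def.mp hPC.disjoint h h'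

theorem eq_one_of_mem_of_coprime (hP : IsPGroup p P) {g : G} (h : g ∈ P)
    (h' : (orderOf g).Coprime p) : g = 1 := by
  obtain ⟨n, hn⟩ := hP ⟨g, h⟩
  have h1 : orderOf g ∣ p ^ n := orderOf_dvd_of_pow_eq_one (congrArg Subtype.val hn)
  rw [← orderOf_eq_one_iff]
  exact Nat.eq_one_of_dvd_coprimes (h'.pow_right n) dvd_rfl h1

theorem pow_card_mem [P.Normal] (hPC : P.IsComplement' C) (g : G) : g ^ Nat.card C ∈ P := by
  rw [← QuotientGroup.eq_one_iff, QuotientGroup.mk_pow,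
    ← Nat.card_congr (hPC.symm.QuotientMulEquiv).toEquiv]
  exact pow_card_eq_one'

theorem mem_of_pow_mem_of_coprime [P.Normal] (hPC : P.IsComplement' C) {g : G} {n : ℕ}
    (hn : (Nat.card C).Coprime n) (h : g ^ n ∈ P) : g ∈ P := by
  have h1 := pow_card_mem hPC g
  rw [← QuotientGroup.eq_one_iff, QuotientGroup.mk_pow] at h h1
  rw [← QuotientGroup.eq_one_iff, ← orderOf_eq_one_iff]
  exact Nat.eq_one_of_dvd_coprimes hn (orderOf_dvd_of_pow_eq_one h1) (orderOf_dvd_of_pow_eq_one h)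

theorem coprime_card [Fact p.Prime] [Finite G] (hP : IsPGroup p P) {n : ℕ}
    (hcop : n.Coprime p) : n.Coprime (Nat.card P) := by
  obtain ⟨r, hr⟩ := IsPGroup.iff_card.mp hP
  rw [hr]
  exact hcop.pow_right r

/-- The `p'`-part of an element outside `P`, up to a unit exponent. -/
theorem pow_card_notMem [Fact p.Prime] [Finite G] [P.Normal] (hP : IsPGroup p P)
    (hcop : (Nat.card C).Coprime p) (hPC : P.IsComplement' C) {g : G} (hg : g ∉ P) : g ^ Nat.card P ∉ P :=
  fun h => hg (mem_of_pow_mem_of_coprime hPC (coprime_card hP hcop) h)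

theorem orderOf_pow_card_dvd (hPC : P.IsComplement' C) (g : G) :
    orderOf (g ^ Nat.card P) ∣ Nat.card C := by
  refine orderOf_dvd_of_pow_eq_one ?_
  rw [← pow_mul, hPC.card_mul_card]
  exact pow_card_eq_one'

theorem commute_of_mem_cyclic (hC : IsCyclic C) {c d : G} (hc : c ∈ C) (hd : d ∈ C) :
    c * d = d * c := by
  obtain ⟨g, hg⟩ := hC.exists_generator
  obtain ⟨m, hm⟩ := Subgroup.mem_zpowers_iff.mp (hg ⟨c, hc⟩)
  obtain ⟨n, hn⟩ := Subgroup.mem_zpowers_iff.mp (hg ⟨d, hd⟩)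
  have h : (⟨c, hc⟩ : C) * ⟨d, hd⟩ = ⟨d, hd⟩ * ⟨c, hc⟩ := by
    rw [← hm, ← hn, ← zpow_add, ← zpow_add, add_comm]
  exact congrArg Subtype.val h

variable (P C) in
/-- All nontrivial elements of `C` have the same, cyclic, centralizer in `P`. -/
def HasUniformCyclicCentralizers : Prop :=
  ∀ c ∈ C, c ≠ 1 →
    P ⊓ Subgroup.centralizer {c} = P ⊓ Subgroup.centralizer (C : Set G) ∧
    IsCyclic (P ⊓ Subgroup.centralizer {c} : Subgroup G)

/-- Since `G = P C` with `C` abelian, `centralizer {c}` is generated by `C` and its intersection with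
`P`. -/
theorem centralizer_eq (hC : IsCyclic C) (hPC : P.IsComplement' C)
    (ha : HasUniformCyclicCentralizers P C) {c : G} (hc : c ∈ C) (hc1 : c ≠ 1) :
    Subgroup.centralizer {c} = Subgroup.centralizer (C : Set G) := by
  refine le_antisymm (fun v hv => ?_) (Subgroup.centralizer_le (by simpa using hc))
  have hCC : C ≤ Subgroup.centralizer (C : Set G) := fun d hd =>
    Subgroup.mem_centralizer_iff.mpr fun e he => commute_of_mem_cyclic hC he hd
  obtain ⟨⟨⟨u, hu⟩, ⟨d, hd⟩⟩, rfl⟩ := hPC.2 v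
  refine Subgroup.mul_mem _ ?_ (hCC hd)
  have hdc : d ∈ Subgroup.centralizer {c} :=
    Subgroup.centralizer_le (by simpa using hc) (hCC hd)
  have huc : u ∈ P ⊓ Subgroup.centralizer {c} := ⟨hu, by
    simpa using Subgroup.mul_mem _ hv (Subgroup.inv_mem _ hdc)⟩
  rw [(ha c hc hc1).1] at huc
  exact huc.2

/-- Elements of order prime to `p` are conjugate into `C`. -/
theorem exists_conj_mem [Fact p.Prime] [Finite G] [P.Normal]
    (hP : IsPGroup p P) (hC : IsCyclic C) (hcop : (Nat.card C).Coprime p)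
    (hPC : P.IsComplement' C) (ha : HasUniformCyclicCentralizers P C) {x : G}
    (hx : (orderOf x).Coprime p) : ∃ y, y * x * y⁻¹ ∈ C := by
  by_cases hx1 : x = 1
  · exact ⟨1, by simp [hx1, C.one_mem]⟩
  have hxP : x ∉ P := fun h => hx1 (eq_one_of_mem_of_coprime hP h hx)
  -- an element of prime order in `⟨x⟩` fixes a point of `G ⧸ C`
  set l := (orderOf x).minFac with hl
  have hlp : l.Prime := Nat.minFac_prime (by rwa [Ne, orderOf_eq_one_iff])
  have : Fact l.Prime := ⟨hlp⟩
  obtain ⟨n, hn⟩ : l ∣ orderOf x := Nat.minFac_dvd _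
  have hxn : orderOf (x ^ n) = l := by
    have hn0 : n ≠ 0 := fun h => (orderOf_pos x).ne' (by rw [hn, h, mul_zero])
    rw [orderOf_pow_of_dvd hn0 ⟨l, by rw [hn, mul_comm]⟩, hn,
      Nat.mul_div_cancel _ (Nat.pos_of_ne_zero hn0)]
  have hlG : IsPGroup l (Subgroup.zpowers (x ^ n)) :=
    IsPGroup.iff_card.mpr ⟨1, by rw [Nat.card_zpowers, hxn, pow_one]⟩
  have hcard : Nat.card (G ⧸ C) = Nat.card P := by
    have h1 := Subgroup.card_eq_card_quotient_mul_card_subgroup C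
    rw [← hPC.card_mul_card] at h1
    exact (Nat.eq_of_mul_eq_mul_right Nat.card_pos h1).symm
  have hlcop : l.Coprime (Nat.card P) :=
    coprime_card hP (Nat.Coprime.coprime_dvd_left (Nat.minFac_dvd _) hx)
  obtain ⟨s, hs⟩ := hlG.nonempty_fixed_point_of_prime_not_dvd_card (G ⧸ C)
    (by rw [hcard]; exact (Nat.Prime.coprime_iff_not_dvd hlp).mp hlcop)
  obtain ⟨y, rfl⟩ := QuotientGroup.mk_surjective s
  have hy := hs ⟨x ^ n, Subgroup.mem_zpowers _⟩
  have hc : y⁻¹ * x ^ n * y ∈ C := by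
    have h2 : ((x ^ n * y : G) : G ⧸ C) = (y : G ⧸ C) := hy
    rw [eq_comm, QuotientGroup.eq] at h2
    simpa [mul_assoc] using h2
  set c := y⁻¹ * x ^ n * y with hcdef
  have hc1 : c ≠ 1 := by
    intro h
    have h3 : x ^ n = 1 := by
      have : x ^ n = y * c * y⁻¹ := by rw [hcdef]; group
      rw [this, h]; simp
    rw [h3, orderOf_one] at hxn
    exact hlp.one_lt.ne hxn
  -- `y⁻¹ x y` centralizes `c`, hence all of `C`
  have hcent : y⁻¹ * x * y ∈ Subgroup.centralizer (C : Set G) := by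
    rw [← centralizer_eq hC hPC ha hc hc1, Subgroup.mem_centralizer_singleton_iff, hcdef]
    have : x * x ^ n = x ^ n * x := by rw [← pow_succ, ← pow_succ']
    calc y⁻¹ * x * y * (y⁻¹ * x ^ n * y) = y⁻¹ * (x * x ^ n) * y := by group
      _ = y⁻¹ * x ^ n * y * (y⁻¹ * x * y) := by rw [this]; group
  obtain ⟨u, hu, d, hd, hud⟩ := exists_mul_eq_of_isComplement' hPC (y⁻¹ * x * y)
  refine ⟨y⁻¹, ?_⟩
  rw [inv_inv, ← hud]
  -- its component in `P` has order prime to `p`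
  have hcom : Commute u d := by
    have h4 : d * (u * d) = (u * d) * d := by
      rw [hud]; exact Subgroup.mem_centralizer_iff.mp hcent d hd
    have h5 : (d * u) * d = (u * d) * d := by rw [← h4, mul_assoc]
    exact (mul_right_cancel h5).symm
  have hu1 : u = 1 := by
    refine eq_one_of_mem_of_coprime hP hu ?_
    have h6 : u ^ (orderOf x * Nat.card C) = 1 := by
      have h7 : (u * d) ^ (orderOf x * Nat.card C) = 1 := by
        rw [hud, pow_mul, show (y⁻¹ * x * y) = y⁻¹ * x * y⁻¹⁻¹ by simp, conj_pow,
          pow_orderOf_eq_one]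
        simp
      have h8 : d ^ (orderOf x * Nat.card C) = 1 := by
        rw [mul_comm, pow_mul, show d ^ Nat.card C = 1 from
          congrArg Subtype.val (pow_card_eq_one' (x := (⟨d, hd⟩ : C))), one_pow]
      rwa [hcom.mul_pow, h8, mul_one] at h7
    exact Nat.Coprime.coprime_dvd_left (orderOf_dvd_of_pow_eq_one h6) (hx.mul_left hcop)
  rwa [hu1, one_mul]

theorem exists_pow_mul_pow_eq {z c : G} (hzc : Commute z c) (h : (orderOf z).Coprime (orderOf c)) :
    z ∈ Subgroup.zpowers (z * c) := by
  obtain ⟨m, hm⟩ := exists_pow_eq_self_of_coprime h.symm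
  refine Subgroup.mem_zpowers_iff.mpr ⟨(orderOf c * m : ℕ), ?_⟩
  rw [zpow_natCast, pow_mul, hzc.mul_pow, pow_orderOf_eq_one, mul_one, hm]

/-- The centralizer of `C` is the product of its cyclic intersection with `P` and of `C`, which have
coprime orders. -/
theorem isCyclic_centralizer [Fact p.Prime] [Finite G] (hP : IsPGroup p P) (hC : IsCyclic C)
    (hcop : (Nat.card C).Coprime p) (hPC : P.IsComplement' C)
    (hcyc : IsCyclic (P ⊓ Subgroup.centralizer (C : Set G) : Subgroup G)) :
    IsCyclic (Subgroup.centralizer (C : Set G)) := by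
  obtain ⟨⟨z, hz⟩, hzgen⟩ := hcyc.exists_generator
  obtain ⟨⟨c, hc⟩, hcgen⟩ := hC.exists_generator
  have hCC : C ≤ Subgroup.centralizer (C : Set G) := fun d hd =>
    Subgroup.mem_centralizer_iff.mpr fun e he => commute_of_mem_cyclic hC he hd
  have hcom : Commute z c := (Subgroup.mem_centralizer_iff.mp hz.2 c hc).symm
  have hord : (orderOf z).Coprime (orderOf c) := by
    refine Nat.Coprime.coprime_dvd_left (Subgroup.orderOf_dvd_natCard P hz.1) ?_
    refine Nat.Coprime.coprime_dvd_right (Subgroup.orderOf_dvd_natCard C hc) ?_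
    exact (coprime_card hP hcop).symm
  have h1 := exists_pow_mul_pow_eq hcom hord
  have h2 : c ∈ Subgroup.zpowers (z * c) := by
    rw [hcom.eq]
    exact exists_pow_mul_pow_eq hcom.symm hord.symm
  refine ⟨⟨⟨z * c, Subgroup.mul_mem _ hz.2 (hCC hc)⟩, ?_⟩⟩
  rintro ⟨v, hv⟩
  obtain ⟨u, hu, d, hd, rfl⟩ := exists_mul_eq_of_isComplement' hPC v
  have hucent : u ∈ Subgroup.centralizer (C : Set G) := by
    simpa using Subgroup.mul_mem _ hv (Subgroup.inv_mem _ (hCC hd))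
  have hu' : u ∈ Subgroup.zpowers z := by
    obtain ⟨n, hn⟩ := Subgroup.mem_zpowers_iff.mp (hzgen ⟨u, hu, hucent⟩)
    exact Subgroup.mem_zpowers_iff.mpr ⟨n, congrArg Subtype.val hn⟩
  have hd' : d ∈ Subgroup.zpowers c := by
    obtain ⟨n, hn⟩ := Subgroup.mem_zpowers_iff.mp (hcgen ⟨d, hd⟩)
    exact Subgroup.mem_zpowers_iff.mpr ⟨n, congrArg Subtype.val hn⟩
  have h3 : u * d ∈ Subgroup.zpowers (z * c) := Subgroup.mul_mem _
    (Subgroup.zpowers_le.mpr h1 hu') (Subgroup.zpowers_le.mpr h2 hd')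
  obtain ⟨n, hn⟩ := Subgroup.mem_zpowers_iff.mp h3
  exact Subgroup.mem_zpowers_iff.mpr ⟨n, Subtype.ext hn⟩

/-- Every element outside `P` lies in exactly one conjugate of the centralizer of `C`: it lies in a
conjugate of this centralizer precisely when its `p'`-part lies in the same conjugate of `C`. -/
theorem existsUnique_fixed_quotient [Fact p.Prime] [Finite G] [P.Normal]
    (hP : IsPGroup p P) (hC : IsCyclic C)
    (hcop : (Nat.card C).Coprime p) (hPC : P.IsComplement' C)
    (ha : HasUniformCyclicCentralizers P C) {g : G} (hg : g ∉ P) :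
    ∃! s : G ⧸ Subgroup.centralizer (C : Set G), g • s = s := by
  set M := Subgroup.centralizer (C : Set G) with hM
  have hfix : ∀ v : G, g • (v : G ⧸ M) = v ↔ v⁻¹ * g * v ∈ M := by
    intro v
    rw [eq_comm, show g • (v : G ⧸ M) = ((g * v : G) : G ⧸ M) from rfl, QuotientGroup.eq, mul_assoc]
  set x := g ^ Nat.card P with hx
  have hxP : x ∉ P := pow_card_notMem hP hcop hPC hg
  have hxcop : (orderOf x).Coprime p :=
    Nat.Coprime.coprime_dvd_left (orderOf_pow_card_dvd hPC g) hcop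
  -- a conjugate of `g` lies in `M` exactly when the conjugate of `x` lies in `C`
  have key : ∀ v : G, v⁻¹ * x * v ∈ C → v⁻¹ * g * v ∈ M := by
    intro v hv
    have h1 : v⁻¹ * x * v ≠ 1 := by
      intro h
      refine hxP ?_
      rw [show x = v * (v⁻¹ * x * v) * v⁻¹ by group, h]
      simp [P.one_mem]
    rw [hM, ← centralizer_eq hC hPC ha hv h1, Subgroup.mem_centralizer_singleton_iff]
    have : g * x = x * g := by rw [hx, ← pow_succ, ← pow_succ']
    calc v⁻¹ * g * v * (v⁻¹ * x * v) = v⁻¹ * (g * x) * v := by group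
      _ = v⁻¹ * x * v * (v⁻¹ * g * v) := by rw [this]; group
  have key' : ∀ v : G, v⁻¹ * g * v ∈ M → v⁻¹ * x * v ∈ C := by
    intro v hv
    obtain ⟨u, hu, d, hd, hud⟩ := exists_mul_eq_of_isComplement' hPC (v⁻¹ * g * v)
    have hcom : Commute u d := by
      have h4 : d * (u * d) = (u * d) * d := by
        rw [hud]; exact Subgroup.mem_centralizer_iff.mp hv d hd
      have h5 : (d * u) * d = (u * d) * d := by rw [← h4, mul_assoc]
      exact (mul_right_cancel h5).symm
    have h6 : v⁻¹ * x * v = (v⁻¹ * g * v) ^ Nat.card P := by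
      rw [hx, show v⁻¹ * g * v = v⁻¹ * g * v⁻¹⁻¹ by simp, conj_pow, inv_inv]
    rw [h6, ← hud, hcom.mul_pow, show u ^ Nat.card P = 1 from
      congrArg Subtype.val (pow_card_eq_one' (x := (⟨u, hu⟩ : P))), one_mul]
    exact C.pow_mem hd _
  obtain ⟨y, hy⟩ := exists_conj_mem hP hC hcop hPC ha hxcop
  refine ⟨((y⁻¹ : G) : G ⧸ M), (hfix _).mpr (key _ (by simpa using hy)), ?_⟩
  intro s hs
  induction s using QuotientGroup.induction_on with
  | H w =>
  have hw := key' w ((hfix w).mp hs)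
  rw [eq_comm, QuotientGroup.eq, inv_inv]
  -- `y * w` conjugates an element of `C` to an element of `C`, congruent modulo `P`
  set c₁ := y * x * y⁻¹ with hc₁
  set c₂ := w⁻¹ * x * w with hc₂
  have h12 : c₂ = (y * w)⁻¹ * c₁ * (y * w) := by rw [hc₁, hc₂]; group
  have hc₁1 : c₁ ≠ 1 := by
    intro h
    refine hxP ?_
    rw [show x = y⁻¹ * c₁ * y by rw [hc₁]; group, h]
    simp [P.one_mem]
  have heq : c₂ = c₁ := by
    rw [← inv_mul_eq_one]
    refine eq_one_of_mem_of_mem hPC ?_ (C.mul_mem (C.inv_mem hw) hy)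
    obtain ⟨u, hu, d, hd, hud⟩ := exists_mul_eq_of_isComplement' hPC (y * w)
    rw [← QuotientGroup.eq_one_iff]
    have h7 : ((y * w : G) : G ⧸ P) = (d : G ⧸ P) := by
      rw [← hud, QuotientGroup.mk_mul, (QuotientGroup.eq_one_iff u).mpr hu, one_mul]
    have h8 : (c₁ : G ⧸ P) * d = d * c₁ := by
      rw [← QuotientGroup.mk_mul, ← QuotientGroup.mk_mul, commute_of_mem_cyclic hC hy hd]
    have h9 : (c₂ : G ⧸ P) = c₁ := by
      rw [h12, QuotientGroup.mk_mul, QuotientGroup.mk_mul, QuotientGroup.mk_inv, h7, mul_assoc, h8,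
        inv_mul_cancel_left]
    rw [QuotientGroup.mk_mul, QuotientGroup.mk_inv, h9, inv_mul_cancel]
  rw [hM, ← centralizer_eq hC hPC ha hy hc₁1, Subgroup.mem_centralizer_singleton_iff]
  rw [heq] at h12
  calc y * w * c₁ = y * w * ((y * w)⁻¹ * c₁ * (y * w)) := by rw [← h12]
    _ = c₁ * (y * w) := by group

/-- There is a finite `G`-set with nontrivial cyclic stabilizers in which every element outside `P`
has exactly one fixed point: the coset space of the centralizer of `C`, or the empty set if `C` is
trivial. -/
theorem exists_gset_fixCount_eq_one [Fact p.Prime] [Finite G] [P.Normal]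
    (hP : IsPGroup p P) (hC : IsCyclic C)
    (hcop : (Nat.card C).Coprime p) (hPC : P.IsComplement' C)
    (ha : HasUniformCyclicCentralizers P C) :
    ∃ (S : Type u) (_ : Finite S) (_ : MulAction G S),
      (∀ s : S, MulAction.stabilizer G s ≠ ⊥ ∧ IsCyclic (MulAction.stabilizer G s)) ∧
      ∀ g ∉ P, fixCount (Subgroup.zpowers g) S = 1 := by
  by_cases hC1 : C = ⊥
  · refine ⟨PEmpty, inferInstance,
      { smul := fun _ s => s, one_smul := fun s => s.elim, mul_smul := fun _ _ s => s.elim },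
      fun s => s.elim, fun g hg => (hg ?_).elim⟩
    have : P = ⊤ := by rw [hC1] at hPC; simpa using hPC
    simp [this]
  obtain ⟨⟨c, hc⟩, hcne⟩ := Subgroup.ne_bot_iff_exists_ne_one.mp hC1
  have hc1 : c ≠ 1 := fun h => hcne (Subtype.ext h)
  refine ⟨G ⧸ Subgroup.centralizer (C : Set G), inferInstance, inferInstance, ?_, ?_⟩
  · intro s
    induction s using QuotientGroup.induction_on with
    | H g =>
    rw [show (g : G ⧸ Subgroup.centralizer (C : Set G)) =
      g • ((1 : G) : G ⧸ Subgroup.centralizer (C : Set G)) by simp, stabilizer_smul_eq_conjBy,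
      MulAction.stabilizer_quotient]
    have hcyc := isCyclic_centralizer hP hC hcop hPC ((ha c hc hc1).1 ▸ (ha c hc hc1).2)
    refine ⟨fun h => hc1 ?_, ?_⟩
    · have h1 : g * c * g⁻¹ ∈ conjBy g (Subgroup.centralizer (C : Set G)) := by
        rw [mem_conjBy]
        have : g⁻¹ * (g * c * g⁻¹) * g = c := by group
        rw [this]
        exact Subgroup.mem_centralizer_iff.mpr fun e he => commute_of_mem_cyclic hC he hc
      rw [h, Subgroup.mem_bot] at h1
      simpa using h1
    · exact isCyclic_of_surjective _
        (Subgroup.equivMapOfInjective _ _ (MulAut.conj g).injective).surjective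
  · intro g hg
    obtain ⟨s, hs, huniq⟩ := existsUnique_fixed_quotient hP hC hcop hPC ha hg
    rw [fixCount, Nat.card_eq_one_iff_unique]
    refine ⟨⟨fun a b => Subtype.ext ?_⟩, ⟨s, ?_⟩⟩
    · rw [huniq a.1 (a.2 (Subgroup.mem_zpowers g)), huniq b.1 (b.2 (Subgroup.mem_zpowers g))]
    · rw [Subgroup.zpowers_le]
      exact hs

end semidirect

/-! ### The Bertin obstruction in terms of fixed points -/

section bertin

theorem fixCount_zpowers {G : Type*} [Group G] (g : G) (S : Type*) [MulAction G S] :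
    fixCount (Subgroup.zpowers g) S = Nat.card (MulAction.fixedBy S g) :=
  Nat.card_congr (Equiv.subtypeEquivRight fun s => by
    rw [Subgroup.zpowers_le, MulAction.mem_stabilizer_iff, MulAction.mem_fixedBy])

theorem regCharacter_of_ne_one {G : Type*} [Group G] {g : G} (hg : g ≠ 1) :
    regCharacter G g = 0 := by
  rw [regCharacter, permCharacter, Nat.cast_eq_zero]
  have : IsEmpty (MulAction.fixedBy G g) := ⟨fun s => hg (by
    simpa using (MulAction.mem_fixedBy.mp s.2 : g • s.1 = s.1))⟩
  exact Nat.card_of_isEmpty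

theorem exists_card_fixedBy_eq {k : Type*} [Field k] {G : Type*} [Group G]
    {φ : G →* AutPowerSeries k} (h : BertinObstructionVanishes φ) :
    ∃ (S : Type) (_ : Finite S) (_ : MulAction G S),
      (∀ s : S, MulAction.stabilizer G s ≠ ⊥ ∧ IsCyclic (MulAction.stabilizer G s)) ∧
      ∀ g : G, g ≠ 1 → fixCount (Subgroup.zpowers g) S = ramIndex φ g := by
  obtain ⟨S, hS, hact, hstab, m, hm⟩ := h
  refine ⟨S, hS, hact, hstab, fun g hg => ?_⟩
  have h1 := hm g
  rw [regCharacter_of_ne_one hg, artinCharacter, if_neg hg, permCharacter] at h1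
  rw [fixCount_zpowers]
  have h2 : (Nat.card (MulAction.fixedBy S g) : ℤ) = ramIndex φ g := by linarith
  exact_mod_cast h2

/-- The identity `χ_S = m • reg_G - a_φ` only has to be checked away from `1`: by Burnside's lemma
it then holds at `1` for `m` the number of orbits. -/
theorem bertinObstructionVanishes_of_gset {k : Type*} [Field k] {G : Type*} [Group G] [Finite G]
    {φ : G →* AutPowerSeries k} {S : Type*} [Finite S] [MulAction G S]
    (hstab : ∀ s : S, MulAction.stabilizer G s ≠ ⊥ ∧ IsCyclic (MulAction.stabilizer G s))
    (hfix : ∀ g : G, g ≠ 1 → fixCount (Subgroup.zpowers g) S = ramIndex φ g) :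
    BertinObstructionVanishes φ := by
  classical
  cases nonempty_fintype G
  obtain ⟨n, ⟨e⟩⟩ := Finite.exists_equiv_fin S
  let _ : MulAction G (Fin n) := e.symm.mulAction G
  have hsmul : ∀ (g : G) (i : Fin n), g • i = e (g • e.symm i) := fun g i => rfl
  have hfix' : ∀ g : G, Nat.card (MulAction.fixedBy (Fin n) g) =
      fixCount (Subgroup.zpowers g) S := by
    intro g
    rw [fixCount_zpowers]
    refine Nat.card_congr (e.symm.subtypeEquiv fun i => ?_)
    rw [MulAction.mem_fixedBy, MulAction.mem_fixedBy, hsmul, ← Equiv.eq_symm_apply]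
  have hstab' : ∀ i : Fin n, MulAction.stabilizer G i = MulAction.stabilizer G (e.symm i) := by
    intro i
    ext g
    rw [MulAction.mem_stabilizer_iff, MulAction.mem_stabilizer_iff, hsmul, ← Equiv.eq_symm_apply]
  obtain ⟨m, hm⟩ := card_dvd_sum_fixedBy G (Fin n)
  refine ⟨Fin n, inferInstance, inferInstance, fun i => by rw [hstab']; exact hstab _, m,
    fun g => ?_⟩
  by_cases hg : g = 1
  · subst hg
    have h1 : (Nat.card (MulAction.fixedBy (Fin n) (1 : G)) : ℤ)
        + ∑ h ∈ Finset.univ.erase (1 : G), (ramIndex φ h : ℤ) = Nat.card G * m := by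
      rw [← Finset.add_sum_erase _ _ (Finset.mem_univ (1 : G))] at hm
      rw [← Nat.cast_mul, ← hm, Nat.cast_add, Nat.cast_sum]
      congr 1
      refine Finset.sum_congr rfl fun h hh => ?_
      rw [hfix', hfix h (Finset.ne_of_mem_erase hh)]
    have h2 : regCharacter G 1 = Nat.card G := by
      rw [regCharacter, permCharacter, MulAction.fixedBy_one_eq_univ, Nat.card_univ]
    have h3 : ∑ᶠ (h : G) (_ : h ≠ 1), (ramIndex φ h : ℤ)
        = ∑ h ∈ Finset.univ.erase (1 : G), (ramIndex φ h : ℤ) :=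
      finsum_cond_eq_sum_of_cond_iff _ fun _ => by simp
    rw [artinCharacter, if_pos rfl, h3, h2, permCharacter]
    linarith
  · rw [regCharacter_of_ne_one hg, artinCharacter, if_neg hg, permCharacter, hfix', hfix g hg]
    ring

end bertin

/-! ### `p`-adic exponents -/

section padic

variable (p : ℕ) [Fact p.Prime]

/-- The reduction `ℤ_p → 𝔽_p ⊆ k`. -/
def residueHom (k : Type*) [Field k] [CharP k p] : ℤ_[p] →+* k :=
  (ZMod.castHom dvd_rfl k).comp PadicInt.toZMod

variable {p}

theorem ringHom_eq_natCast_appr {k : Type*} [Field k] [CharP k p] (f : ℤ_[p] →+* k) (z : ℤ_[p])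
    {n : ℕ} (hn : n ≠ 0) : f z = (z.appr n : k) := by
  obtain ⟨y, hy⟩ := Ideal.mem_span_singleton.mp (PadicInt.appr_spec n z)
  have h := congrArg f hy
  rw [map_sub, map_mul, map_pow, map_natCast, map_natCast, CharP.cast_eq_zero k p, zero_pow hn,
    zero_mul, sub_eq_zero] at h
  exact h

theorem pow_dvd_natCast_sub_iff {n a b : ℕ} :
    (p : ℤ_[p]) ^ n ∣ (a : ℤ_[p]) - b ↔ b ≡ a [MOD p ^ n] := by
  rw [Nat.modEq_iff_dvd, ← Int.cast_natCast a, ← Int.cast_natCast b, ← Int.cast_sub,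
    PadicInt.pow_p_dvd_int_iff]
  norm_cast

theorem padicPow_eq_pow {G : Type*} [Group G] {y : G} {n a : ℕ} {z : ℤ_[p]} (hy : y ^ p ^ n = 1)
    (h : (p : ℤ_[p]) ^ n ∣ a - z) : padicPow p y z = y ^ a := by
  obtain ⟨m, hm, hord⟩ := (Nat.dvd_prime_pow Fact.out).mp (orderOf_dvd_of_pow_eq_one hy)
  rw [padicPow, pow_eq_pow_iff_modEq, hord, padicValNat.prime_pow]
  rw [← pow_dvd_natCast_sub_iff]
  have h1 : (p : ℤ_[p]) ^ m ∣ z - z.appr m := Ideal.mem_span_singleton.mp (PadicInt.appr_spec m z)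
  have h2 := dvd_add ((pow_dvd_pow _ hm).trans h) h1
  rwa [sub_add_sub_cancel] at h2

/-- If `a ≡ b mod p` and `a ^ d ≡ b ^ d mod p ^ n` for some `d` prime to `p`, then
`a ≡ b mod p ^ n`. -/
theorem pow_dvd_sub_of_pow_dvd_pow_sub {k : Type*} [Field k] [CharP k p] (f : ℤ_[p] →+* k)
    {a b : ℤ_[p]} {n d : ℕ} (hd : (d : k) ≠ 0) (hfa : f a ≠ 0) (hab : f a = f b)
    (h : (p : ℤ_[p]) ^ n ∣ a ^ d - b ^ d) : (p : ℤ_[p]) ^ n ∣ a - b := by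
  rw [← (Commute.all a b).geom_sum₂_mul] at h
  refine IsUnit.dvd_mul_left ?_ |>.mp h
  by_contra hu
  have h1 : f (∑ i ∈ Finset.range d, a ^ i * b ^ (d - 1 - i)) = 0 := by
    have h2 : (∑ i ∈ Finset.range d, a ^ i * b ^ (d - 1 - i)) ∈
        IsLocalRing.maximalIdeal ℤ_[p] := hu
    rw [PadicInt.maximalIdeal_eq_span_p, Ideal.mem_span_singleton] at h2
    obtain ⟨y, hy⟩ := h2
    rw [hy, map_mul, map_natCast, CharP.cast_eq_zero k p, zero_mul]
  rw [map_sum, Finset.sum_congr rfl (g := fun _ => f a ^ (d - 1)) (fun i hi => by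
    rw [map_mul, map_pow, map_pow, ← hab, ← pow_add]
    congr 1
    have := Finset.mem_range.mp hi
    omega), Finset.sum_const, Finset.card_range, nsmul_eq_mul] at h1
  exact mul_ne_zero hd (pow_ne_zero _ hfa) h1

theorem eq_of_residueHom_eq {k : Type*} [Field k] [CharP k p] (f : ℤ_[p] →+* k)
    {a b : ℤ_[p]} {d : ℕ} (hd : (d : k) ≠ 0) (hfa : f a ≠ 0) (hab : f a = f b)
    (h : a ^ d = b ^ d) : a = b := by
  by_contra hne
  replace hne := sub_ne_zero.mpr hne
  have h1 := pow_dvd_sub_of_pow_dvd_pow_sub (n := (a - b).valuation + 1) f hd hfa hab (by simp [h])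
  rw [← Ideal.mem_span_singleton, PadicInt.mem_span_pow_iff_le_valuation _ hne] at h1
  omega

/-- Every element of `𝔽_pˣ` has a multiplicative lift to `ℤ_p`. -/
theorem exists_teichmuller (p : ℕ) [Fact p.Prime] (k : Type*) [Field k] [CharP k p] :
    ∃ ω : (ZMod p)ˣ →* ℤ_[p]ˣ, ∀ u : (ZMod p)ˣ,
      residueHom p k (ω u : ℤ_[p]) = ZMod.castHom dvd_rfl k (u : ZMod p) := by
  let f : ZMod p →* ℤ_[p] :=
    (WittVector.equiv p : WittVector p (ZMod p) →* ℤ_[p]).comp (WittVector.teichmuller p)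
  refine ⟨Units.map f, fun u => ?_⟩
  let g : ℤ_[p] →+* k := (ZMod.castHom dvd_rfl k).comp
    ((WittVector.constantCoeff : WittVector p (ZMod p) →+* ZMod p).comp
      ((WittVector.equiv p).symm : ℤ_[p] →+* WittVector p (ZMod p)))
  rw [ringHom_eq_natCast_appr _ _ one_ne_zero, ← ringHom_eq_natCast_appr g _ one_ne_zero]
  simp [g, f]

end padic

/-! ### Vanishing Bertin obstruction implies the Green–Matignon condition -/

section tame

variable {p : ℕ} [Fact p.Prime] {k : Type*} [Field k] [CharP k p] {G : Type*} [Group G] [Finite G]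
  {P C : Subgroup G} [P.Normal] {φ : G →* AutPowerSeries k}

/-- The wild inertia group is `P`. -/
theorem tameChar_eq_one_iff (hφ : Function.Injective φ) (hP : IsPGroup p P)
    (hcop : (Nat.card C).Coprime p) (hPC : P.IsComplement' C) (g : G) :
    tameChar φ g = 1 ↔ g ∈ P := by
  constructor
  · intro h
    by_contra hg
    have hx := pow_card_notMem hP hcop hPC hg
    have hx1 : g ^ Nat.card P ≠ 1 := fun h' => hx (h' ▸ P.one_mem)
    have h0 := natCast_eq_zero_of_pow_eq_one hφ hx1 (by rw [map_pow, h, one_pow])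
      (pow_orderOf_eq_one (g ^ Nat.card P))
    rw [CharP.cast_eq_zero_iff k p] at h0
    refine (Nat.Prime.coprime_iff_not_dvd Fact.out).mp
      (Nat.Coprime.coprime_dvd_left (orderOf_pow_card_dvd hPC g) hcop).symm h0
  · intro hg
    obtain ⟨n, hn⟩ := hP ⟨g, hg⟩
    have h1 : g ^ p ^ n = 1 := congrArg Subtype.val hn
    have h2 : (tameChar φ g : k) ^ (p ^ n * 1) = 1 := by
      rw [mul_one, ← Units.val_pow_eq_pow_val, ← map_pow, h1, map_one, Units.val_one]
    have : ExpChar k p := ExpChar.prime Fact.out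
    rw [ExpChar.pow_prime_pow_mul_eq_one_iff, pow_one] at h2
    exact Units.ext h2

theorem tameChar_injOn (hφ : Function.Injective φ) (hP : IsPGroup p P)
    (hcop : (Nat.card C).Coprime p) (hPC : P.IsComplement' C) {c : G} (hc : c ∈ C)
    (h : tameChar φ c = 1) : c = 1 :=
  eq_one_of_mem_of_mem hPC ((tameChar_eq_one_iff hφ hP hcop hPC c).mp h) hc

end tame

section onlyIf

variable {G : Type*} [Group G] {S : Type*} [MulAction G S]

/-- The centralizer of `c` permutes the fixed points of `c`. -/
theorem centralizer_le_stabilizer {c : G} (h1 : fixCount (Subgroup.zpowers c) S = 1) :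
    ∃ s : S, Subgroup.centralizer {c} ≤ MulAction.stabilizer G s := by
  rw [fixCount_zpowers, Nat.card_eq_one_iff_unique] at h1
  obtain ⟨hsub, ⟨s, hs⟩⟩ := h1
  refine ⟨s, fun g hg => ?_⟩
  have h2 : g • s ∈ MulAction.fixedBy S c := by
    rw [MulAction.mem_fixedBy, ← mul_smul, ← Subgroup.mem_centralizer_singleton_iff.mp hg, mul_smul,
      MulAction.mem_fixedBy.mp hs]
  exact congrArg Subtype.val (hsub.elim ⟨_, h2⟩ ⟨s, hs⟩)

/-- A cyclic group of elements which normalize `T`, none of which but `1` centralizes `T`, acts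
freely on the points fixed by `T`, if point stabilizers are cyclic. -/
theorem orderOf_dvd_fixCount [Finite G] [Finite S]
    (hstab : ∀ s : S, IsCyclic (MulAction.stabilizer G s)) {T : Subgroup G} {x : G}
    (hx : x ∈ Subgroup.normalizer (T : Set G))
    (hT : Subgroup.zpowers x ⊓ Subgroup.centralizer (T : Set G) = ⊥) :
    orderOf x ∣ fixCount T S := by
  rw [← Nat.card_zpowers, ← Nat.modEq_zero_iff_dvd]
  refine fixCount_modEq_card (Subgroup.zpowers_le.mpr hx) S fun h hh h1 => ?_
  have : IsEmpty {s : S // T ⊔ Subgroup.zpowers h ≤ MulAction.stabilizer G s} := by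
    refine ⟨fun ⟨s, hs⟩ => h1 ?_⟩
    rw [← Subgroup.mem_bot, ← hT]
    exact ⟨hh, Subgroup.mem_centralizer_iff.mpr fun t ht => commute_of_mem_cyclic (hstab s)
      (hs (le_sup_left (a := T) ht)) (hs (le_sup_right (a := T) (Subgroup.mem_zpowers h)))⟩
  exact Nat.card_of_isEmpty

end onlyIf

section onlyIf

variable {G : Type*} [Group G] {P C : Subgroup G}

theorem hasUniformCyclicCentralizers_of_gset {S : Type*} [MulAction G S]
    (hstab : ∀ s : S, IsCyclic (MulAction.stabilizer G s))
    (hfix : ∀ c ∈ C, c ≠ 1 → fixCount (Subgroup.zpowers c) S = 1) (hC : IsCyclic C) :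
    HasUniformCyclicCentralizers P C := by
  intro c hc hc1
  obtain ⟨s, hs⟩ := centralizer_le_stabilizer (hfix c hc hc1)
  constructor
  · refine le_antisymm (fun v hv => ⟨hv.1, ?_⟩)
      (inf_le_inf_left P (Subgroup.centralizer_le (by simpa using hc)))
    refine Subgroup.mem_centralizer_iff.mpr fun d hd => ?_
    refine commute_of_mem_cyclic (hstab s) (hs ?_) (hs hv.2)
    rw [Subgroup.mem_centralizer_singleton_iff]
    exact commute_of_mem_cyclic hC hd hc
  · have := hstab s
    exact isCyclic_of_injective (Subgroup.inclusion (inf_le_right.trans hs))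
      (Subgroup.inclusion_injective _)

/-- The elements of the cyclic group `C` killed by `n` form its greatest subgroup of order
dividing `n`. -/
theorem exists_isGreatest_card_dvd (hC : IsCyclic C) (n : ℕ) :
    ∃ B : Subgroup G, IsGreatest {H : Subgroup G | H ≤ C ∧ Nat.card H ∣ n} B ∧
      ∀ x ∈ B, x ^ n = 1 := by
  let B : Subgroup G :=
    { carrier := {x | x ∈ C ∧ x ^ n = 1}
      one_mem' := ⟨C.one_mem, one_pow n⟩
      mul_mem' := by
        rintro x y ⟨hx, hx'⟩ ⟨hy, hy'⟩
        refine ⟨C.mul_mem hx hy, ?_⟩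
        rw [(show Commute x y from commute_of_mem_cyclic hC hx hy).mul_pow, hx', hy', one_mul]
      inv_mem' := by
        rintro x ⟨hx, hx'⟩
        exact ⟨C.inv_mem hx, by rw [inv_pow, hx', inv_one]⟩ }
  refine ⟨B, ⟨⟨fun x hx => hx.1, ?_⟩, fun H hH x hx => ⟨hH.1 hx, ?_⟩⟩, fun x hx => hx.2⟩
  · have hB : IsCyclic B := isCyclic_of_injective
      (Subgroup.inclusion (fun x hx => hx.1 : B ≤ C)) (Subgroup.inclusion_injective _)
    obtain ⟨b, hb⟩ := hB.exists_generator
    rw [← orderOf_eq_card_of_forall_mem_zpowers hb]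
    exact orderOf_dvd_of_pow_eq_one (Subtype.ext b.2.2)
  · exact orderOf_dvd_iff_pow_eq_one.mp ((Subgroup.orderOf_dvd_natCard H hx).trans hH.2)

theorem pow_eq_of_mem_zpowers {t x y : G} {a : ℕ} (h : x * t * x⁻¹ = t ^ a)
    (hy : y ∈ Subgroup.zpowers t) : x * y * x⁻¹ = y ^ a := by
  obtain ⟨m, rfl⟩ := Subgroup.mem_zpowers_iff.mp hy
  rw [← conj_zpow, h, ← zpow_natCast, ← zpow_natCast, ← zpow_mul, ← zpow_mul, mul_comm]

theorem exists_conj_eq_pow [Finite G] {t x : G}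
    (hx : x ∈ Subgroup.normalizer (Subgroup.zpowers t : Set G)) :
    ∃ a : ℕ, x * t * x⁻¹ = t ^ a := by
  have h := (Subgroup.mem_normalizer_iff.mp hx t).mp (Subgroup.mem_zpowers t)
  obtain ⟨a, ha⟩ := (Submonoid.mem_powers_iff _ _).mp (mem_powers_iff_mem_zpowers.mpr h)
  exact ⟨a, ha.symm⟩

theorem conj_pow_eq_pow_pow {t x : G} {a : ℕ} (h : x * t * x⁻¹ = t ^ a) (n : ℕ) :
    x ^ n * t * (x ^ n)⁻¹ = t ^ a ^ n := by
  induction n with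
  | zero => simp
  | succ n ih =>
    calc x ^ (n + 1) * t * (x ^ (n + 1))⁻¹ = x * (x ^ n * t * (x ^ n)⁻¹) * x⁻¹ := by
          rw [pow_succ']; group
      _ = t ^ a ^ (n + 1) := by
          rw [ih, ← conj_pow, h, ← pow_mul, pow_succ, mul_comm]

variable {p : ℕ} [Fact p.Prime] {k : Type*} [Field k] [CharP k p] [Finite G] [P.Normal]
  {φ : G →* AutPowerSeries k}

/-- The character `Θ` of the Green–Matignon condition is the Teichmüller lift of the inverse of the
tame character on `B`. -/
theorem isGreenMatignon_of_bertinObstructionVanishes (hφ : Function.Injective φ)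
    (hP : IsPGroup p P) (hC : IsCyclic C) (hcop : (Nat.card C).Coprime p)
    (hPC : P.IsComplement' C) (h : BertinObstructionVanishes φ) : IsGreenMatignon p P C := by
  obtain ⟨S, hS, hact, hstab, hfix⟩ := exists_card_fixedBy_eq h
  have hp1 : p - 1 ≠ 0 := by have := (Fact.out : p.Prime).two_le; omega
  have hp1k : ((p - 1 : ℕ) : k) ≠ 0 := by
    rw [Ne, CharP.cast_eq_zero_iff k p]
    exact fun h => absurd (Nat.le_of_dvd (Nat.pos_of_ne_zero hp1) h) (by omega)
  have hone : ∀ c ∈ C, c ≠ 1 → fixCount (Subgroup.zpowers c) S = 1 := by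
    intro c hc hc1
    rw [hfix c hc1]
    refine ramIndex_of_tameChar_ne_one fun h' => hc1 ?_
    exact tameChar_injOn hφ hP hcop hPC hc h'
  obtain ⟨B, hB, hBpow⟩ := exists_isGreatest_card_dvd hC (p - 1)
  obtain ⟨ω, hω⟩ := exists_teichmuller p k
  -- the restriction of the tame character to `B` has values in `𝔽_p`
  let ι : (ZMod p)ˣ →* kˣ := Units.map (ZMod.castHom dvd_rfl k : ZMod p →* k)
  have hι : Function.Injective ι := Units.map_injective (ZMod.castHom dvd_rfl k).injective
  have hrange : ∀ x : B, tameChar φ (x : G) ∈ ι.range := by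
    intro x
    have h1 : (tameChar φ (x : G) : k) ^ p = tameChar φ (x : G) := by
      rw [← Nat.sub_add_cancel (Fact.out : p.Prime).one_le, pow_succ, ← Units.val_pow_eq_pow_val,
        ← map_pow, hBpow x x.2, map_one, Units.val_one, one_mul]
    rw [← Subfield.mem_bot_iff_pow_eq_self, ← ZMod.fieldRange_castHom_eq_bot p] at h1
    obtain ⟨u, hu⟩ := h1
    have hu0 : u ≠ 0 := by
      rintro rfl
      rw [map_zero] at hu
      exact Units.ne_zero _ hu.symm
    exact ⟨Units.mk0 u hu0, Units.ext hu⟩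
  let e : (ZMod p)ˣ ≃* ι.range := MonoidHom.ofInjective hι
  let ψ : B →* (ZMod p)ˣ := (e.symm : ι.range →* (ZMod p)ˣ).comp
    (((tameChar φ).comp B.subtype).codRestrict ι.range hrange)
  have hψ : ∀ x : B, ι (ψ x) = tameChar φ (x : G) := by
    intro x
    exact congrArg Subtype.val (e.apply_symm_apply ⟨tameChar φ (x : G), hrange x⟩)
  have hΘ : ∀ x : B, residueHom p k ((ω.comp (ψ⁻¹)) x : ℤ_[p]) = ((tameChar φ (x : G))⁻¹ : kˣ) := by
    intro x
    rw [← hψ, ← map_inv, MonoidHom.comp_apply, hω]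
    rfl
  refine ⟨B, hB, ω.comp (ψ⁻¹), ?_, hasUniformCyclicCentralizers_of_gset
    (fun s => (hstab s).2) hone hC, ?_⟩
  · rw [injective_iff_map_eq_one]
    intro x hx
    have h1 := hΘ x
    rw [hx, Units.val_one, map_one, eq_comm, Units.val_eq_one, inv_eq_one] at h1
    exact Subtype.ext (tameChar_injOn hφ hP hcop hPC (hB.1.1 x.2) h1)
  · intro T hTP hT hTC x hx y hy
    obtain ⟨⟨t, ht⟩, htgen⟩ := hT.exists_generator
    have hTt : T = Subgroup.zpowers t := by
      refine le_antisymm (fun v hv => ?_) (Subgroup.zpowers_le.mpr ht)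
      obtain ⟨n, hn⟩ := Subgroup.mem_zpowers_iff.mp (htgen ⟨v, hv⟩)
      exact Subgroup.mem_zpowers_iff.mpr ⟨n, congrArg Subtype.val hn⟩
    by_cases ht1 : t = 1
    · have : y = 1 := by
        rw [hTt, ht1, Subgroup.zpowers_one_eq_bot, Subgroup.mem_bot] at hy
        exact hy
      rw [this, padicPow, one_pow]
      simp
    obtain ⟨a, ha⟩ := exists_conj_eq_pow (hTt ▸ hx)
    obtain ⟨n, hord⟩ : ∃ n, orderOf t = p ^ n := by
      obtain ⟨n, hn⟩ := hP ⟨t, hTP ht⟩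
      obtain ⟨m, -, hm⟩ := (Nat.dvd_prime_pow Fact.out).mp
        (orderOf_dvd_of_pow_eq_one (show t ^ p ^ n = 1 from congrArg Subtype.val hn))
      exact ⟨m, hm⟩
    have hn : t ^ p ^ n = 1 := hord ▸ pow_orderOf_eq_one t
    have hytn : y ^ p ^ n = 1 := by
      obtain ⟨m, rfl⟩ := Subgroup.mem_zpowers_iff.mp (hTt ▸ hy)
      rw [← zpow_natCast, zpow_comm, zpow_natCast, hn, one_zpow]
    rw [pow_eq_of_mem_zpowers ha (hTt ▸ hy)]
    refine (padicPow_eq_pow hytn ?_).symm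
    have htame : tameChar φ t = 1 := (tameChar_eq_one_iff hφ hP hcop hPC t).mpr (hTP ht)
    -- `⟨x⟩` acts freely on the points fixed by `T`
    have hdvd : orderOf (x : G) ∣ ramIndex φ t := by
      rw [← hfix t ht1, ← hTt]
      refine orderOf_dvd_fixCount (fun s => (hstab s).2) hx ?_
      rw [← le_bot_iff, ← hTC]
      exact inf_le_inf_right _ (Subgroup.zpowers_le.mpr (hB.1.1 x.2))
    have hres : (a : k) = ((tameChar φ (x : G))⁻¹ : kˣ) := by
      rw [conj_exponent_eq hφ ht1 htame ha, ← Units.val_pow_eq_pow_val]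
      congr 1
      rw [_root_.eq_inv_iff_mul_eq_one, ← pow_succ, Nat.sub_add_cancel
        ((one_le_two).trans (two_le_ramIndex hφ ht1 htame)), ← map_pow,
        orderOf_dvd_iff_pow_eq_one.mp hdvd, map_one]
    -- `a` and `Θ x` agree modulo `p`, and both have `(p - 1)`-th power `1` modulo `p ^ n`
    refine pow_dvd_sub_of_pow_dvd_pow_sub (residueHom p k) hp1k ?_ ?_ (d := p - 1) ?_
    · rw [map_natCast, hres]
      exact Units.ne_zero _
    · rw [map_natCast, hres, hΘ]
    · have h1 : (ω.comp (ψ⁻¹)) x ^ (p - 1) = 1 := by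
        rw [← map_pow, show x ^ (p - 1) = 1 from Subtype.ext (hBpow x x.2), map_one]
      have h2 := conj_pow_eq_pow_pow ha (p - 1)
      rw [hBpow x x.2, one_mul, inv_one, mul_one] at h2
      have h3 := pow_dvd_natCast_sub_iff.mpr
        (hord ▸ pow_eq_pow_iff_modEq.mp ((pow_one t).trans h2))
      rw [Nat.cast_pow, Nat.cast_one] at h3
      rwa [← Units.val_pow_eq_pow_val, h1, Units.val_one]

end onlyIf

/-! ### Extending a faithful character -/

section character

theorem exists_injective_monoidHom {C k : Type*} [Group C] [Finite C] (hC : IsCyclic C) [Field k]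
    [IsAlgClosed k] (hn : (Nat.card C : k) ≠ 0) : ∃ ψ : C →* kˣ, Function.Injective ψ := by
  obtain ⟨c, hc⟩ := hC.exists_generator
  have : NeZero (Nat.card C : k) := ⟨hn⟩
  obtain ⟨ξ, hξ⟩ := HasEnoughRootsOfUnity.exists_primitiveRoot k (Nat.card C)
  have hu : IsUnit ξ := hξ.isUnit Nat.card_pos.ne'
  have hord : orderOf hu.unit = orderOf c := by
    rw [← orderOf_units, IsUnit.unit_spec, ← hξ.eq_orderOf,
      orderOf_eq_card_of_forall_mem_zpowers hc]
  refine ⟨monoidHomOfForallMemZpowers hc hord.dvd, ?_⟩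
  rw [injective_iff_map_eq_one]
  intro x hx
  obtain ⟨n, rfl⟩ := Subgroup.mem_zpowers_iff.mp (hc x)
  rw [map_zpow, monoidHomOfForallMemZpowers_apply_gen, ← orderOf_dvd_iff_zpow_eq_one, hord] at hx
  exact orderOf_dvd_iff_zpow_eq_one.mp hx

/-- A faithful character of a subgroup of a finite cyclic group extends to a faithful character. -/
theorem exists_injective_extension {C k : Type*} [Group C] [Finite C] (hC : IsCyclic C) [Field k]
    [IsAlgClosed k] (hn : (Nat.card C : k) ≠ 0) (B : Subgroup C) {χ : B →* kˣ}
    (hχ : Function.Injective χ) :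
    ∃ ψ : C →* kˣ, Function.Injective ψ ∧ ∀ x : B, ψ x = χ x := by
  obtain ⟨ψ, hψ⟩ := exists_injective_monoidHom hC hn
  obtain ⟨b, hb⟩ := (inferInstance : IsCyclic B).exists_generator
  have hm : NeZero (orderOf b) := ⟨(orderOf_pos b).ne'⟩
  have h1 : IsPrimitiveRoot (ψ b : k) (orderOf b) := by
    rw [← Subgroup.orderOf_coe, ← orderOf_injective ψ hψ, ← orderOf_units]
    exact IsPrimitiveRoot.orderOf _
  have h2 : IsPrimitiveRoot (χ b : k) (orderOf b) := by
    rw [← orderOf_injective χ hχ, ← orderOf_units]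
    exact IsPrimitiveRoot.orderOf _
  obtain ⟨i, -, hi, hi'⟩ := h1.isPrimitiveRoot_iff.mp h2
  have hdvd : orderOf b ∣ Nat.card C := by
    rw [← Subgroup.orderOf_coe]; exact orderOf_dvd_natCard _
  -- lift the exponent to one prime to the order of `C`
  obtain ⟨u, hu⟩ := ZMod.unitsMap_surjective (n := orderOf b) (m := Nat.card C)
    hdvd (ZMod.unitOfCoprime i hi)
  have : NeZero (Nat.card C) := ⟨Nat.card_pos.ne'⟩
  set r := (u : ZMod (Nat.card C)).val with hr
  have hrcop : r.Coprime (Nat.card C) := ZMod.val_coe_unit_coprime u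
  have hri : r ≡ i [MOD orderOf b] := by
    rw [← ZMod.natCast_eq_natCast_iff]
    have h3 := congrArg Units.val hu
    rw [ZMod.unitsMap_val, ZMod.coe_unitOfCoprime] at h3
    rw [← h3, hr, ZMod.natCast_val]
  have hpow : ψ b ^ r = χ b := by
    refine Units.ext ?_
    rw [← hi', ← Units.val_pow_eq_pow_val, ← map_pow, ← map_pow]
    congr 2
    rw [pow_eq_pow_iff_modEq, Subgroup.orderOf_coe]
    exact hri
  refine ⟨ψ ^ r, ?_, fun x => ?_⟩
  · rw [injective_iff_map_eq_one]
    intro x hx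
    rw [MonoidHom.pow_apply, ← map_pow, map_eq_one_iff _ hψ] at hx
    rw [← orderOf_eq_one_iff]
    exact Nat.eq_one_of_dvd_coprimes hrcop (orderOf_dvd_of_pow_eq_one hx) (orderOf_dvd_natCard x)
  · obtain ⟨n, rfl⟩ := Subgroup.mem_zpowers_iff.mp (hb x)
    rw [map_zpow, ← hpow, MonoidHom.pow_apply, Subgroup.coe_zpow, map_zpow, ← zpow_natCast,
      ← zpow_natCast, zpow_comm]

theorem exists_monoidHom_ker_eq {k : Type*} [Field k] [IsAlgClosed k] {G : Type*} [Group G]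
    [Finite G] {P C : Subgroup G} [P.Normal] (hC : IsCyclic C) (hPC : P.IsComplement' C)
    (hn : (Nat.card C : k) ≠ 0) {B : Subgroup G} (hB : B ≤ C) {χ : B →* kˣ}
    (hχ : Function.Injective χ) :
    ∃ θ : G →* kˣ, θ.ker = P ∧ ∀ x : B, θ x = χ x := by
  let e := Subgroup.subgroupOfEquivOfLe hB
  obtain ⟨ψ, hψ, hψχ⟩ := exists_injective_extension hC hn (B.subgroupOf C)
    (χ := χ.comp e.toMonoidHom) (hχ.comp e.injective)
  let q := hPC.symm.QuotientMulEquiv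
  have hq : ∀ c : C, q ((c : G) : G ⧸ P) = c := fun c => q.apply_symm_apply c
  refine ⟨(ψ.comp q.toMonoidHom).comp (QuotientGroup.mk' P), ?_, fun x => ?_⟩
  · ext g
    rw [MonoidHom.mem_ker, ← QuotientGroup.eq_one_iff, ← map_eq_one_iff q q.injective,
      ← map_eq_one_iff ψ hψ]
    rfl
  · have h1 := hψχ ⟨⟨x, hB x.2⟩, x.2⟩
    refine Eq.trans (congrArg ψ (hq ⟨x, hB x.2⟩)) (h1.trans ?_)
    rfl

end character

/-! ### Congruences between fixed points and ramification -/

section congruence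

variable {k : Type*} [Field k] {G : Type*} [Group G] {P C : Subgroup G} {φ : G →* AutPowerSeries k}

variable (P C φ) in
/-- Condition (b) for Green–Matignon groups, read through the tame character: if no nontrivial
element of `C` centralizes `t ∈ P`, then an element `x` of `C` can normalize `⟨t⟩` only by raising
`t` to a power congruent to the inverse of the tame character of `x`. -/
def ActsByInverseTameChar : Prop :=
  ∀ x ∈ C, ∀ t ∈ P, t ≠ 1 → C ⊓ Subgroup.centralizer (Subgroup.zpowers t : Set G) = ⊥ →
    ∀ a : ℕ, x * t * x⁻¹ = t ^ a → (a : k) * tameChar φ x = 1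

theorem mem_centralizer_zpowers {t z : G} :
    z ∈ Subgroup.centralizer (Subgroup.zpowers t : Set G) ↔ t * z = z * t := by
  rw [Subgroup.mem_centralizer_iff]
  refine ⟨fun h => h t (Subgroup.mem_zpowers t), fun h s hs => ?_⟩
  obtain ⟨n, rfl⟩ := Subgroup.mem_zpowers_iff.mp hs
  exact (Commute.zpow_left (show Commute t z from h) n)

/-- If one nontrivial element of `C` centralizes `t`, then all of `C` does. -/
theorem commute_of_centralizes (ha : HasUniformCyclicCentralizers P C) {t : G} (ht : t ∈ P)
    {z : G} (hz : z ∈ C) (hz1 : z ≠ 1) (h : t * z = z * t) {x : G} (hx : x ∈ C) :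
    x * t = t * x := by
  have h1 : t ∈ P ⊓ Subgroup.centralizer {z} :=
    ⟨ht, Subgroup.mem_centralizer_singleton_iff.mpr h⟩
  rw [(ha z hz hz1).1] at h1
  exact Subgroup.mem_centralizer_iff.mp h1.2 x hx

theorem fixCount_sup_eq_one {S : Type*} [MulAction G S] {t h : G}
    (h1 : fixCount (Subgroup.zpowers h) S = 1) (hcom : t * h = h * t) :
    fixCount (Subgroup.zpowers t ⊔ Subgroup.zpowers h) S = 1 := by
  obtain ⟨s, hs⟩ := centralizer_le_stabilizer h1
  rw [fixCount, Nat.card_eq_one_iff_unique] at h1 ⊢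
  refine ⟨⟨fun a b => ?_⟩, ⟨s, sup_le ?_ ?_⟩⟩
  · have := h1.1.elim ⟨a.1, le_sup_right.trans a.2⟩ ⟨b.1, le_sup_right.trans b.2⟩
    exact Subtype.ext (Subtype.mk_eq_mk.mp this)
  · rw [Subgroup.zpowers_le]
    exact hs (Subgroup.mem_centralizer_singleton_iff.mpr hcom)
  · rw [Subgroup.zpowers_le]
    exact hs (Subgroup.mem_centralizer_singleton_iff.mpr rfl)

variable {p : ℕ} [Fact p.Prime] [CharP k p] [Finite G] [P.Normal]

/-- If `⟨x⟩` acts faithfully on `⟨t⟩`, then it acts freely on the points fixed by `t`, and both sides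
are `0`; if not, then `x` commutes with `t`, and both sides are `1`. -/
theorem fixCount_modEq_ramIndex_of_mem {S : Type*} [Finite S] [MulAction G S]
    (hφ : Function.Injective φ) (hP : IsPGroup p P) (hcop : (Nat.card C).Coprime p)
    (hPC : P.IsComplement' C) (ha : HasUniformCyclicCentralizers P C)
    (hb : ActsByInverseTameChar P C φ)
    (hstab : ∀ s : S, IsCyclic (MulAction.stabilizer G s))
    (hone : ∀ g ∉ P, fixCount (Subgroup.zpowers g) S = 1) {t x : G} (ht : t ∈ P) (ht1 : t ≠ 1)
    (hx : x ∈ C) (hxt : x ∈ Subgroup.normalizer (Subgroup.zpowers t : Set G)) :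
    fixCount (Subgroup.zpowers t) S ≡ ramIndex φ t [MOD orderOf x] := by
  have htame : tameChar φ t = 1 := (tameChar_eq_one_iff hφ hP hcop hPC t).mpr ht
  have hram := two_le_ramIndex hφ ht1 htame
  have hxC : Subgroup.zpowers x ≤ C := Subgroup.zpowers_le.mpr hx
  by_cases hT : Subgroup.zpowers x ⊓ Subgroup.centralizer (Subgroup.zpowers t : Set G) = ⊥
  · refine (Nat.modEq_zero_iff_dvd.mpr (orderOf_dvd_fixCount hstab hxt hT)).trans
      (Nat.modEq_zero_iff_dvd.mpr ?_).symm
    by_cases hx1 : x = 1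
    · rw [hx1, orderOf_one]; exact one_dvd _
    have hCT : C ⊓ Subgroup.centralizer (Subgroup.zpowers t : Set G) = ⊥ := by
      rw [Subgroup.eq_bot_iff_forall]
      rintro z ⟨hz, hzt⟩
      by_contra hz1
      refine hx1 ?_
      rw [← Subgroup.mem_bot, ← hT]
      refine ⟨Subgroup.mem_zpowers x, mem_centralizer_zpowers.mpr ?_⟩
      exact (commute_of_centralizes ha ht hz hz1 (mem_centralizer_zpowers.mp hzt) hx).symm
    obtain ⟨a, hxa⟩ := exists_conj_eq_pow hxt
    have h1 := hb x hx t ht ht1 hCT a hxa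
    rw [conj_exponent_eq hφ ht1 htame hxa, ← pow_succ, Nat.sub_add_cancel (by omega),
      ← Units.val_pow_eq_pow_val, Units.val_eq_one, ← map_pow] at h1
    exact orderOf_dvd_of_pow_eq_one (tameChar_injOn hφ hP hcop hPC (C.pow_mem hx _) h1)
  · obtain ⟨⟨z, hz⟩, hzne⟩ := Subgroup.ne_bot_iff_exists_ne_one.mp hT
    have hz1 : z ≠ 1 := fun h => hzne (Subtype.ext h)
    have hcom : ∀ y ∈ C, y * t = t * y := fun y hy =>
      commute_of_centralizes ha ht (hxC hz.1) hz1 (mem_centralizer_zpowers.mp hz.2) hy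
    have h1 : fixCount (Subgroup.zpowers t) S ≡ 1 [MOD orderOf x] := by
      rw [← Nat.card_zpowers]
      refine fixCount_modEq_card (Subgroup.zpowers_le.mpr hxt) S fun h hh hh1 => ?_
      refine fixCount_sup_eq_one (hone h fun hhP => hh1 ?_) (hcom h (hxC hh)).symm
      exact eq_one_of_mem_of_mem hPC hhP (hxC hh)
    refine h1.trans ((Nat.modEq_iff_dvd' (by omega)).mpr ?_)
    have h2 := conj_exponent_eq hφ ht1 htame (x := x) (a := 1) (by
      rw [hcom x hx, mul_inv_cancel_right, pow_one])
    rw [Nat.cast_one, eq_comm, ← Units.val_pow_eq_pow_val, Units.val_eq_one, ← map_pow] at h2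
    exact orderOf_dvd_of_pow_eq_one (tameChar_injOn hφ hP hcop hPC (C.pow_mem hx _) h2)

/-- The number of points fixed by `t ∈ P` has the residue of the ramification index of `t` modulo
the order of any `p'`-element that normalizes `⟨t⟩`. -/
theorem fixCount_modEq_ramIndex {S : Type*} [Finite S] [MulAction G S]
    (hφ : Function.Injective φ) (hP : IsPGroup p P) (hC : IsCyclic C)
    (hcop : (Nat.card C).Coprime p)
    (hPC : P.IsComplement' C) (ha : HasUniformCyclicCentralizers P C)
    (hb : ActsByInverseTameChar P C φ)
    (hstab : ∀ s : S, IsCyclic (MulAction.stabilizer G s))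
    (hone : ∀ g ∉ P, fixCount (Subgroup.zpowers g) S = 1) {t x : G} (ht : t ∈ P) (ht1 : t ≠ 1)
    (hx : (orderOf x).Coprime p) (hxt : x ∈ Subgroup.normalizer (Subgroup.zpowers t : Set G)) :
    fixCount (Subgroup.zpowers t) S ≡ ramIndex φ t [MOD orderOf x] := by
  obtain ⟨y, hy⟩ := exists_conj_mem hP hC hcop hPC ha hx
  have h := fixCount_modEq_ramIndex_of_mem (S := S) (t := y * t * y⁻¹) hφ hP hcop hPC ha hb hstab
    hone (Subgroup.Normal.conj_mem inferInstance t ht y) (fun h => ht1 (by simpa using h)) hy (by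
      rw [mem_normalizer_iff_conjBy, ← conjBy_zpowers, ← conjBy_mul,
        show y * x * y⁻¹ * y = y * x by group, conjBy_mul, mem_normalizer_iff_conjBy.mp hxt])
  rwa [← conjBy_zpowers, fixCount_conjBy, ramIndex_conj hφ,
    show orderOf (y * x * y⁻¹) = orderOf x from (MulAut.conj y).orderOf_eq x] at h

end congruence

/-! ### The `G`-set of wild points -/

section wild

universe u

variable {k : Type*} [Field k] {G : Type u} [Group G] {P C : Subgroup G} {φ : G →* AutPowerSeries k}

variable (P) in
/-- The nontrivial cyclic subgroups of `P`. -/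
def nontrivialCyclic : Set (Subgroup G) := {T | ∃ g ∈ P, g ≠ 1 ∧ Subgroup.zpowers g = T}

open Classical in
variable (φ) in
/-- The ramification index of a generator of a cyclic subgroup. -/
def cyclicRam (T : Subgroup G) : ℕ :=
  if h : ∃ g, Subgroup.zpowers g = T then ramIndex φ h.choose else 0

theorem cyclicRam_zpowers [Finite G] (hφ : Function.Injective φ) (g : G) :
    cyclicRam φ (Subgroup.zpowers g) = ramIndex φ g := by
  have h : ∃ g', Subgroup.zpowers g' = Subgroup.zpowers g := ⟨g, rfl⟩
  rw [cyclicRam, dif_pos h]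
  exact ramIndex_eq_of_zpowers_eq hφ h.choose_spec

theorem conjBy_mem_nontrivialCyclic [P.Normal] (g : G) {T : Subgroup G}
    (hT : T ∈ nontrivialCyclic P) : conjBy g T ∈ nontrivialCyclic P := by
  obtain ⟨t, ht, ht1, rfl⟩ := hT
  exact ⟨g * t * g⁻¹, Subgroup.Normal.conj_mem inferInstance t ht g, by simpa using ht1,
    (conjBy_zpowers g t).symm⟩

theorem cyclicRam_conjBy [Finite G] (hφ : Function.Injective φ) (g : G) {T : Subgroup G}
    (hT : T ∈ nontrivialCyclic P) : cyclicRam φ (conjBy g T) = cyclicRam φ T := by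
  obtain ⟨t, -, -, rfl⟩ := hT
  rw [conjBy_zpowers, cyclicRam_zpowers hφ, cyclicRam_zpowers hφ, ramIndex_conj hφ]

theorem mem_nontrivialCyclic {T : Subgroup G} (hP : T ≤ P) (hne : T ≠ ⊥) (hT : IsCyclic T) :
    T ∈ nontrivialCyclic P := by
  obtain ⟨⟨t, ht⟩, htgen⟩ := hT.exists_generator
  have hTt : Subgroup.zpowers t = T := by
    refine le_antisymm (Subgroup.zpowers_le.mpr ht) (fun v hv => ?_)
    obtain ⟨n, hn⟩ := Subgroup.mem_zpowers_iff.mp (htgen ⟨v, hv⟩)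
    exact Subgroup.mem_zpowers_iff.mpr ⟨n, congrArg Subtype.val hn⟩
  refine ⟨t, hP ht, fun h => hne ?_, hTt⟩
  rw [← hTt, h, Subgroup.zpowers_one_eq_bot]

theorem isCyclic_of_le_isCyclic {T U : Subgroup G} (h : T ≤ U) [IsCyclic U] : IsCyclic T :=
  isCyclic_of_injective (Subgroup.inclusion h) (Subgroup.inclusion_injective h)

theorem ne_bot_of_mem_nontrivialCyclic {T : Subgroup G} (hT : T ∈ nontrivialCyclic P) : T ≠ ⊥ := by
  obtain ⟨t, -, ht1, rfl⟩ := hT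
  rwa [Ne, Subgroup.zpowers_eq_bot]

theorem isCyclic_of_mem_nontrivialCyclic {T : Subgroup G} (hT : T ∈ nontrivialCyclic P) :
    IsCyclic T := by
  obtain ⟨t, -, -, rfl⟩ := hT
  infer_instance

theorem le_of_mem_nontrivialCyclic {T : Subgroup G} (hT : T ∈ nontrivialCyclic P) : T ≤ P := by
  obtain ⟨t, ht, -, rfl⟩ := hT
  rwa [Subgroup.zpowers_le]

theorem mem_nontrivialCyclic_of_between {T U T' : Subgroup G} (hT : T ∈ nontrivialCyclic P)
    (hT' : T' ∈ nontrivialCyclic P) (h : T ≤ U) (h' : U ≤ T') : U ∈ nontrivialCyclic P := by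
  have := isCyclic_of_mem_nontrivialCyclic hT'
  refine mem_nontrivialCyclic (h'.trans (le_of_mem_nontrivialCyclic hT')) (fun hU => ?_)
    (isCyclic_of_le_isCyclic h')
  exact ne_bot_of_mem_nontrivialCyclic hT (le_bot_iff.mp (hU ▸ h))

/-- If `⟨h⟩ < ⟨g⟩`, then `h` is a power of `g ^ p`. -/
theorem mul_cyclicRam_le [Finite G] {p : ℕ} [Fact p.Prime] (hφ : Function.Injective φ)
    (hP : IsPGroup p P) {R : ℕ}
    (hgrow : ∀ g ∈ P, g ^ p ≠ 1 → R * ramIndex φ g ≤ ramIndex φ (g ^ p)) {T T' : Subgroup G}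
    (hT : T ∈ nontrivialCyclic P) (hT' : T' ∈ nontrivialCyclic P) (hlt : T < T') :
    R * cyclicRam φ T' ≤ cyclicRam φ T := by
  obtain ⟨h, hhP, hh1, rfl⟩ := hT
  obtain ⟨g, hgP, hg1, rfl⟩ := hT'
  rw [cyclicRam_zpowers hφ, cyclicRam_zpowers hφ]
  have hmem : h ∈ Subgroup.zpowers g := hlt.le (Subgroup.mem_zpowers h)
  obtain ⟨j, rfl⟩ := (Submonoid.mem_powers_iff _ _).mp (mem_powers_iff_mem_zpowers.mpr hmem)
  have hpj : p ∣ j := by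
    by_contra hpj
    obtain ⟨n, hn⟩ := hP ⟨g, hgP⟩
    have hgn : g ^ p ^ n = 1 := congrArg Subtype.val hn
    have hcop : j.Coprime (orderOf g) := by
      refine Nat.Coprime.coprime_dvd_right (orderOf_dvd_of_pow_eq_one hgn) ?_
      exact (Nat.Coprime.pow_left n ((Nat.Prime.coprime_iff_not_dvd Fact.out).mpr hpj)).symm
    obtain ⟨m, hm⟩ := exists_pow_eq_self_of_coprime hcop
    refine hlt.not_ge ?_
    rw [Subgroup.zpowers_le]
    exact Subgroup.mem_zpowers_iff.mpr ⟨m, by rw [zpow_natCast, hm]⟩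
  obtain ⟨i, rfl⟩ := hpj
  rw [pow_mul] at hh1 ⊢
  have hgp : g ^ p ≠ 1 := fun h => hh1 (by rw [h, one_pow])
  exact (hgrow g hgP hgp).trans (ramIndex_le_of_mem_zpowers hφ hh1
    (Subgroup.pow_mem _ (Subgroup.mem_zpowers _) i))

theorem fixCount_le_card [Finite G] (T : Subgroup G) (S : Type*) [Finite S] [MulAction G S] :
    fixCount T S ≤ Nat.card S :=
  Finite.card_subtype_le _

theorem fixCount_eq_zero_of_notMem {S : Type*} [MulAction G S]
    (hstab : ∀ s : S, IsCyclic (MulAction.stabilizer G s)) {U : Subgroup G} (hU : U ≤ P)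
    (hne : U ≠ ⊥) (h : U ∉ nontrivialCyclic P) : fixCount U S = 0 := by
  have : IsEmpty {s : S // U ≤ MulAction.stabilizer G s} := ⟨fun s => h <| by
    have := hstab s.1
    exact mem_nontrivialCyclic hU hne (isCyclic_of_le_isCyclic s.2)⟩
  exact Nat.card_of_isEmpty

/-- A `p'`-element `x` of a subgroup `N` which generates `N` modulo `N ⊓ P`. -/
theorem exists_orderOf_mul_card_eq [Finite G] {p : ℕ} [Fact p.Prime] [P.Normal] (hP : IsPGroup p P)
    (hC : IsCyclic C) (hcop : (Nat.card C).Coprime p) (hPC : P.IsComplement' C) (N : Subgroup G) :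
    ∃ x ∈ N, (orderOf x).Coprime p ∧
      Nat.card N = Nat.card (P ⊓ N : Subgroup G) * orderOf x := by
  let f : N →* G ⧸ P := (QuotientGroup.mk' P).comp N.subtype
  have hcyc : IsCyclic (G ⧸ P) := isCyclic_of_surjective hPC.symm.QuotientMulEquiv.symm
    hPC.symm.QuotientMulEquiv.symm.surjective
  obtain ⟨⟨_, y, rfl⟩, hy⟩ := (inferInstance : IsCyclic f.range).exists_generator
  have hn : orderOf (f y) = Nat.card f.range := by
    rw [← orderOf_eq_card_of_forall_mem_zpowers hy, ← Subgroup.orderOf_coe]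
  have hnC : orderOf (f y) ∣ Nat.card C := by
    rw [← Nat.card_congr hPC.symm.QuotientMulEquiv.toEquiv]
    exact orderOf_dvd_natCard _
  have hker : Nat.card f.ker = Nat.card (P ⊓ N : Subgroup G) := by
    have h1 : f.ker = P.subgroupOf N := by
      ext v
      rw [MonoidHom.mem_ker, Subgroup.mem_subgroupOf]
      exact QuotientGroup.eq_one_iff (v : G)
    rw [h1, ← Subgroup.inf_subgroupOf_right]
    exact Nat.card_congr (Subgroup.subgroupOfEquivOfLe inf_le_right).toEquiv
  have hcard : Nat.card N = Nat.card f.ker * Nat.card f.range := by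
    rw [Subgroup.card_eq_card_quotient_mul_card_subgroup f.ker, mul_comm,
      Nat.card_congr (QuotientGroup.quotientKerEquivRange f).toEquiv]
  have hord : orderOf ((y : G) ^ Nat.card P) = orderOf (f y) := by
    refine Nat.dvd_antisymm (orderOf_dvd_of_pow_eq_one ?_) ?_
    · have h1 : (y : G) ^ orderOf (f y) ∈ P := by
        rw [← QuotientGroup.eq_one_iff, QuotientGroup.mk_pow]
        exact pow_orderOf_eq_one (f y)
      rw [← pow_mul, mul_comm, pow_mul]
      exact congrArg Subtype.val (pow_card_eq_one' (x := (⟨_, h1⟩ : P)))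
    · have h2 : orderOf (f y ^ Nat.card P) = orderOf (f y) :=
        Nat.Coprime.orderOf_pow (Nat.Coprime.coprime_dvd_left hnC (coprime_card hP hcop))
      rw [← h2]
      exact orderOf_map_dvd (QuotientGroup.mk' P) ((y : G) ^ Nat.card P)
  refine ⟨(y : G) ^ Nat.card P, N.pow_mem y.2 _, ?_, ?_⟩
  · rw [hord]; exact Nat.Coprime.coprime_dvd_left hnC hcop
  · rw [hcard, hker, hord, hn]

open Classical in
/-- The divisibility by the order of an element `x` that normalizes `T`: conjugation by `x` permutes
the terms of the sum, and the term at `g` is divisible by the order of the stabilizer of `g`. -/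
theorem orderOf_dvd_sum_of_normalizes [Fintype G] {T : Subgroup G} {F : Subgroup G → ℕ}
    {𝒯 : Set (Subgroup G)} (hconj : ∀ g, ∀ T ∈ 𝒯, conjBy g T ∈ 𝒯)
    (hFconj : ∀ g, ∀ T ∈ 𝒯, F (conjBy g T) = F T) {x : G}
    (hx : x ∈ Subgroup.normalizer (T : Set G))
    (hF : ∀ U ∈ 𝒯, ∀ y ∈ Subgroup.zpowers x, y ∈ Subgroup.normalizer (U : Set G) →
      orderOf y ∣ F U) :
    orderOf x ∣ ∑ g : G with g ∈ Subgroup.normalizer (T : Set G) ∧ T ⊔ Subgroup.zpowers g ∈ 𝒯,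
      F (T ⊔ Subgroup.zpowers g) := by
  have hconjT : ∀ d ∈ Subgroup.zpowers x, ∀ g : G,
      T ⊔ Subgroup.zpowers (d * g * d⁻¹) = conjBy d (T ⊔ Subgroup.zpowers g) := by
    intro d hd g
    rw [conjBy_sup, conjBy_zpowers, mem_normalizer_iff_conjBy.mp (Subgroup.zpowers_le.mpr hx hd)]
  let A := {g : G // g ∈ Subgroup.normalizer (T : Set G) ∧ T ⊔ Subgroup.zpowers g ∈ 𝒯}
  let _ : MulAction (Subgroup.zpowers x) A :=
    { smul := fun d a => ⟨d * a.1 * (d : G)⁻¹,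
        Subgroup.mul_mem _ (Subgroup.mul_mem _ (Subgroup.zpowers_le.mpr hx d.2) a.2.1)
          (Subgroup.inv_mem _ (Subgroup.zpowers_le.mpr hx d.2)), by
        rw [hconjT d d.2]
        exact hconj _ _ a.2.2⟩
      one_smul := fun a => Subtype.ext (by
        show (1 : G) * a.1 * (1 : G)⁻¹ = a.1
        simp)
      mul_smul := fun d e a => Subtype.ext (by
        show (d * e : G) * a.1 * (d * e : G)⁻¹ = d * (e * a.1 * (e : G)⁻¹) * (d : G)⁻¹
        group) }
  have hsmul : ∀ (d : Subgroup.zpowers x) (a : A), (d • a).1 = d * a.1 * (d : G)⁻¹ :=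
    fun _ _ => rfl
  have h := card_dvd_sum_of_stabilizer (D := Subgroup.zpowers x) (A := A)
    (fun a => F (T ⊔ Subgroup.zpowers a.1)) (fun d a => by
      rw [hsmul, hconjT d d.2, hFconj _ _ a.2.2]) (fun a => ?_)
  · rw [Nat.card_zpowers] at h
    rwa [← Finset.sum_subtype_eq_sum_filter, Finset.subtype_univ]
  · obtain ⟨⟨y, hy⟩, hygen⟩ := (inferInstance :
      IsCyclic (MulAction.stabilizer (Subgroup.zpowers x) a)).exists_generator
    rw [← orderOf_eq_card_of_forall_mem_zpowers hygen, ← Subgroup.orderOf_coe,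
      ← Subgroup.orderOf_coe]
    refine hF _ a.2.2 y y.2 ?_
    have h1 : (y : G) * a.1 * (y : G)⁻¹ = a.1 := congrArg Subtype.val hy
    rw [mem_normalizer_iff_conjBy, ← hconjT y y.2, h1]

section

variable [Fintype G]

open Classical in
/-- The divisibility by the order of the `p`-part of the normalizer. -/
theorem card_inf_normalizer_dvd_sum {S : Type*} [Finite S] [MulAction G S]
    (hstab : ∀ s : S, IsCyclic (MulAction.stabilizer G s)) {T : Subgroup G}
    (hT : T ∈ nontrivialCyclic P)
    (hle : ∀ U ∈ nontrivialCyclic P, fixCount U S ≤ cyclicRam φ U)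
    (hdvd : ∀ U ∈ nontrivialCyclic P, Nat.card P ∣ cyclicRam φ U) :
    Nat.card (P ⊓ Subgroup.normalizer (T : Set G) : Subgroup G) ∣
      ∑ g : G with g ∈ Subgroup.normalizer (T : Set G) ∧
          T ⊔ Subgroup.zpowers g ∈ nontrivialCyclic P,
        (cyclicRam φ (T ⊔ Subgroup.zpowers g) - fixCount (T ⊔ Subgroup.zpowers g) S) := by
  have h1 := card_dvd_sum_fixCount (H := P ⊓ Subgroup.normalizer (T : Set G)) (T := T)
    inf_le_right S
  have h2 : ∑ g : G with g ∈ P ⊓ Subgroup.normalizer (T : Set G),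
        fixCount (T ⊔ Subgroup.zpowers g) S
      = ∑ g : G with g ∈ Subgroup.normalizer (T : Set G) ∧
          T ⊔ Subgroup.zpowers g ∈ nontrivialCyclic P, fixCount (T ⊔ Subgroup.zpowers g) S := by
    symm
    refine Finset.sum_subset (fun g hg => ?_) (fun g hg hg' => ?_)
    · rw [Finset.mem_filter] at hg ⊢
      exact ⟨hg.1, le_of_mem_nontrivialCyclic hg.2.2 (le_sup_right (a := T)
        (Subgroup.mem_zpowers g)), hg.2.1⟩
    · rw [Finset.mem_filter] at hg hg'
      refine fixCount_eq_zero_of_notMem hstab (P := P) (sup_le (le_of_mem_nontrivialCyclic hT)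
        (Subgroup.zpowers_le.mpr hg.2.1)) (fun h => ?_) fun h => hg' ⟨hg.1, hg.2.2, h⟩
      exact ne_bot_of_mem_nontrivialCyclic hT (le_bot_iff.mp (h ▸ le_sup_left))
  rw [h2] at h1
  rw [← Nat.dvd_add_left h1, ← Finset.sum_add_distrib]
  refine Finset.dvd_sum fun g hg => ?_
  have hg' := (Finset.mem_filter.mp hg).2.2
  rw [Nat.sub_add_cancel (hle _ hg')]
  exact (Subgroup.card_dvd_of_le inf_le_left).trans (hdvd _ hg')

/-- An action whose wild ramification indices are large, divisible and fast growing has vanishing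
Bertin obstruction. The elements outside `P` are dealt with by `S₀`, and the remaining points, with
stabilizers in `P`, are provided by `exists_gset`. -/
theorem bertinObstructionVanishes_of_ramIndex {p : ℕ} [Fact p.Prime] [CharP k p] [P.Normal]
    {S₀ : Type u} [Finite S₀] [MulAction G S₀]
    (hφ : Function.Injective φ) (hP : IsPGroup p P) (hC : IsCyclic C)
    (hcop : (Nat.card C).Coprime p)
    (hPC : P.IsComplement' C) (ha : HasUniformCyclicCentralizers P C)
    (hb : ActsByInverseTameChar P C φ)
    (hstab : ∀ s : S₀, MulAction.stabilizer G s ≠ ⊥ ∧ IsCyclic (MulAction.stabilizer G s))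
    (hone : ∀ g ∉ P, fixCount (Subgroup.zpowers g) S₀ = 1) {R : ℕ}
    (hR : 2 * (Nat.card (Subgroup G) + Nat.card S₀) ≤ R)
    (hdvd : ∀ g ∈ P, g ≠ 1 → Nat.card P ∣ ramIndex φ g)
    (hRle : ∀ g ∈ P, g ≠ 1 → R ≤ ramIndex φ g)
    (hgrow : ∀ g ∈ P, g ^ p ≠ 1 → R * ramIndex φ g ≤ ramIndex φ (g ^ p)) :
    BertinObstructionVanishes φ := by
  classical
  have hRT : ∀ U ∈ nontrivialCyclic P, R ≤ cyclicRam φ U := by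
    rintro _ ⟨t, ht, ht1, rfl⟩
    rw [cyclicRam_zpowers hφ]
    exact hRle t ht ht1
  have hle : ∀ U ∈ nontrivialCyclic P, fixCount U S₀ ≤ cyclicRam φ U := fun U hU =>
    (fixCount_le_card U S₀).trans ((by omega : Nat.card S₀ ≤ R).trans (hRT U hU))
  have hcyc : ∀ s : S₀, IsCyclic (MulAction.stabilizer G s) := fun s => (hstab s).2
  have hFconj : ∀ g, ∀ T ∈ nontrivialCyclic P,
      cyclicRam φ (conjBy g T) - fixCount (conjBy g T) S₀ = cyclicRam φ T - fixCount T S₀ := by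
    intro g T hT
    rw [cyclicRam_conjBy hφ g hT, fixCount_conjBy]
  obtain ⟨S, hS, hSact, hSstab, hSfix⟩ := exists_gset (𝒯 := nontrivialCyclic P)
    (F := fun T => cyclicRam φ T - fixCount T S₀)
    (fun g T hT => conjBy_mem_nontrivialCyclic g hT)
    (fun T hT T' hT' U h h' => mem_nontrivialCyclic_of_between hT hT' h h') hFconj
    (by
      -- with `R` twice the number of subgroups, the larger subgroups contribute at most half
      intro T hT
      set W := ∑ T' : Subgroup G with T' ∈ nontrivialCyclic P ∧ T < T',
        (cyclicRam φ T' - fixCount T' S₀) with hW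
      have h1 : R * W ≤ Nat.card (Subgroup G) * cyclicRam φ T := by
        rw [hW, Finset.mul_sum]
        refine (Finset.sum_le_card_nsmul _ _ (cyclicRam φ T) fun T' hT' => ?_).trans ?_
        · have h2 := (Finset.mem_filter.mp hT').2
          exact (Nat.mul_le_mul_left R (Nat.sub_le _ _)).trans
            (mul_cyclicRam_le hφ hP hgrow hT h2.1 h2.2)
        · rw [smul_eq_mul, Nat.card_eq_fintype_card]
          exact Nat.mul_le_mul_right _ (Finset.card_le_univ _)
      have h3 : Nat.card (Subgroup G) * (2 * W) ≤ Nat.card (Subgroup G) * cyclicRam φ T := by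
        refine le_trans ?_ h1
        rw [← mul_assoc]
        exact Nat.mul_le_mul_right _ (by omega)
      have h4 := Nat.le_of_mul_le_mul_left h3 Nat.card_pos
      have h5 := fixCount_le_card T S₀
      have h6 := hRT T hT
      show W ≤ cyclicRam φ T - fixCount T S₀
      omega)
    (by
      -- the `p`-part and the `p'`-part of the order of the normalizer are treated separately
      intro T hT
      obtain ⟨x, hxN, hxcop, hcard⟩ := exists_orderOf_mul_card_eq hP hC hcop hPC
        (Subgroup.normalizer (T : Set G))
      rw [hcard]
      refine Nat.Coprime.mul_dvd_of_dvd_of_dvd ?_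
        (card_inf_normalizer_dvd_sum hcyc hT hle ?_) ?_
      · exact Nat.Coprime.coprime_dvd_left (Subgroup.card_dvd_of_le inf_le_left)
          (coprime_card hP hxcop).symm
      · rintro _ ⟨t, ht, ht1, rfl⟩
        rw [cyclicRam_zpowers hφ]
        exact hdvd t ht ht1
      · refine orderOf_dvd_sum_of_normalizes (𝒯 := nontrivialCyclic P)
          (F := fun T => cyclicRam φ T - fixCount T S₀)
          (fun g T hT => conjBy_mem_nontrivialCyclic g hT) hFconj hxN ?_
        intro U hU y hy hyU
        have hU' := hle U hU
        obtain ⟨t, ht, ht1, rfl⟩ := hU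
        refine (Nat.modEq_iff_dvd' hU').mp ?_
        rw [cyclicRam_zpowers hφ]
        refine fixCount_modEq_ramIndex hφ hP hC hcop hPC ha hb hcyc hone ht ht1 ?_ hyU
        exact Nat.Coprime.coprime_dvd_left (orderOf_dvd_of_mem_zpowers hy) hxcop)
  refine bertinObstructionVanishes_of_gset (S := S₀ ⊕ S) ?_ ?_
  · rintro (s | s)
    · have : MulAction.stabilizer G (Sum.inl s : S₀ ⊕ S) = MulAction.stabilizer G s := by
        ext g; simp [MulAction.mem_stabilizer_iff]
      rw [this]
      exact hstab s
    · have : MulAction.stabilizer G (Sum.inr s : S₀ ⊕ S) = MulAction.stabilizer G s := by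
        ext g; simp [MulAction.mem_stabilizer_iff]
      rw [this]
      exact ⟨ne_bot_of_mem_nontrivialCyclic (hSstab s),
        isCyclic_of_mem_nontrivialCyclic (hSstab s)⟩
  · intro g hg
    rw [fixCount_sum]
    by_cases hgP : g ∈ P
    · have hmem : Subgroup.zpowers g ∈ nontrivialCyclic P := ⟨g, hgP, hg, rfl⟩
      rw [hSfix _ hmem, Nat.add_sub_cancel' (hle _ hmem), cyclicRam_zpowers hφ]
    · have hempty : IsEmpty {s : S // Subgroup.zpowers g ≤ MulAction.stabilizer G s} :=
        ⟨fun s => hgP (le_of_mem_nontrivialCyclic (hSstab s.1)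
          (s.2 (Subgroup.mem_zpowers g)))⟩
      have h0 : fixCount (Subgroup.zpowers g) S = 0 := Nat.card_of_isEmpty
      rw [hone g hgP, h0, ramIndex_of_tameChar_ne_one]
      exact fun h => hgP ((tameChar_eq_one_iff hφ hP hcop hPC g).mp h)

end

end wild

/-! ### Green–Matignon groups have vanishing Bertin obstruction -/

section ifDirection

universe u

variable {p : ℕ} [Fact p.Prime] {k : Type*} [Field k] [CharP k p] {G : Type u} [Group G] [Finite G]
  {P C : Subgroup G} {φ : G →* AutPowerSeries k}

/-- An element of order prime to `p` whose nontrivial powers do not centralize an element of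
`p`-power order, and which normalizes the subgroup that this element generates, has order dividing
`p - 1`. -/
theorem orderOf_dvd_sub_one {t x : G} {n a : ℕ} (ht : orderOf t = p ^ n)
    (hx : (orderOf x).Coprime p)
    (hxt : Subgroup.zpowers x ⊓ Subgroup.centralizer (Subgroup.zpowers t : Set G) = ⊥)
    (ha : x * t * x⁻¹ = t ^ a) : orderOf x ∣ p - 1 := by
  have hcop : a.Coprime (p ^ n) := by
    have h1 : orderOf (t ^ a) = orderOf t := by
      rw [← ha]; exact (MulAut.conj x).orderOf_eq t
    rw [orderOf_pow, ht] at h1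
    have h2 := Nat.div_mul_cancel (Nat.gcd_dvd_left (p ^ n) a)
    rw [h1] at h2
    rw [Nat.coprime_comm, Nat.Coprime]
    exact Nat.eq_of_mul_eq_mul_left (pow_pos (Fact.out : p.Prime).pos n) (h2.trans (mul_one _).symm)
  have h3 := conj_pow_eq_pow_pow ha (p ^ n).totient
  have ht' : t ^ a ^ (p ^ n).totient = t ^ 1 := by
    rw [pow_eq_pow_iff_modEq, ht]
    exact Nat.ModEq.pow_totient hcop
  rw [ht', pow_one, mul_inv_eq_iff_eq_mul] at h3
  have h4 : x ^ (p ^ n).totient = 1 := by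
    rw [← Subgroup.mem_bot, ← hxt]
    exact ⟨Subgroup.pow_mem _ (Subgroup.mem_zpowers x) _, mem_centralizer_zpowers.mpr h3.symm⟩
  have h5 := orderOf_dvd_of_pow_eq_one h4
  rcases Nat.eq_zero_or_pos n with rfl | hn
  · rw [pow_zero, Nat.totient_one, Nat.dvd_one] at h5
    rw [h5]; exact one_dvd _
  · rw [Nat.totient_prime_pow Fact.out hn] at h5
    exact (hx.pow_right (n - 1)).dvd_of_dvd_mul_left h5

/-- The reduction of a faithful `p`-adic character of a group of order dividing `p - 1` is
faithful. -/
theorem injective_residueChar {B : Type*} [Group B] (hB : Nat.card B ∣ p - 1)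
    {Θ : B →* ℤ_[p]ˣ} (hΘ : Function.Injective Θ) :
    Function.Injective ((Units.map (residueHom p k : ℤ_[p] →* k)).comp Θ) := by
  have hp1 : p - 1 ≠ 0 := by have := (Fact.out : p.Prime).two_le; omega
  have hp1k : ((p - 1 : ℕ) : k) ≠ 0 := by
    rw [Ne, CharP.cast_eq_zero_iff k p]
    exact fun h => absurd (Nat.le_of_dvd (Nat.pos_of_ne_zero hp1) h) (by omega)
  rw [injective_iff_map_eq_one]
  intro x hx
  have h1 : residueHom p k (Θ x : ℤ_[p]) = 1 := congrArg Units.val hx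
  have h2 : x ^ (p - 1) = 1 := orderOf_dvd_iff_pow_eq_one.mp ((orderOf_dvd_natCard x).trans hB)
  have h3 : (Θ x : ℤ_[p]) = 1 := by
    refine eq_of_residueHom_eq (residueHom p k) hp1k (by rw [h1]; exact one_ne_zero)
      (by rw [h1, map_one]) ?_
    rw [← Units.val_pow_eq_pow_val, ← map_pow, h2, map_one, Units.val_one, one_pow]
  exact hΘ ((Units.ext h3).trans (map_one Θ).symm)

/-- The elements of `C` concerned automatically lie in `B`, as they act faithfully on a cyclic
`p`-group. -/
theorem actsByInverseTameChar_of_padicPow (hP : IsPGroup p P) (hcop : (Nat.card C).Coprime p)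
    {B : Subgroup G} (hB : IsGreatest {H : Subgroup G | H ≤ C ∧ Nat.card H ∣ p - 1} B)
    {Θ : B →* ℤ_[p]ˣ}
    (hΘ : ∀ x : B, residueHom p k (Θ x : ℤ_[p]) * tameChar φ (x : G) = 1)
    (hb : ∀ T : Subgroup G, T ≤ P → IsCyclic T → C ⊓ Subgroup.centralizer (T : Set G) = ⊥ →
      ∀ x : B, (x : G) ∈ Subgroup.normalizer (T : Set G) →
        ∀ y ∈ T, (x : G) * y * (x : G)⁻¹ = padicPow p y (Θ x : ℤ_[p])) :
    ActsByInverseTameChar P C φ := by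
  intro x hx t ht ht1 hCT a ha
  obtain ⟨n, hn⟩ : ∃ n, orderOf t = p ^ n := by
    obtain ⟨n, hn⟩ := hP ⟨t, ht⟩
    obtain ⟨m, -, hm⟩ := (Nat.dvd_prime_pow Fact.out).mp
      (orderOf_dvd_of_pow_eq_one (show t ^ p ^ n = 1 from congrArg Subtype.val hn))
    exact ⟨m, hm⟩
  have hn0 : n ≠ 0 := by
    rintro rfl
    exact ht1 (orderOf_eq_one_iff.mp (by rw [hn, pow_zero]))
  have hxC : Subgroup.zpowers x ≤ C := Subgroup.zpowers_le.mpr hx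
  have hxB : x ∈ B := by
    refine hB.2 ⟨hxC, ?_⟩ (Subgroup.mem_zpowers x)
    rw [Nat.card_zpowers]
    refine orderOf_dvd_sub_one hn
      (Nat.Coprime.coprime_dvd_left (Subgroup.orderOf_dvd_natCard C hx) hcop) ?_ ha
    rw [← le_bot_iff, ← hCT]
    exact inf_le_inf_right _ hxC
  have hxN : x ∈ Subgroup.normalizer (Subgroup.zpowers t : Set G) := by
    rw [mem_normalizer_iff_conjBy]
    refine Subgroup.eq_of_le_of_card_ge ?_ (card_conjBy x _).ge
    rw [conjBy_zpowers, Subgroup.zpowers_le, ha]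
    exact Subgroup.pow_mem _ (Subgroup.mem_zpowers t) a
  have h1 := hb (Subgroup.zpowers t) (Subgroup.zpowers_le.mpr ht) inferInstance hCT ⟨x, hxB⟩ hxN t
    (Subgroup.mem_zpowers t)
  rw [ha, padicPow, pow_eq_pow_iff_modEq, hn, padicValNat.prime_pow] at h1
  have h2 := hΘ ⟨x, hxB⟩
  rw [ringHom_eq_natCast_appr _ _ hn0] at h2
  rw [← h2]
  congr 1
  exact (CharP.natCast_eq_natCast' k p (h1.of_dvd (dvd_pow_self p hn0)))

theorem exists_bertinObstructionVanishes [IsAlgClosed k] [P.Normal]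
    (hP : IsPGroup p P) (hC : IsCyclic C)
    (hcop : (Nat.card C).Coprime p) (hPC : P.IsComplement' C) (h : IsGreenMatignon p P C) :
    ∃ φ : G →* AutPowerSeries k, Function.Injective φ ∧ BertinObstructionVanishes φ := by
  cases nonempty_fintype G
  obtain ⟨B, hB, Θ, hΘ, ha, hb⟩ := h
  obtain ⟨S₀, hS₀, hact, hstab, hone⟩ := exists_gset_fixCount_eq_one hP hC hcop hPC ha
  have hCk : (Nat.card C : k) ≠ 0 := by
    rw [Ne, CharP.cast_eq_zero_iff k p]
    exact (Nat.Prime.coprime_iff_not_dvd Fact.out).mp hcop.symm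
  set χ := (Units.map (residueHom p k : ℤ_[p] →* k)).comp Θ with hχ
  have hχinj : Function.Injective (χ⁻¹ : B →* kˣ) :=
    inv_injective.comp (injective_residueChar hB.1.2 hΘ)
  obtain ⟨θ, hker, hθB⟩ := exists_monoidHom_ker_eq hC hPC hCk hB.1.1 hχinj
  -- `θ` has values in the field with `p ^ f` elements
  have hf : (Nat.card C).totient ≠ 0 := (Nat.totient_pos.mpr Nat.card_pos).ne'
  have hθ : ∀ g, (θ g : k) ^ p ^ (Nat.card C).totient = θ g := by
    intro g
    have h1 : θ g ^ Nat.card C = 1 := by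
      rw [← map_pow, ← MonoidHom.mem_ker, hker]
      exact pow_card_mem hPC g
    have h2 : θ g ^ p ^ (Nat.card C).totient = θ g ^ 1 := by
      rw [pow_eq_pow_iff_modEq]
      exact (Nat.ModEq.pow_totient hcop.symm).of_dvd (orderOf_dvd_of_pow_eq_one h1)
    rw [← Units.val_pow_eq_pow_val, h2, pow_one]
  obtain ⟨φ, hφθ, hφ⟩ := exists_isStronglyRamified p hf (Nat.card_pos (α := P)).ne'
    (2 * (Nat.card (Subgroup G) + Nat.card S₀)) θ (hker ▸ hP) hθ
  have htame : ∀ g ∈ P, tameChar φ g = 1 := by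
    intro g hg
    rw [hφθ, ← MonoidHom.mem_ker, hker]
    exact hg
  have hPdvd : Nat.card P ∣ p ^ Nat.card P := by
    obtain ⟨r, hr⟩ := IsPGroup.iff_card.mp hP
    nth_rewrite 1 [hr]
    exact pow_dvd_pow p (hr ▸ (Nat.lt_pow_self (Fact.out : p.Prime).one_lt).le)
  refine ⟨φ, hφ.injective, bertinObstructionVanishes_of_ramIndex hφ.injective hP hC hcop hPC ha
    (actsByInverseTameChar_of_padicPow hP hcop hB (fun x => ?_) hb) hstab hone le_rfl
    (fun g hg hg1 => hPdvd.trans (hφ.dvd_ramIndex g hg1 (htame g hg)))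
    (fun g hg hg1 => hφ.le_ramIndex g hg1 (htame g hg))
    (fun g hg hg1 => hφ.mul_ramIndex_le g hg1 (htame g hg))⟩
  rw [hφθ, hθB]
  exact (χ x).mul_inv

end ifDirection

end BertinObstruction

end

theorem theorem1p8 {p : ℕ} [Fact p.Prime] {k : Type*} [Field k] [IsAlgClosed k] [CharP k p]
    {G : Type*} [Group G] [Finite G] (P C : Subgroup G) [P.Normal] (hP : IsPGroup p P)
    (hC : IsCyclic C) (hcop : (Nat.card C).Coprime p) (hPC : P.IsComplement' C) :
    ((∃ φ : G →* BertinObstruction.AutPowerSeries k,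
        Function.Injective φ ∧ BertinObstruction.BertinObstructionVanishes φ) ↔
      BertinObstruction.IsGreenMatignon p P C) ∧
    (BertinObstruction.IsWeakBertinGroup k G ↔ BertinObstruction.IsGreenMatignon p P C) := by
  have h : (∃ φ : G →* BertinObstruction.AutPowerSeries k,
        Function.Injective φ ∧ BertinObstruction.BertinObstructionVanishes φ) ↔
      BertinObstruction.IsGreenMatignon p P C :=
    ⟨fun ⟨_, hφ, hv⟩ =>
      BertinObstruction.isGreenMatignon_of_bertinObstructionVanishes hφ hP hC hcop hPC hv,
    BertinObstruction.exists_bertinObstructionVanishes hP hC hcop hPC⟩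
  exact ⟨h, h⟩
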